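/- Let $n>1$. Consider the equations of adiabatic gas dynamics for velocity $\mathbf u(t,\mathbf x)\in\mathbb R^n$, density $\rho(t,\mathbf x)>0$ and pressure $p(t,\mathbf x)$, $\mathbf x\in\mathbb R^n$, $$\mathbf u_t+\mathbf u\cdot\nabla\mathbf u+\tfrac1\rho\nabla p=0,\qquad \rho_t+\nabla\cdot(\rho\mathbf u)=0,\qquad p_t+\mathbf u\cdot\nabla p+F(p,\rho)\nabla\cdot\mathbf u=0,$$ where the state function $F$ is smooth on a nonempty connected open set $\Omega$ of states $(p,\rho)$ with $\rho>0$ and does not vanish identically on any nonempty open subset of $\Omega$. A smooth function $T(t,\mathbf x,\mathbf u,\rho,p)$, defined for all $t,\mathbf x,\mathbf u$ and all $(p,\rho)\in\Omega$, is called a kinematic conserved density if there is a smooth spatial flux $\mathbf X$, a function of $t,\mathbf x,\mathbf u,\rho,p$ and finitely many $\mathbf x$-derivatives of $\mathbf u,\rho,p$, such that $D_tT+D_{\mathbf x}\cdot\mathbf X=0$ holds formally on all solutions (that is, identically in the spatial jets of $\mathbf u,\rho,p$, once the time derivatives are eliminated by the equations). Every smooth function $c(t,\mathbf x)$ is such a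 density; it is called trivial. (i) For every such $F$ the following are kinematic conserved densities: mass $\rho$, momentum $\rho u^i$, angular momentum $\rho(u^ix^j-u^jx^i)$, Galilean momentum $\rho(tu^i-x^i)$, energy $\rho(\tfrac12|\mathbf u|^2+e)$, where $e(p,\rho)$ is any solution of $\rho e_\rho+F e_p=p/\rho$ on $\Omega$, and volumetric entropy $\rho S$, where $S(p,\rho)$ is any solution of $\rho S_\rho+F S_p=0$ on $\Omega$; likewise their linear combinations. For general $F$, namely whenever $F$ is not of the form in (ii), every kinematic conserved density is, up to a trivial one, a linear combination of these, in which for $e$ one may take any given solution (the energy term occurring only if a solution $e$ exists on $\Omega$). (ii) Additional kinematic conserved densities exist if and only if, modulo a constant shift of the pressure, $F$ is the polytropic state function with dimension-dependent coefficient, i.e. $F=\gamma(p-p_0)$ on $\Omega$ with $\gamma=1+2/n$ and some constant $p_0$. In this case the kinematic conserved densities are exactly the linear combinations of those in (i), of the similarity energy $tE-\tfrac12\rho\,\mathbf u\cdot\mathbf x$ and of the dilational energy $t^2E-t\rho\,\mathbf u\cdot\mathbf x+\tfrac12\rho|\mathbf x|^2$, up to trivial ones, where $E=\tfrac12\rho|\mathbf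 u|^2+\tfrac n2(p-p_0)$ is the polytropic energy density. -/

import Mathlib

open scoped ContDiff

noncomputable section

namespace GasDynamics

/-- The flow domain `ℝⁿ` with its Euclidean structure (also the space of velocities). -/
abbrev Space (n : ℕ) := EuclideanSpace ℝ (Fin n)

/-- Spatial divergence of a vector field on `ℝⁿ`. -/
def divergence {n : ℕ} (v : Space n → Space n) (x : Space n) : ℝ :=
  ∑ i : Fin n, (fderiv ℝ v x (EuclideanSpace.single i 1)) i

/-- Smooth fluid variables `(u, ρ, p)` on space, at a fixed time, with thermodynamic state
`(p, ρ)` in the region `Ω`. Their spatial Taylor coefficients at a point are arbitrary, so an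
identity which holds for all of them is an identity in the spatial jet variables. -/
structure FluidField (n : ℕ) (Ω : Set (ℝ × ℝ)) where
  u : Space n → Space n
  ρ : Space n → ℝ
  p : Space n → ℝ
  smooth_u : ContDiff ℝ ∞ u
  smooth_ρ : ContDiff ℝ ∞ ρ
  smooth_p : ContDiff ℝ ∞ p
  mem : ∀ x, (p x, ρ x) ∈ Ω

namespace FluidField

variable {n : ℕ} {Ω : Set (ℝ × ℝ)}

/-- The value of `∂ₜu` given by `∂ₜu + u·∇u + (1/ρ)∇p = 0`. -/
def uDot (φ : FluidField n Ω) (x : Space n) : Space n :=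
  -(fderiv ℝ φ.u x (φ.u x)) - (1 / φ.ρ x) • gradient φ.p x

/-- The value of `∂ₜρ` given by `∂ₜρ + ∇·(ρu) = 0`. -/
def ρDot (φ : FluidField n Ω) (x : Space n) : ℝ :=
  -divergence (fun y => φ.ρ y • φ.u y) x

/-- The value of `∂ₜp` given by `∂ₜp + u·∇p + F(p,ρ) ∇·u = 0`. -/
def pDot (F : ℝ × ℝ → ℝ) (φ : FluidField n Ω) (x : Space n) : ℝ :=
  -(inner ℝ (φ.u x) (gradient φ.p x)) - F (φ.p x, φ.ρ x) * divergence φ.u x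

end FluidField

/-- Spatial jets of order at most `k` of the fluid variables `(u, ρ, p)`. -/
abbrev Jet (n k : ℕ) :=
  (j : Fin (k + 1)) → (Space n) [×(j : ℕ)]→L[ℝ] (Space n × ℝ × ℝ)

/-- The `k`-jet at `x` of fluid variables. -/
def FluidField.jet {n : ℕ} {Ω : Set (ℝ × ℝ)} (k : ℕ) (φ : FluidField n Ω) (x : Space n) :
    Jet n k :=
  fun j => iteratedFDeriv ℝ (j : ℕ) (fun y => (φ.u y, φ.ρ y, φ.p y)) x

/-- The order-zero part `(u, ρ, p)` of a jet. -/
def Jet.base {n k : ℕ} (J : Jet n k) : Space n × ℝ × ℝ := J 0 (fun _ => 0)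

/-- Arguments `(t, x, jet)` whose thermodynamic state `(p, ρ)` lies in `Ω`. -/
def jetDomain (n k : ℕ) (Ω : Set (ℝ × ℝ)) : Set (ℝ × Space n × Jet n k) :=
  {q | ((Jet.base q.2.2).2.2, (Jet.base q.2.2).2.1) ∈ Ω}

/-- Functions `T(t, x, u, ρ, p)` of kinematic form. -/
abbrev KinematicFunction (n : ℕ) := ℝ → Space n → Space n → ℝ → ℝ → ℝ

/-- `T(t, x, u, ρ, p)` is smooth for all `t, x, u` and all `(p, ρ) ∈ Ω`. -/
def KinematicFunction.IsSmooth {n : ℕ} (Ω : Set (ℝ × ℝ)) (T : KinematicFunction n) : Prop :=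
  ContDiffOn ℝ ∞
    (fun q : ℝ × Space n × Space n × ℝ × ℝ => T q.1 q.2.1 q.2.2.1 q.2.2.2.1 q.2.2.2.2)
    {q | (q.2.2.2.2, q.2.2.2.1) ∈ Ω}

/-- The total time derivative of `T` evaluated on solutions: time derivatives of the fluid
variables are eliminated by means of the gas dynamics equations. -/
def totalTimeDeriv {n : ℕ} {Ω : Set (ℝ × ℝ)} (F : ℝ × ℝ → ℝ) (T : KinematicFunction n)
    (φ : FluidField n Ω) (t : ℝ) (x : Space n) : ℝ :=
  deriv (fun s => T s x (φ.u x) (φ.ρ x) (φ.p x)) t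
    + fderiv ℝ (fun v => T t x v (φ.ρ x) (φ.p x)) (φ.u x) (φ.uDot x)
    + deriv (fun r => T t x (φ.u x) r (φ.p x)) (φ.ρ x) * φ.ρDot x
    + deriv (fun q => T t x (φ.u x) (φ.ρ x) q) (φ.p x) * φ.pDot F x

/-- `T(t, x, u, ρ, p)` is a kinematic conserved density of the gas dynamics equations with
state function `F` on `Ω`: for some smooth spatial flux `X`, depending on `t`, `x` and on
`u, ρ, p` with their spatial derivatives up to a finite order, `D_t T + D_x · X = 0` holds
formally on all solutions. -/
def IsConservedDensity {n : ℕ} (F : ℝ × ℝ → ℝ) (Ω : Set (ℝ × ℝ)) (T : KinematicFunction n) :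
    Prop :=
  T.IsSmooth Ω ∧
    ∃ (k : ℕ) (X : ℝ × Space n × Jet n k → Space n),
      ContDiffOn ℝ ∞ X (jetDomain n k Ω) ∧
      ∀ (φ : FluidField n Ω) (t : ℝ) (x : Space n),
        totalTimeDeriv F T φ t x + divergence (fun y => X (t, y, φ.jet k y)) x = 0

/-- `S(p, ρ)` is a solution on `Ω` of `ρ S_ρ + F S_p = 0`. -/
def IsEntropy (F : ℝ × ℝ → ℝ) (Ω : Set (ℝ × ℝ)) (S : ℝ × ℝ → ℝ) : Prop :=
  ContDiffOn ℝ ∞ S Ω ∧ ∀ p ρ : ℝ, (p, ρ) ∈ Ω →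
    ρ * deriv (fun r => S (p, r)) ρ + F (p, ρ) * deriv (fun q => S (q, ρ)) p = 0

/-- `e(p, ρ)` is a solution on `Ω` of `ρ e_ρ + F e_p = p / ρ`. -/
def IsInternalEnergy (F : ℝ × ℝ → ℝ) (Ω : Set (ℝ × ℝ)) (e : ℝ × ℝ → ℝ) : Prop :=
  ContDiffOn ℝ ∞ e Ω ∧ ∀ p ρ : ℝ, (p, ρ) ∈ Ω →
    ρ * deriv (fun r => e (p, r)) ρ + F (p, ρ) * deriv (fun q => e (q, ρ)) p = p / ρ

section Densities

variable {n : ℕ}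

def mass : KinematicFunction n := fun _ _ _ ρ _ => ρ

def momentum (i : Fin n) : KinematicFunction n := fun _ _ u ρ _ => ρ * u i

def angularMomentum (i j : Fin n) : KinematicFunction n :=
  fun _ x u ρ _ => ρ * (u i * x j - u j * x i)

def galileanMomentum (i : Fin n) : KinematicFunction n :=
  fun t x u ρ _ => ρ * (t * u i - x i)

def energy (e : ℝ × ℝ → ℝ) : KinematicFunction n :=
  fun _ _ u ρ p => ρ * (1 / 2 * ‖u‖ ^ 2 + e (p, ρ))

def volumetricEntropy (S : ℝ × ℝ → ℝ) : KinematicFunction n :=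
  fun _ _ _ ρ p => ρ * S (p, ρ)

/-- The polytropic energy density `E = ½ρ|u|² + (n/2)(p - p₀)`, the pressure being counted
from `p₀`. -/
def polytropicEnergy (p₀ : ℝ) : KinematicFunction n :=
  fun _ _ u ρ p => 1 / 2 * ρ * ‖u‖ ^ 2 + (n : ℝ) / 2 * (p - p₀)

/-- `t E - ½ρ u·x`. -/
def similarityEnergy (p₀ : ℝ) : KinematicFunction n :=
  fun t x u ρ p => t * polytropicEnergy p₀ t x u ρ p - 1 / 2 * ρ * inner ℝ u x

/-- `t² E - t ρ u·x + ½ρ|x|²`. -/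
def dilationalEnergy (p₀ : ℝ) : KinematicFunction n :=
  fun t x u ρ p => t ^ 2 * polytropicEnergy p₀ t x u ρ p - t * ρ * inner ℝ u x
    + 1 / 2 * ρ * ‖x‖ ^ 2

end Densities

/-- On `Ω`, `T` is a linear combination of mass, momentum, angular momentum, Galilean momentum,
energy (formed with `e`) and volumetric entropy (formed with some solution `S` of the entropy
equation), up to a trivial density `c(t, x)`, which does not involve the fluid variables.
If the energy occurs, then `e` has to solve the thermodynamic energy equation. -/
def IsBasicCombination {n : ℕ} (F : ℝ × ℝ → ℝ) (Ω : Set (ℝ × ℝ)) (e : ℝ × ℝ → ℝ)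
    (T : KinematicFunction n) : Prop :=
  ∃ (m : ℝ) (a : Fin n → ℝ) (A : Fin n → Fin n → ℝ) (g : Fin n → ℝ) (b : ℝ)
    (S : ℝ × ℝ → ℝ) (c : ℝ × Space n → ℝ),
    (b ≠ 0 → IsInternalEnergy F Ω e) ∧ IsEntropy F Ω S ∧ ContDiff ℝ ∞ c ∧
    ∀ (t : ℝ) (x u : Space n) (ρ p : ℝ), (p, ρ) ∈ Ω →
      T t x u ρ p =
        m * mass t x u ρ p
        + ∑ i, a i * momentum i t x u ρ p
        + ∑ i, ∑ j, A i j * angularMomentum i j t x u ρ p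
        + ∑ i, g i * galileanMomentum i t x u ρ p
        + b * energy e t x u ρ p
        + volumetricEntropy S t x u ρ p
        + c (t, x)

/-- On `Ω`, `F = γ(p - p₀)` with `γ = 1 + 2/n`. -/
def IsSpecialPolytropic (n : ℕ) (F : ℝ × ℝ → ℝ) (Ω : Set (ℝ × ℝ)) (p₀ : ℝ) : Prop :=
  ∀ p ρ : ℝ, (p, ρ) ∈ Ω → F (p, ρ) = (1 + 2 / (n : ℝ)) * (p - p₀)

end GasDynamics

end

/-!
Integrating `D_t T + D_x · X = 0` over compactly supported perturbations of fluid fields shows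
that `D_t T`, which is affine in the first derivatives of the fluid variables, is a null
Lagrangian. Its Euler–Lagrange equations are relations among the derivatives of `T` in the
differential ring of smooth functions of `(t, x, u, ρ, p)`. For `n > 1` they say that the Legendre
quantity `ρ T_ρ + F T_p - T` depends on the fluid variables only through `p`, affinely and with a
slope `β(t)`, and that `T_u / ρ = β u + P` with a conformal Killing field `P(t, x)` of factor
`-β'`. If `β'` is not identically zero, compatibility of these equations forces `F_p = 1 + 2/n`
and `F_ρ = 0`; then `β` is quadratic in `t`, and subtracting similarity and dilational energies
makes it constant. If `β` is constant, then `P` is a Killing field, affine in `t`, and what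
remains of `T`, up to a trivial density, is `ρ` times a solution of the energy equation with
right-hand side `β p / ρ`.
-/

noncomputable section

namespace GasDynamics

/-! ### The differential algebra of smooth functions on an open set -/

section SmoothAlgebra

/-- Extension by zero of a function on a subset. -/
def extendZero {Z : Type*} {D : Set Z} (f : D → ℝ) (q : Z) : ℝ :=
  open Classical in if h : q ∈ D then f ⟨q, h⟩ else 0

@[simp] lemma extendZero_of_mem {Z : Type*} {D : Set Z} (f : D → ℝ) {q : Z} (h : q ∈ D) :
    extendZero f q = f ⟨q, h⟩ := by
  simp [extendZero, h]

variable {Z : Type*} [NormedAddCommGroup Z] [NormedSpace ℝ Z]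

/-- The smooth functions on a subset `D`, as a subalgebra of all functions on `D`. -/
def smoothAlgebra (D : Set Z) : Subalgebra ℝ (D → ℝ) where
  carrier := {f | ContDiffOn ℝ ∞ (extendZero f) D}
  mul_mem' {f g} hf hg := (ContDiffOn.mul hf hg).congr fun q hq => by simp [hq]
  add_mem' {f g} hf hg := (ContDiffOn.add hf hg).congr fun q hq => by simp [hq]
  algebraMap_mem' r := (contDiffOn_const (c := r)).congr fun q hq => by simp [hq]

variable {D : Set Z}

-- Unifying the default instance, stated over `Subalgebra.toSemiring`, with the semiring underlying
-- the commutative ring structure is slow.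
instance : @Algebra ℝ (smoothAlgebra D) _ CommRing.toCommSemiring.toSemiring :=
  (smoothAlgebra D).algebra

lemma contDiffOn_extendZero (f : smoothAlgebra D) : ContDiffOn ℝ ∞ (extendZero f.1) D := f.2

lemma differentiableAt_extendZero (hD : IsOpen D) (f : smoothAlgebra D) (q : D) :
    DifferentiableAt ℝ (extendZero f.1) q :=
  (f.2.contDiffAt (hD.mem_nhds q.2)).differentiableAt (by simp)

/-- The restriction to `D` of a function which is smooth on `D`. -/
def restrictSmooth (f : Z → ℝ) (hf : ContDiffOn ℝ ∞ f D) : smoothAlgebra D :=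
  ⟨fun q => f q, hf.congr fun q hq => by simp [hq]⟩

@[simp] lemma restrictSmooth_apply (f : Z → ℝ) (hf : ContDiffOn ℝ ∞ f D) (q : D) :
    (restrictSmooth f hf).1 q = f q := rfl

lemma restrictSmooth_extendZero (f : smoothAlgebra D) :
    restrictSmooth (extendZero f.1) (contDiffOn_extendZero f) = f := by
  ext q
  simp

lemma contDiffOn_fderiv_apply (hD : IsOpen D) {f : Z → ℝ} (hf : ContDiffOn ℝ ∞ f D) (v : Z) :
    ContDiffOn ℝ ∞ (fun q => fderiv ℝ f q v) D :=
  (hf.fderiv_of_isOpen hD (by simp)).clm_apply contDiffOn_const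

lemma fderiv_extendZero (hD : IsOpen D) {f : D → ℝ} {g : Z → ℝ} (h : ∀ q : D, f q = g q)
    (q : D) : fderiv ℝ (extendZero f) q = fderiv ℝ g q := by
  refine Filter.EventuallyEq.fderiv_eq ?_
  filter_upwards [hD.mem_nhds q.2] with y hy
  simpa [hy] using h ⟨y, hy⟩

/-- The derivative of a smooth function in a constant direction. -/
def smoothDeriv (hD : IsOpen D) (v : Z) : Derivation ℝ (smoothAlgebra D) (smoothAlgebra D) where
  toFun f := restrictSmooth (fun q => fderiv ℝ (extendZero f.1) q v)
    (contDiffOn_fderiv_apply hD f.2 v)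
  map_add' f g := by
    ext q
    have := fderiv_extendZero hD (f := f.1 + g.1) (g := extendZero f.1 + extendZero g.1)
      (by simp) q
    simp [this, fderiv_add (differentiableAt_extendZero hD f q)
      (differentiableAt_extendZero hD g q)]
  map_smul' c f := by
    ext q
    have := fderiv_extendZero hD (f := c • f.1) (g := c • extendZero f.1) (by simp) q
    simp [this, fderiv_const_smul (differentiableAt_extendZero hD f q)]
  map_one_eq_zero' := by
    ext q
    have := fderiv_extendZero hD (f := (1 : D → ℝ)) (g := fun _ => 1) (by simp) q
    simp [this]
  leibniz' f g := by
    ext q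
    have := fderiv_extendZero hD (f := f.1 * g.1) (g := extendZero f.1 * extendZero g.1)
      (by simp) q
    simp [this, fderiv_mul (differentiableAt_extendZero hD f q)
      (differentiableAt_extendZero hD g q)]

lemma smoothDeriv_apply (hD : IsOpen D) (v : Z) (f : smoothAlgebra D) (q : D) :
    (smoothDeriv hD v f).1 q = fderiv ℝ (extendZero f.1) q v := rfl

lemma smoothDeriv_restrictSmooth (hD : IsOpen D) (v : Z) {f : Z → ℝ} (hf : ContDiffOn ℝ ∞ f D) :
    smoothDeriv hD v (restrictSmooth f hf) =
      restrictSmooth (fun q => fderiv ℝ f q v) (contDiffOn_fderiv_apply hD hf v) := by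
  ext q
  rw [smoothDeriv_apply, fderiv_extendZero hD (restrictSmooth_apply f hf), restrictSmooth_apply]

lemma smoothDeriv_comm (hD : IsOpen D) (v w : Z) (f : smoothAlgebra D) :
    smoothDeriv hD v (smoothDeriv hD w f) = smoothDeriv hD w (smoothDeriv hD v f) := by
  ext q
  have hf : ContDiffAt ℝ 2 (extendZero f.1) q :=
    ((contDiffOn_extendZero f).contDiffAt (hD.mem_nhds q.2)).of_le ENat.LEInfty.out
  have hf' : DifferentiableAt ℝ (fderiv ℝ (extendZero f.1)) q :=
    (hf.fderiv_right (m := 1) (by norm_num)).differentiableAt (by simp)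
  rw [← restrictSmooth_extendZero f]
  simp only [smoothDeriv_restrictSmooth, restrictSmooth_apply]
  rw [fderiv_clm_apply hf' (by fun_prop), fderiv_clm_apply hf' (by fun_prop)]
  simpa using hf.isSymmSndFDerivAt (by simp) v w

lemma smoothAlgebra_apply_eq_of_smoothDeriv_eq_zero (hD : IsOpen D) (hc : IsPreconnected D)
    (f : smoothAlgebra D) (h : ∀ v, smoothDeriv hD v f = 0) (q q' : D) : f.1 q = f.1 q' := by
  have := hD.is_const_of_fderiv_eq_zero hc (f.2.differentiableOn (by simp))
    (fun x hx => by
      ext v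
      have := congrArg (fun g : smoothAlgebra D => g.1 ⟨x, hx⟩) (h v)
      simpa [smoothDeriv_apply] using this) q.2 q'.2
  simpa using this

end SmoothAlgebra

/-! ### The determining equations in a differential ring -/

section DifferentialRing

open scoped nonZeroDivisors

lemma eq_zero_of_natCast_mul_eq_zero {A : Type*} [CommRing A] [Algebra ℝ A] {k : ℕ}
    (hk : k ≠ 0) {f : A} (h : (k : A) * f = 0) : f = 0 := by
  have : IsUnit (k : A) := by
    simpa using (isUnit_iff_ne_zero.2 (Nat.cast_ne_zero (R := ℝ).2 hk)).map (algebraMap ℝ A)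
  exact this.mul_right_eq_zero.1 h

/-- The coordinate directions of the space of `(t, x, u, ρ, p)`. -/
inductive Direction (n : ℕ) : Type
  | t : Direction n
  | x (i : Fin n) : Direction n
  | u (i : Fin n) : Direction n
  | r : Direction n
  | p : Direction n

/-- A ring with commuting derivations modelled on the smooth functions of `(t, x, u, ρ, p)`,
containing the velocity components, an invertible density and a state function of `(ρ, p)`. -/
structure StateRing (n : ℕ) (A : Type*) [CommRing A] [Algebra ℝ A] where
  D : Direction n → Derivation ℝ A A
  comm : ∀ a b f, D a (D b f) = D b (D a f)
  u : Fin n → A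
  r : A
  rinv : A
  F : A
  r_mul_rinv : r * rinv = 1
  D_t_u : ∀ j, D .t (u j) = 0
  D_x_u : ∀ i j, D (.x i) (u j) = 0
  D_u_u : ∀ i j, D (.u i) (u j) = if i = j then 1 else 0
  D_r_u : ∀ j, D .r (u j) = 0
  D_p_u : ∀ j, D .p (u j) = 0
  D_t_r : D .t r = 0
  D_x_r : ∀ i, D (.x i) r = 0
  D_u_r : ∀ i, D (.u i) r = 0
  D_r_r : D .r r = 1
  D_p_r : D .p r = 0
  D_t_F : D .t F = 0
  D_x_F : ∀ i, D (.x i) F = 0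
  D_u_F : ∀ i, D (.u i) F = 0

namespace StateRing

variable {n : ℕ} {A : Type*} [CommRing A] [Algebra ℝ A] (S : StateRing n A)

attribute [simp] D_t_u D_x_u D_u_u D_r_u D_p_u D_t_r D_x_r D_u_r D_r_r D_p_r D_t_F D_x_F D_u_F

@[simp] lemma D_ofNat (a : Direction n) (k : ℕ) [k.AtLeastTwo] : S.D a (ofNat(k) : A) = 0 :=
  (S.D a).map_natCast k

lemma D_rinv (a : Direction n) : S.D a S.rinv = -S.rinv ^ 2 * S.D a S.r := by
  have h := congrArg (S.D a) S.r_mul_rinv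
  simp only [Derivation.leibniz, smul_eq_mul, Derivation.map_one_eq_zero] at h
  linear_combination S.rinv * h - S.D a S.rinv * S.r_mul_rinv

lemma r_mul_cancel {f : A} (h : S.r * f = 0) : f = 0 := by
  linear_combination S.rinv * h - f * S.r_mul_rinv

/-- The thermodynamic derivative `ρ G_ρ + F G_p`, whose negative multiplies `∇·u` in the total
time derivative of `G`. -/
def thermal (G : A) : A := S.r * S.D .r G + S.F * S.D .p G

/-- The coefficient of `∂ᵢuʲ` in the total time derivative of `G`. -/
def coeffU (G : A) (i j : Fin n) : A :=
  -(S.u i * S.D (.u j) G) - if i = j then S.thermal G else 0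

/-- The coefficient of `∂ᵢρ` in the total time derivative of `G`. -/
def coeffR (G : A) (i : Fin n) : A := -(S.u i * S.D .r G)

/-- The coefficient of `∂ᵢp` in the total time derivative of `G`. -/
def coeffP (G : A) (i : Fin n) : A := -(S.u i * S.D .p G) - S.rinv * S.D (.u i) G

/-- The Euler–Lagrange equations of the total time derivative of `G`. -/
structure IsNull (G : A) : Prop where
  rp : ∀ i, S.D .p (S.coeffR G i) = S.D .r (S.coeffP G i)
  ur : ∀ i j, S.D .r (S.coeffU G i j) = S.D (.u j) (S.coeffR G i)
  up : ∀ i j, S.D .p (S.coeffU G i j) = S.D (.u j) (S.coeffP G i)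
  uu : ∀ i j k, S.D (.u k) (S.coeffU G i j) = S.D (.u j) (S.coeffU G i k)
  tr : S.D .r (S.D .t G) = ∑ i, S.D (.x i) (S.coeffR G i)
  tu : ∀ j, S.D (.u j) (S.D .t G) = ∑ i, S.D (.x i) (S.coeffU G i j)
  tp : S.D .p (S.D .t G) = ∑ i, S.D (.x i) (S.coeffP G i)

/-- The Legendre quantity `ρ G_ρ + F G_p - G`. -/
def legendre (G : A) : A := S.thermal G - G

/-- The `p`-derivative of the Legendre quantity; for conserved `G` it is the coefficient of
`½ρ|u|²` in `G`. -/
def energyCoeff (G : A) : A := S.D .p (S.legendre G)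

/-- The specific momentum `G_u / ρ`. -/
def specificMomentum (G : A) (j : Fin n) : A := S.rinv * S.D (.u j) G

lemma D_u_eq_r_mul_specificMomentum (G : A) (j : Fin n) :
    S.D (.u j) G = S.r * S.specificMomentum G j := by
  rw [specificMomentum]
  linear_combination -S.D (.u j) G * S.r_mul_rinv

section SubMul

variable (G : A) {P : A}

lemma D_u_sub_r_mul {j : Fin n} (hP : S.D (.u j) P = S.specificMomentum G j) :
    S.D (.u j) (G - S.r * P) = 0 := by
  simp [S.D_u_eq_r_mul_specificMomentum G j, hP]

lemma D_r_D_sub_r_mul {a : Direction n} (ha : S.D a S.r = 0) (hP : S.D .r P = 0) :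
    S.D .r (S.D a (G - S.r * P)) = S.D .r (S.D a G) - S.D a P := by
  simp [ha, S.comm .r a P, hP]

lemma D_p_D_sub_r_mul {a : Direction n} (ha : S.D a S.r = 0) (hP : S.D .p P = 0) :
    S.D .p (S.D a (G - S.r * P)) = S.D .p (S.D a G) := by
  simp [ha, S.comm .p a P, hP]

lemma legendre_sub_r_mul (hr : S.D .r P = 0) (hp : S.D .p P = 0) :
    S.legendre (G - S.r * P) = S.legendre G := by
  simp only [legendre, thermal, map_sub, Derivation.leibniz, smul_eq_mul, hr, hp, D_r_r, D_p_r]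
  ring

end SubMul

lemma energyCoeff_sub (G H : A) : S.energyCoeff (G - H) = S.energyCoeff G - S.energyCoeff H := by
  simp only [energyCoeff, legendre, thermal, ← map_sub]
  congr 1
  simp only [map_sub]
  ring

lemma D_t_legendre (G : A) : S.D .t (S.legendre G) =
    S.r * S.D .r (S.D .t G) + S.F * S.D .p (S.D .t G) - S.D .t G := by
  simp only [legendre, thermal, map_sub, map_add, Derivation.leibniz, smul_eq_mul, D_t_r, D_t_F,
    S.comm .t .r, S.comm .t .p]
  ring

variable {S} {G : A} (h : S.IsNull G)
include h

lemma IsNull.r_mul_D_r_D_u (i : Fin n) : S.r * S.D .r (S.D (.u i) G) = S.D (.u i) G := by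
  have := h.rp i
  simp only [coeffR, coeffP, map_neg, map_sub, Derivation.leibniz, smul_eq_mul, D_rinv,
    D_p_u, D_r_u, D_r_r] at this
  rw [S.comm .p .r] at this
  linear_combination S.r ^ 2 * this + (S.D (.u i) G * (S.r * S.rinv + 1)
    - S.r * S.D .r (S.D (.u i) G)) * S.r_mul_rinv

lemma IsNull.D_u_thermal (hn : 1 < n) (j : Fin n) : S.D (.u j) (S.thermal G) = S.D (.u j) G := by
  have : Nontrivial (Fin n) := Fin.nontrivial_iff_two_le.2 hn
  obtain ⟨k, hk⟩ := exists_ne j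
  have := h.uu k j k
  simp only [coeffU, map_neg, map_sub, Derivation.leibniz, smul_eq_mul, D_u_u, if_neg hk,
    if_neg hk.symm, if_true, map_zero] at this
  rw [S.comm (.u k) (.u j)] at this
  linear_combination this

lemma IsNull.D_r_thermal (hn : 1 < n) : S.D .r (S.thermal G) = S.D .r G := by
  have := h.ur ⟨0, by omega⟩ ⟨0, by omega⟩
  simp only [coeffU, coeffR, map_neg, map_sub, Derivation.leibniz, smul_eq_mul, D_u_u, if_true,
    D_r_u] at this
  rw [S.comm .r (.u _)] at this
  linear_combination -this

lemma IsNull.D_u_D_u (i j : Fin n) :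
    S.D (.u j) (S.D (.u i) G) = if i = j then S.r * S.energyCoeff G else 0 := by
  have := h.up i j
  simp only [coeffU, coeffP, map_neg, map_sub, Derivation.leibniz, smul_eq_mul, D_u_u,
    D_p_u, D_rinv, D_u_r] at this
  rw [S.comm .p (.u j)] at this
  simp only [energyCoeff, legendre, map_sub]
  by_cases hij : i = j
  · subst hij
    simp only [if_true] at this ⊢
    linear_combination S.r * this - S.D (.u i) (S.D (.u i) G) * S.r_mul_rinv
  · simp only [if_neg hij, if_neg (Ne.symm hij), map_zero] at this ⊢
    linear_combination S.r * this - S.D (.u j) (S.D (.u i) G) * S.r_mul_rinv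

lemma IsNull.D_u_legendre (hn : 1 < n) (j : Fin n) : S.D (.u j) (S.legendre G) = 0 := by
  simp [legendre, h.D_u_thermal hn]

lemma IsNull.D_r_legendre (hn : 1 < n) : S.D .r (S.legendre G) = 0 := by
  simp [legendre, h.D_r_thermal hn]

lemma IsNull.D_p_D_u (hn : 1 < n) (hF : S.F ∈ A⁰) (j : Fin n) : S.D .p (S.D (.u j) G) = 0 := by
  refine (mul_left_mem_nonZeroDivisors_eq_zero_iff hF).1 ?_
  have := h.D_u_thermal hn j
  simp only [thermal, map_add, Derivation.leibniz, smul_eq_mul, D_u_r, D_u_F] at this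
  rw [S.comm (.u j) .r, S.comm (.u j) .p] at this
  linear_combination this - h.r_mul_D_r_D_u j

lemma IsNull.D_u_energyCoeff (hn : 1 < n) (j : Fin n) : S.D (.u j) (S.energyCoeff G) = 0 := by
  rw [energyCoeff, S.comm, h.D_u_legendre hn, map_zero]

lemma IsNull.D_r_energyCoeff (hn : 1 < n) : S.D .r (S.energyCoeff G) = 0 := by
  rw [energyCoeff, S.comm, h.D_r_legendre hn, map_zero]

lemma IsNull.D_p_energyCoeff (hn : 1 < n) (hF : S.F ∈ A⁰) : S.D .p (S.energyCoeff G) = 0 := by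
  apply S.r_mul_cancel
  have := congrArg (S.D .p) (h.D_u_D_u ⟨0, by omega⟩ ⟨0, by omega⟩)
  rw [S.comm .p (.u _), h.D_p_D_u hn hF] at this
  simp only [if_true, Derivation.leibniz, smul_eq_mul, D_p_r, map_zero] at this
  linear_combination -this

lemma IsNull.D_r_specificMomentum (j : Fin n) : S.D .r (S.specificMomentum G j) = 0 := by
  simp only [specificMomentum, Derivation.leibniz, smul_eq_mul, D_rinv, D_r_r]
  linear_combination S.rinv ^ 2 * h.r_mul_D_r_D_u j
    - S.rinv * S.D .r (S.D (.u j) G) * S.r_mul_rinv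

lemma IsNull.D_p_specificMomentum (hn : 1 < n) (hF : S.F ∈ A⁰) (j : Fin n) :
    S.D .p (S.specificMomentum G j) = 0 := by
  simp [specificMomentum, D_rinv, h.D_p_D_u hn hF]

lemma IsNull.D_u_specificMomentum (i j : Fin n) : S.D (.u i) (S.specificMomentum G j) =
    if j = i then S.energyCoeff G else 0 := by
  simp only [specificMomentum, Derivation.leibniz, smul_eq_mul, D_rinv, D_u_r, h.D_u_D_u]
  split_ifs
  · linear_combination S.energyCoeff G * S.r_mul_rinv
  · simp

lemma IsNull.D_r_D_t : S.D .r (S.D .t G) = -∑ i, S.u i * S.D .r (S.D (.x i) G) := by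
  rw [h.tr, ← Finset.sum_neg_distrib]
  refine Finset.sum_congr rfl fun i _ => ?_
  simp only [coeffR, map_neg, Derivation.leibniz, smul_eq_mul, D_x_u, S.comm (.x i) .r]
  ring

lemma IsNull.D_r_D_x (j : Fin n) : S.D .r (S.D (.x j) G) =
    -S.D .t (S.specificMomentum G j)
      - ∑ i, S.u i * S.D (.x i) (S.specificMomentum G j) := by
  have := congrArg (S.D (.u j)) h.D_r_D_t
  simp only [map_neg, map_sum, Derivation.leibniz, smul_eq_mul, D_u_u,
    Finset.sum_add_distrib, mul_ite, mul_one, mul_zero, Finset.sum_ite_eq,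
    Finset.mem_univ, if_true] at this
  have e : ∀ a, S.D (.u j) (S.D .r (S.D a G)) = S.D a (S.specificMomentum G j) := by
    intro a
    rw [S.comm (.u j) .r, S.comm (.u j) a, S.comm .r a,
      S.D_u_eq_r_mul_specificMomentum G j]
    simp [h.D_r_specificMomentum]
  simp only [e] at this
  linear_combination this

lemma IsNull.D_x_specificMomentum_symm_eq_sub_sum (j k : Fin n) :
    S.D (.x k) (S.specificMomentum G j) + S.D (.x j) (S.specificMomentum G k) =
      if j = k then -S.D .t (S.energyCoeff G) - ∑ i, S.u i * S.D (.x i) (S.energyCoeff G)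
      else 0 := by
  have := congrArg (S.D (.u k)) (h.D_r_D_x j)
  rw [S.comm (.u k) .r, S.comm (.u k) (.x j), S.comm .r (.x j),
    S.D_u_eq_r_mul_specificMomentum G k] at this
  simp only [map_neg, map_sub, map_sum, Derivation.leibniz, smul_eq_mul, D_u_u,
    Finset.sum_add_distrib, mul_ite, mul_one, mul_zero, Finset.sum_ite_eq,
    Finset.mem_univ, if_true, h.D_r_specificMomentum, D_r_r, zero_add,
    S.comm (.u k) .t, S.comm (.u k) (.x _), h.D_u_specificMomentum] at this
  by_cases hjk : j = k
  · simp only [if_pos hjk] at this ⊢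
    linear_combination this
  · simp only [if_neg hjk, map_zero, mul_zero, Finset.sum_const_zero] at this ⊢
    linear_combination this

lemma IsNull.D_x_energyCoeff (hn : 1 < n) (j : Fin n) : S.D (.x j) (S.energyCoeff G) = 0 := by
  refine eq_zero_of_natCast_mul_eq_zero three_ne_zero ?_
  have := congrArg (S.D (.u j)) (h.D_x_specificMomentum_symm_eq_sub_sum j j)
  simp only [map_add, map_neg, map_sub, map_sum, Derivation.leibniz, smul_eq_mul,
    D_u_u, Finset.sum_add_distrib, mul_ite, mul_one, mul_zero, Finset.sum_ite_eq,
    Finset.mem_univ, if_true, S.comm (.u j) .t, S.comm (.u j) (.x _), h.D_u_specificMomentum,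
    h.D_u_energyCoeff hn, map_zero, Finset.sum_const_zero] at this
  linear_combination this

lemma IsNull.D_x_specificMomentum_symm (hn : 1 < n) (j k : Fin n) :
    S.D (.x k) (S.specificMomentum G j) + S.D (.x j) (S.specificMomentum G k) =
      if j = k then -S.D .t (S.energyCoeff G) else 0 := by
  simp [h.D_x_specificMomentum_symm_eq_sub_sum, h.D_x_energyCoeff hn]

lemma IsNull.D_x_D_x_specificMomentum (hn : 1 < n) (j k l : Fin n) :
    S.D (.x l) (S.D (.x k) (S.specificMomentum G j)) = 0 := by
  have key : ∀ a b c : Fin n, S.D (.x c) (S.D (.x b) (S.specificMomentum G a))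
      + S.D (.x c) (S.D (.x a) (S.specificMomentum G b)) = 0 := by
    intro a b c
    rw [← map_add, h.D_x_specificMomentum_symm hn]
    split_ifs
    · rw [map_neg, S.comm, h.D_x_energyCoeff hn, map_zero, neg_zero]
    · simp
  refine eq_zero_of_natCast_mul_eq_zero two_ne_zero ?_
  have h1 := key j k l
  have h2 := key k l j
  have h3 := key l j k
  rw [S.comm (.x j) (.x l), S.comm (.x j) (.x k)] at h2
  rw [S.comm (.x k) (.x l)] at h3
  linear_combination h1 - h2 + h3

lemma IsNull.D_x_D_t_specificMomentum_comm (hn : 1 < n) (j k : Fin n) :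
    S.D (.x k) (S.D .t (S.specificMomentum G j)) =
      S.D (.x j) (S.D .t (S.specificMomentum G k)) := by
  have hx : ∀ a b : Fin n, S.D (.x a) (S.D .r (S.D (.x b) G)) =
      -S.D (.x a) (S.D .t (S.specificMomentum G b)) := by
    intro a b
    simp [h.D_r_D_x, h.D_x_D_x_specificMomentum hn]
  have hkj := hx k j
  have hjk := hx j k
  rw [S.comm (.x k) .r, S.comm (.x k) (.x j), S.comm .r (.x j)] at hkj
  linear_combination hkj - hjk

lemma IsNull.two_mul_D_x_D_t_specificMomentum (hn : 1 < n) (j k : Fin n) :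
    2 * S.D (.x k) (S.D .t (S.specificMomentum G j)) =
      if j = k then -S.D .t (S.D .t (S.energyCoeff G)) else 0 := by
  have hsymm := congrArg (S.D .t) (h.D_x_specificMomentum_symm hn j k)
  rw [map_add, S.comm .t, S.comm .t, ← h.D_x_D_t_specificMomentum_comm hn j k,
    ← two_mul] at hsymm
  rw [hsymm]
  split_ifs <;> simp

lemma IsNull.sum_u_mul_sum_u_mul_D_x_specificMomentum (hn : 1 < n) :
    2 * ∑ j, S.u j * ∑ i, S.u i * S.D (.x i) (S.specificMomentum G j) =
      -S.D .t (S.energyCoeff G) * ∑ j, S.u j ^ 2 := by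
  rw [two_mul]
  simp only [Finset.mul_sum]
  nth_rewrite 2 [Finset.sum_comm]
  simp only [← Finset.sum_add_distrib]
  refine Finset.sum_congr rfl fun j _ => ?_
  have hsymm : ∀ i, S.u j * (S.u i * S.D (.x i) (S.specificMomentum G j))
      + S.u i * (S.u j * S.D (.x j) (S.specificMomentum G i)) =
      if j = i then -S.D .t (S.energyCoeff G) * S.u i ^ 2 else 0 := by
    intro i
    have := h.D_x_specificMomentum_symm hn j i
    by_cases hij : j = i
    · subst hij
      simp only [if_true] at this ⊢
      linear_combination S.u j ^ 2 * this
    · simp only [if_neg hij] at this ⊢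
      linear_combination S.u i * S.u j * this
  simp [hsymm]

lemma IsNull.two_mul_D_r_D_t (hn : 1 < n) : 2 * S.D .r (S.D .t G) =
    2 * ∑ j, S.u j * S.D .t (S.specificMomentum G j)
      - S.D .t (S.energyCoeff G) * ∑ j, S.u j ^ 2 := by
  rw [h.D_r_D_t]
  simp only [h.D_r_D_x, mul_sub, mul_neg, Finset.sum_sub_distrib, Finset.sum_neg_distrib]
  linear_combination h.sum_u_mul_sum_u_mul_D_x_specificMomentum hn

lemma IsNull.D_t_D_t_specificMomentum (hn : 1 < n) (j : Fin n) :
    S.D .t (S.D .t (S.specificMomentum G j)) =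
      S.D .t (S.D .t (S.energyCoeff G)) * S.u j := by
  refine sub_eq_zero.1 (eq_zero_of_natCast_mul_eq_zero two_ne_zero ?_)
  have htx := congrArg (S.D .t) (h.D_r_D_x j)
  have hxt := congrArg (S.D (.x j)) (h.two_mul_D_r_D_t hn)
  rw [S.comm .t .r, S.comm .t (.x j)] at htx
  simp only [map_sub, map_neg, map_sum, Derivation.leibniz, smul_eq_mul, D_t_u, D_x_u, D_ofNat,
    mul_zero, add_zero, Finset.sum_const_zero, S.comm (.x j) .t (S.energyCoeff G),
    h.D_x_energyCoeff hn, map_zero, Derivation.leibniz_pow, smul_zero, S.comm (.x j) .r]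
    at htx hxt
  replace htx := congrArg (2 * ·) htx
  simp only [mul_sub, Finset.mul_sum, mul_neg, mul_left_comm (2 : A), S.comm .t (.x _),
    h.two_mul_D_x_D_t_specificMomentum hn, mul_ite, mul_zero,
    Finset.sum_ite_eq, Finset.sum_ite_eq', Finset.mem_univ, if_true] at htx hxt
  linear_combination htx - hxt

lemma IsNull.D_t_D_t_D_t_energyCoeff (hn : 1 < n) :
    S.D .t (S.D .t (S.D .t (S.energyCoeff G))) = 0 := by
  set j : Fin n := ⟨0, by omega⟩
  have h1 := congrArg (S.D .t) (h.two_mul_D_x_D_t_specificMomentum hn j j)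
  have h2 := congrArg (S.D (.x j)) (h.D_t_D_t_specificMomentum hn j)
  simp only [if_true, map_neg, Derivation.leibniz, smul_eq_mul, D_x_u, D_ofNat, mul_zero,
    add_zero, S.comm (.x j) .t, h.D_x_energyCoeff hn, map_zero] at h1 h2
  linear_combination h1 - 2 * h2

lemma IsNull.two_mul_D_p_D_t_eq_sub_sum (hn : 1 < n) : 2 * S.D .p (S.D .t G) =
    n * S.D .t (S.energyCoeff G) - 2 * ∑ i, S.u i * S.D .p (S.D (.x i) G) := by
  have hdiag : ∀ i : Fin n, 2 * S.D (.x i) (S.specificMomentum G i) =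
      -S.D .t (S.energyCoeff G) := by
    intro i
    simpa only [if_true, ← two_mul] using h.D_x_specificMomentum_symm hn i i
  have hcoeffP : ∀ i, S.D (.x i) (S.coeffP G i) = -(S.u i * S.D .p (S.D (.x i) G))
      - S.D (.x i) (S.specificMomentum G i) := by
    intro i
    rw [coeffP, ← specificMomentum]
    simp only [map_neg, map_sub, Derivation.leibniz, smul_eq_mul, D_x_u, S.comm (.x i) .p]
    ring
  rw [h.tp]
  simp only [hcoeffP, Finset.sum_sub_distrib, Finset.sum_neg_distrib, mul_sub, mul_neg]
  nth_rewrite 2 [Finset.mul_sum]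
  simp only [hdiag, Finset.sum_const, Finset.card_univ, Fintype.card_fin, nsmul_eq_mul]
  ring

lemma IsNull.D_p_D_x (hn : 1 < n) (hF : S.F ∈ A⁰) (j : Fin n) : S.D .p (S.D (.x j) G) = 0 := by
  refine eq_zero_of_natCast_mul_eq_zero two_ne_zero ?_
  have := congrArg (S.D (.u j)) (h.two_mul_D_p_D_t_eq_sub_sum hn)
  have e : ∀ a, S.D (.u j) (S.D .p (S.D a G)) = 0 := by
    intro a
    rw [S.comm (.u j) .p, S.comm (.u j) a, S.comm .p a, h.D_p_D_u hn hF, map_zero]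
  simp only [map_sub, map_sum, Derivation.leibniz, smul_eq_mul, D_ofNat, e, mul_zero, add_zero,
    zero_add, Derivation.map_natCast, S.comm (.u j) .t, h.D_u_energyCoeff hn, map_zero, D_u_u,
    mul_ite, mul_one, Finset.sum_ite_eq, Finset.mem_univ, if_true] at this
  linear_combination this

lemma IsNull.two_mul_D_p_D_t (hn : 1 < n) (hF : S.F ∈ A⁰) :
    2 * S.D .p (S.D .t G) = n * S.D .t (S.energyCoeff G) := by
  simp [h.two_mul_D_p_D_t_eq_sub_sum hn, h.D_p_D_x hn hF]

lemma IsNull.D_r_D_r_D_t (hn : 1 < n) : S.D .r (S.D .r (S.D .t G)) = 0 := by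
  refine eq_zero_of_natCast_mul_eq_zero two_ne_zero ?_
  have := congrArg (S.D .r) (h.two_mul_D_r_D_t hn)
  simp only [map_sub, map_sum, Derivation.leibniz, smul_eq_mul, D_ofNat, mul_zero, add_zero,
    S.comm .r .t, h.D_r_specificMomentum, h.D_r_energyCoeff hn, map_zero, D_r_u,
    Derivation.leibniz_pow, smul_zero, Finset.sum_const_zero, sub_zero] at this
  simp only [S.comm .r .t]
  exact this

lemma IsNull.D_D_p_D_t_eq_zero (hn : 1 < n) (hF : S.F ∈ A⁰) {a : Direction n}
    (ha : S.D a (S.energyCoeff G) = 0) : S.D a (S.D .p (S.D .t G)) = 0 := by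
  refine eq_zero_of_natCast_mul_eq_zero two_ne_zero ?_
  have := congrArg (S.D a) (h.two_mul_D_p_D_t hn hF)
  simpa only [Derivation.leibniz, smul_eq_mul, Nat.cast_ofNat, D_ofNat, mul_zero,
    add_zero, Derivation.map_natCast, S.comm a .t (S.energyCoeff G), ha, map_zero] using this

lemma IsNull.D_t_energyCoeff_mul_D_r_F (hn : 1 < n) (hF : S.F ∈ A⁰) :
    S.D .t (S.energyCoeff G) * S.D .r S.F = 0 := by
  have hleg := congrArg (S.D .r) (S.D_t_legendre G)
  rw [S.comm .r .t, h.D_r_legendre hn] at hleg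
  simp only [map_sub, map_add, Derivation.leibniz, smul_eq_mul, D_r_r,
    h.D_D_p_D_t_eq_zero hn hF (h.D_r_energyCoeff hn), h.D_r_D_r_D_t hn, map_zero] at hleg
  refine eq_zero_of_natCast_mul_eq_zero (Nat.ne_zero_of_lt hn) ?_
  linear_combination -2 * hleg - S.D .r S.F * h.two_mul_D_p_D_t hn hF

lemma IsNull.D_t_energyCoeff_mul_D_p_F (hn : 1 < n) (hF : S.F ∈ A⁰) :
    n * S.D .t (S.energyCoeff G) * S.D .p S.F = (n + 2) * S.D .t (S.energyCoeff G) := by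
  have hleg := congrArg (S.D .p) (S.D_t_legendre G)
  rw [S.comm .p .t] at hleg
  simp only [map_sub, map_add, Derivation.leibniz, smul_eq_mul, D_p_r, S.comm .p .r,
    h.D_D_p_D_t_eq_zero hn hF (h.D_r_energyCoeff hn),
    h.D_D_p_D_t_eq_zero hn hF (h.D_p_energyCoeff hn hF)] at hleg
  rw [← energyCoeff] at hleg
  linear_combination -2 * hleg + (1 - S.D .p S.F) * h.two_mul_D_p_D_t hn hF

section Stationary

variable (hβ : S.D .t (S.energyCoeff G) = 0)
include hβ

lemma IsNull.D_energyCoeff_eq_zero (hn : 1 < n) (hF : S.F ∈ A⁰) :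
    ∀ a, S.D a (S.energyCoeff G) = 0
  | .t => hβ
  | .x i => h.D_x_energyCoeff hn i
  | .u i => h.D_u_energyCoeff hn i
  | .r => h.D_r_energyCoeff hn
  | .p => h.D_p_energyCoeff hn hF

lemma IsNull.D_x_specificMomentum_antisymm (hn : 1 < n) (j k : Fin n) :
    S.D (.x k) (S.specificMomentum G j) = -S.D (.x j) (S.specificMomentum G k) := by
  have hsymm := h.D_x_specificMomentum_symm hn j k
  rw [hβ, neg_zero, ite_self] at hsymm
  linear_combination hsymm

lemma IsNull.D_x_D_t_specificMomentum (hn : 1 < n) (j k : Fin n) :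
    S.D (.x k) (S.D .t (S.specificMomentum G j)) = 0 :=
  eq_zero_of_natCast_mul_eq_zero two_ne_zero
    (by simp [h.two_mul_D_x_D_t_specificMomentum hn, hβ])

lemma IsNull.D_D_specificMomentum_eq_zero (hn : 1 < n) (hF : S.F ∈ A⁰) (a b : Direction n)
    (j : Fin n) : S.D a (S.D b (S.specificMomentum G j)) = 0 := by
  have hβ' := h.D_energyCoeff_eq_zero hβ hn hF
  have hu (c i) : S.D c (S.D (.u i) (S.specificMomentum G j)) = 0 := by
    rw [h.D_u_specificMomentum]
    split_ifs <;> simp [hβ']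
  have hr (c) : S.D c (S.D .r (S.specificMomentum G j)) = 0 := by
    rw [h.D_r_specificMomentum, map_zero]
  have hp (c) : S.D c (S.D .p (S.specificMomentum G j)) = 0 := by
    rw [h.D_p_specificMomentum hn hF, map_zero]
  have htx := h.D_x_D_t_specificMomentum hβ hn j
  match a, b with
  | c, .u i => exact hu c i
  | c, .r => exact hr c
  | c, .p => exact hp c
  | .u i, c => rw [S.comm]; exact hu c i
  | .r, c => rw [S.comm]; exact hr c
  | .p, c => rw [S.comm]; exact hp c
  | .t, .t => rw [h.D_t_D_t_specificMomentum hn, hβ, map_zero, zero_mul]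
  | .t, .x k => rw [S.comm, htx]
  | .x k, .t => exact htx k
  | .x i, .x k => exact h.D_x_D_x_specificMomentum hn j k i

lemma IsNull.D_r_D_t_of_stationary (hn : 1 < n) :
    S.D .r (S.D .t G) = ∑ j, S.u j * S.D .t (S.specificMomentum G j) := by
  refine sub_eq_zero.1 (eq_zero_of_natCast_mul_eq_zero two_ne_zero ?_)
  linear_combination h.two_mul_D_r_D_t hn - (∑ j, S.u j ^ 2) * hβ

lemma IsNull.D_p_D_t_of_stationary (hn : 1 < n) (hF : S.F ∈ A⁰) : S.D .p (S.D .t G) = 0 :=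
  eq_zero_of_natCast_mul_eq_zero two_ne_zero (by simp [h.two_mul_D_p_D_t hn hF, hβ])

end Stationary

end StateRing

end DifferentialRing

/-! ### Lagrangians affine in the gradient -/

section AffineLagrangian

open MeasureTheory Topology

variable {E V ι : Type*} [NormedAddCommGroup E] [NormedSpace ℝ E] [NormedAddCommGroup V]
  [NormedSpace ℝ V] {W : Set V} {φ : E → V}

lemma hasFDerivAt_add_mul_smul (hφ : ContDiff ℝ ∞ φ) {η : E → ℝ} (hη : ContDiff ℝ ∞ η) (v : V)
    (ε : ℝ) (x : E) : HasFDerivAt (fun y => φ y + (ε * η y) • v)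
      (fderiv ℝ φ x + (ε • fderiv ℝ η x).smulRight v) x :=
  ((hφ.differentiable (by simp) x).hasFDerivAt).add
    ((((hη.differentiable (by simp) x).hasFDerivAt).const_mul ε).smul_const v)

lemma hasDerivAt_add_mul_smul (y v : V) (c ε : ℝ) :
    HasDerivAt (fun ε : ℝ => y + (ε * c) • v) (c • v) ε := by
  simpa using (((hasDerivAt_id ε).mul_const c).smul_const v).const_add y

lemma hasDerivAt_comp_add_mul_smul {Y : Type*} [NormedAddCommGroup Y] [NormedSpace ℝ Y]
    {h : E × V → Y} {x : E} {y : V} (hh : DifferentiableAt ℝ h (x, y)) (v : V) (c : ℝ) :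
    HasDerivAt (fun ε : ℝ => h (x, y + (ε * c) • v)) (c • fderiv ℝ h (x, y) (0, v)) 0 := by
  have hd : HasFDerivAt h (fderiv ℝ h (x, y)) (x, y + ((0 : ℝ) * c) • v) := by
    simpa using hh.hasFDerivAt
  refine (hd.comp_hasDerivAt (f := fun ε : ℝ => (x, y + (ε * c) • v)) 0
    ((hasDerivAt_const 0 x).prodMk (hasDerivAt_add_mul_smul y v c 0))).congr_deriv ?_
  rw [← map_smul, Prod.smul_mk, smul_zero]

lemma exists_isOpen_forall_add_mul_smul_mem {X : Type*} [TopologicalSpace X] (hW : IsOpen W)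
    {φ : X → V} (hφ : Continuous φ) (hφW : ∀ x, φ x ∈ W) {η : X → ℝ} (hη : Continuous η)
    (hηs : HasCompactSupport η) (v : V) :
    ∃ s : Set ℝ, IsOpen s ∧ 0 ∈ s ∧ ∀ ε ∈ s, ∀ x, φ x + (ε * η x) • v ∈ W := by
  have hopen : IsOpen ((fun q : ℝ × X => φ q.2 + (q.1 * η q.2) • v) ⁻¹' W) :=
    hW.preimage (by fun_prop)
  have hnear : ∀ᶠ ε in 𝓝 (0 : ℝ), ∀ x ∈ tsupport η, φ x + (ε * η x) • v ∈ W :=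
    hηs.isCompact.eventually_forall_of_forall_eventually fun x _ =>
      hopen.mem_nhds (x := (0, x)) (by simpa using hφW x)
  obtain ⟨s, hs, hs', h0⟩ := eventually_nhds_iff.1 hnear
  refine ⟨s, hs', h0, fun ε hε x => ?_⟩
  by_cases hx : x ∈ tsupport η
  · exact hs ε hε x hx
  · simpa [image_eq_zero_of_notMem_tsupport hx] using hφW x

lemma exists_contDiff_eq_hasFDerivAt (hW : IsOpen W) {y : V} (hy : y ∈ W) (x : E) (l : E →L[ℝ] ℝ)
    (w : V) : ∃ φ : E → V, ContDiff ℝ ∞ φ ∧ (∀ z, φ z ∈ W) ∧ φ x = y ∧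
      HasFDerivAt φ (l.smulRight w) x := by
  obtain ⟨r, hr, hrW⟩ := Metric.isOpen_iff.1 hW y hy
  have : 0 < ‖w‖ + 1 := by positivity
  set δ := r / (‖w‖ + 1) with hδ
  have hδ0 : 0 < δ := by positivity
  refine ⟨fun z => y + (δ * Real.sin (δ⁻¹ * l (z - x))) • w, by fun_prop, fun z => hrW ?_,
    by simp, ?_⟩
  · rw [Metric.mem_ball, dist_eq_norm, add_sub_cancel_left, norm_smul, norm_mul, Real.norm_eq_abs,
      Real.norm_eq_abs, abs_of_pos hδ0]
    calc δ * |Real.sin (δ⁻¹ * l (z - x))| * ‖w‖ ≤ δ * 1 * ‖w‖ := by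
          gcongr; exact Real.abs_sin_le_one _
      _ < δ * 1 * (‖w‖ + 1) := by gcongr; linarith
      _ = r := by rw [hδ]; field_simp
  · have hl : HasFDerivAt (fun z => δ⁻¹ * l (z - x)) (δ⁻¹ • l) x :=
      ((l.hasFDerivAt (x := x)).sub_const (l x)).const_mul δ⁻¹ |>.congr_of_eventuallyEq
        (.of_forall fun z => by simp [map_sub])
    refine (((hl.sin.const_mul δ).smul_const w).const_add y).congr_fderiv ?_
    simp [smul_smul, mul_inv_cancel₀ hδ0.ne']

lemma continuous_fderiv_graph {Y : Type*} [NormedAddCommGroup Y] [NormedSpace ℝ Y] {h : E × V → Y}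
    (hW : IsOpen W) (hh : ContDiffOn ℝ ∞ h (Set.univ ×ˢ W)) (hφ : Continuous φ)
    (hφW : ∀ x, φ x ∈ W) (z : E × V) : Continuous fun x => fderiv ℝ h (x, φ x) z :=
  ((hh.continuousOn_fderiv_of_isOpen (isOpen_univ.prod hW) (by simp)).comp_continuous
    (by fun_prop) fun x => ⟨trivial, hφW x⟩).clm_apply continuous_const

variable [Fintype ι]

/-- The Lagrangian density `B(x, φ) + ∑ᵢ Aᵢ(x, φ) ∂ᵢφ` at a field `φ`, where `∂ᵢ` is the
derivative in the direction `e i`. -/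
def affineLagrangian (B : E × V → ℝ) (A : ι → E × V → V →L[ℝ] ℝ) (e : ι → E) (φ : E → V) (x : E) :
    ℝ :=
  B (x, φ x) + ∑ i, A i (x, φ x) (fderiv ℝ φ x (e i))

variable {B : E × V → ℝ} {A : ι → E × V → V →L[ℝ] ℝ} {e : ι → E}

lemma affineLagrangian_add_mul_smul (hφ : ContDiff ℝ ∞ φ) {η : E → ℝ} (hη : ContDiff ℝ ∞ η)
    (v : V) (ε : ℝ) (x : E) : affineLagrangian B A e (fun y => φ y + (ε * η y) • v) x =
      B (x, φ x + (ε * η x) • v) + ∑ i, A i (x, φ x + (ε * η x) • v)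
        (fderiv ℝ φ x (e i) + (ε * fderiv ℝ η x (e i)) • v) := by
  simp only [affineLagrangian, (hasFDerivAt_add_mul_smul hφ hη v ε x).fderiv]
  simp

lemma affineLagrangian_add_mul_smul_of_notMem_tsupport (hφ : ContDiff ℝ ∞ φ) {η : E → ℝ}
    (hη : ContDiff ℝ ∞ η) (v : V) (ε : ℝ) {x : E} (hx : x ∉ tsupport η) :
    affineLagrangian B A e (fun y => φ y + (ε * η y) • v) x = affineLagrangian B A e φ x := by
  rw [affineLagrangian_add_mul_smul hφ hη, image_eq_zero_of_notMem_tsupport hx,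
    image_eq_zero_of_notMem_tsupport fun h => hx (tsupport_fderiv_subset ℝ h)]
  simp [affineLagrangian]

lemma hasDerivAt_affineLagrangian {x : E} (hB : DifferentiableAt ℝ B (x, φ x))
    (hA : ∀ i, DifferentiableAt ℝ (A i) (x, φ x)) (hφ : ContDiff ℝ ∞ φ)
    {η : E → ℝ} (hη : ContDiff ℝ ∞ η) (v : V) :
    HasDerivAt (fun ε => affineLagrangian B A e (fun y => φ y + (ε * η y) • v) x)
      ((fderiv ℝ B (x, φ x) (0, v)
        + ∑ i, fderiv ℝ (A i) (x, φ x) (0, v) (fderiv ℝ φ x (e i))) * η x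
        + ∑ i, A i (x, φ x) v * fderiv ℝ η x (e i)) 0 := by
  simp only [affineLagrangian_add_mul_smul hφ hη]
  refine ((hasDerivAt_comp_add_mul_smul hB v (η x)).add <| HasDerivAt.fun_sum fun i _ =>
    (hasDerivAt_comp_add_mul_smul (hA i) v (η x)).clm_apply
      (hasDerivAt_add_mul_smul _ v (fderiv ℝ η x (e i)) 0)).congr_deriv ?_
  simp only [smul_eq_mul, zero_mul, zero_smul, add_zero, smul_apply, map_smul,
    Finset.sum_add_distrib, ← Finset.mul_sum, mul_comm (fderiv ℝ η x _)]
  ring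

lemma contDiffOn_affineLagrangian (hB : ContDiffOn ℝ ∞ B (Set.univ ×ˢ W))
    (hA : ∀ i, ContDiffOn ℝ ∞ (A i) (Set.univ ×ˢ W)) (hφ : ContDiff ℝ ∞ φ)
    {η : E → ℝ} (hη : ContDiff ℝ ∞ η) (v : V) {s : Set ℝ}
    (hs : ∀ ε ∈ s, ∀ x, φ x + (ε * η x) • v ∈ W) :
    ContDiffOn ℝ 1 (fun q : ℝ × E => affineLagrangian B A e (fun y => φ y + (q.1 * η y) • v) q.2)
      (s ×ˢ Set.univ) := by
  have hmaps : Set.MapsTo (fun q : ℝ × E => (q.2, φ q.2 + (q.1 * η q.2) • v)) (s ×ˢ Set.univ)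
      (Set.univ ×ˢ W) := fun q hq => ⟨trivial, hs q.1 hq.1 q.2⟩
  have hpoint : ContDiff ℝ ∞ fun q : ℝ × E => (q.2, φ q.2 + (q.1 * η q.2) • v) := by fun_prop
  have hφ' : ∀ i, ContDiff ℝ ∞ fun q : ℝ × E => fderiv ℝ φ q.2 (e i) := fun i =>
    ((hφ.fderiv_right (m := ∞) (by simp)).comp contDiff_snd).clm_apply contDiff_const
  have hη' : ∀ i, ContDiff ℝ ∞ fun q : ℝ × E => fderiv ℝ η q.2 (e i) := fun i =>
    ((hη.fderiv_right (m := ∞) (by simp)).comp contDiff_snd).clm_apply contDiff_const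
  simp only [affineLagrangian_add_mul_smul hφ hη]
  refine ContDiffOn.of_le (n := ∞) ?_ (by simp)
  exact (hB.comp hpoint.contDiffOn hmaps).add <| ContDiffOn.sum fun i _ =>
    ((hA i).comp hpoint.contDiffOn hmaps).clm_apply
      ((hφ' i).add ((contDiff_fst.mul (hη' i)).smul contDiff_const)).contDiffOn

variable [MeasurableSpace E] [BorelSpace E] {μ : Measure E}

section FirstVariation

variable [IsFiniteMeasureOnCompacts μ]

lemma hasDerivAt_integral_of_eq_zero_off_isCompact
    {K : Set E} (hK : IsCompact K) {s : Set ℝ} (hs : IsOpen s) {ε₀ : ℝ} (hε₀ : ε₀ ∈ s)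
    {g : ℝ → E → ℝ} (hg : ContDiffOn ℝ 1 (Function.uncurry g) (s ×ˢ Set.univ))
    (hgK : ∀ ε ∈ s, ∀ x ∉ K, g ε x = 0) :
    HasDerivAt (fun ε => ∫ x, g ε x ∂μ) (∫ x, deriv (fun ε => g ε x) ε₀ ∂μ) ε₀ := by
  have hopen : IsOpen (s ×ˢ (Set.univ : Set E)) := hs.prod isOpen_univ
  set g' : ℝ → E → ℝ := fun ε x => fderiv ℝ (Function.uncurry g) (ε, x) (1, 0)
  have hderiv : ∀ ε ∈ s, ∀ x, HasDerivAt (fun ε => g ε x) (g' ε x) ε := fun ε hε x =>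
    ((hg.contDiffAt (hopen.mem_nhds ⟨hε, trivial⟩)).differentiableAt
      one_ne_zero).hasFDerivAt.comp_hasDerivAt (f := fun ε => (ε, x)) ε
      ((hasDerivAt_id ε).prodMk (hasDerivAt_const ε x))
  have hg'K : ∀ ε ∈ s, ∀ x ∉ K, g' ε x = 0 := fun ε hε x hx =>
    (hderiv ε hε x).unique <| (hasDerivAt_const ε 0).congr_of_eventuallyEq <| by
      filter_upwards [hs.mem_nhds hε] with ε' hε' using hgK ε' hε' x hx
  have hg'cont : ContinuousOn (Function.uncurry g') (s ×ˢ Set.univ) :=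
    (hg.continuousOn_fderiv_of_isOpen hopen le_rfl).clm_apply continuousOn_const
  have hslice : ∀ {f : ℝ → E → ℝ}, ContinuousOn (Function.uncurry f) (s ×ˢ Set.univ) →
      ∀ ε ∈ s, Continuous (f ε) := fun hf ε hε =>
    hf.comp_continuous (f := fun x => (ε, x)) (by fun_prop) fun x => ⟨hε, trivial⟩
  obtain ⟨δ, hδ, hδs⟩ := Metric.nhds_basis_closedBall.mem_iff.1 (hs.mem_nhds hε₀)
  obtain ⟨M, hM⟩ := ((isCompact_closedBall ε₀ δ).prod hK).exists_bound_of_continuousOn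
    (hg'cont.mono (Set.prod_mono hδs (Set.subset_univ K)))
  have hbound : ∀ x, ∀ ε ∈ Metric.closedBall ε₀ δ, ‖g' ε x‖ ≤ K.indicator (fun _ => M) x := by
    intro x ε hε
    by_cases hx : x ∈ K
    · simpa [hx] using hM (ε, x) ⟨hε, hx⟩
    · simp [hx, hg'K ε (hδs hε) x hx]
  have h0 := (hasDerivAt_integral_of_dominated_loc_of_deriv_le (Metric.closedBall_mem_nhds ε₀ hδ)
    (Filter.eventually_of_mem (hs.mem_nhds hε₀) fun ε hε =>
      (hslice hg.continuousOn ε hε).aestronglyMeasurable)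
    ((hslice hg.continuousOn ε₀ hε₀).integrable_of_hasCompactSupport
      (HasCompactSupport.intro hK (hgK ε₀ hε₀)))
    (hslice hg'cont ε₀ hε₀).aestronglyMeasurable (.of_forall hbound)
    ((integrable_indicator_iff hK.measurableSet).2
      (integrableOn_const (hK.measure_ne_top (μ := μ))))
    (.of_forall fun x ε hε => hderiv ε (hδs hε) x)).2
  simpa only [(hderiv ε₀ hε₀ _).deriv] using h0

/-- The integrated form of a null Lagrangian for `W`-valued fields: replacing a smooth field by one
which differs from it on a compact set only does not change the action. -/
def IsNullLagrangian (μ : Measure E) (W : Set V) (L : (E → V) → E → ℝ) : Prop :=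
  ∀ φ ψ : E → V, ContDiff ℝ ∞ φ → ContDiff ℝ ∞ ψ → (∀ x, φ x ∈ W) → (∀ x, ψ x ∈ W) →
    HasCompactSupport (φ - ψ) → ∫ x, (L φ x - L ψ x) ∂μ = 0

lemma IsNullLagrangian.integral_firstVariation_eq_zero
    (H : IsNullLagrangian μ W (affineLagrangian B A e)) (hW : IsOpen W)
    (hB : ContDiffOn ℝ ∞ B (Set.univ ×ˢ W)) (hA : ∀ i, ContDiffOn ℝ ∞ (A i) (Set.univ ×ˢ W))
    (hφ : ContDiff ℝ ∞ φ) (hφW : ∀ x, φ x ∈ W) {η : E → ℝ} (hη : ContDiff ℝ ∞ η)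
    (hηs : HasCompactSupport η) (v : V) :
    ∫ x, ((fderiv ℝ B (x, φ x) (0, v)
      + ∑ i, fderiv ℝ (A i) (x, φ x) (0, v) (fderiv ℝ φ x (e i))) * η x
      + ∑ i, A i (x, φ x) v * fderiv ℝ η x (e i)) ∂μ = 0 := by
  obtain ⟨s, hs, h0, hsW⟩ :=
    exists_isOpen_forall_add_mul_smul_mem hW hφ.continuous hφW hη.continuous hηs v
  have hopen : IsOpen ((Set.univ : Set E) ×ˢ W) := isOpen_univ.prod hW
  have hzero : ∀ ε ∈ s, ∫ x, (affineLagrangian B A e (fun y => φ y + (ε * η y) • v) x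
      - affineLagrangian B A e φ x) ∂μ = 0 := fun ε hε =>
    H _ _ (by fun_prop) hφ (hsW ε hε) hφW <| .intro hηs.isCompact fun x hx => by
      simp [image_eq_zero_of_notMem_tsupport hx]
  have hφ0 : ContDiffOn ℝ 1 (fun q : ℝ × E => affineLagrangian B A e φ q.2) (s ×ˢ Set.univ) := by
    simpa using contDiffOn_affineLagrangian (e := e) hB hA hφ (η := fun _ => 0) contDiff_const v
      (s := s) (by simpa using fun _ _ => hφW)
  have hderiv := hasDerivAt_integral_of_eq_zero_off_isCompact (μ := μ) hηs.isCompact hs h0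
    (g := fun ε x => affineLagrangian B A e (fun y => φ y + (ε * η y) • v) x
      - affineLagrangian B A e φ x)
    ((contDiffOn_affineLagrangian hB hA hφ hη v hsW).sub hφ0)
    fun ε _ x hx => sub_eq_zero.2 (affineLagrangian_add_mul_smul_of_notMem_tsupport hφ hη v ε hx)
  have hconst := (hasDerivAt_const (0 : ℝ) (0 : ℝ)).congr_of_eventuallyEq
    (Filter.eventuallyEq_of_mem (hs.mem_nhds h0) hzero)
  rw [← hderiv.unique hconst]
  refine integral_congr_ae (.of_forall fun x => ?_)
  have hx : Set.univ ×ˢ W ∈ 𝓝 (x, φ x) := hopen.mem_nhds ⟨trivial, hφW x⟩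
  exact (((hasDerivAt_affineLagrangian (((hB.contDiffAt hx)).differentiableAt (by simp))
    (fun i => ((hA i).contDiffAt hx).differentiableAt (by simp)) hφ hη v).sub_const _).deriv).symm

end FirstVariation

variable [FiniteDimensional ℝ E] [μ.IsAddHaarMeasure]

lemma integral_mul_fderiv_eq_neg_of_hasCompactSupport {f g : E → ℝ} (hf : ContDiff ℝ 1 f)
    (hg : ContDiff ℝ 1 g) (hgs : HasCompactSupport g) (v : E) :
    ∫ x, f x * fderiv ℝ g x v ∂μ = -∫ x, fderiv ℝ f x v * g x ∂μ := by
  have hf' : Continuous fun x => fderiv ℝ f x v :=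
    (hf.continuous_fderiv one_ne_zero).clm_apply continuous_const
  have hg' : Continuous fun x => fderiv ℝ g x v :=
    (hg.continuous_fderiv one_ne_zero).clm_apply continuous_const
  exact integral_mul_fderiv_eq_neg_fderiv_mul_of_integrable
    ((hf'.mul hg.continuous).integrable_of_hasCompactSupport hgs.mul_left)
    ((hf.continuous.mul hg').integrable_of_hasCompactSupport (hgs.fderiv_apply ℝ v).mul_left)
    ((hf.continuous.mul hg.continuous).integrable_of_hasCompactSupport hgs.mul_left)
    (fun x _ => hf.differentiable one_ne_zero x) (fun x _ => hg.differentiable one_ne_zero x)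

lemma integral_fderiv_apply_eq_zero_of_hasCompactSupport {f : E → ℝ} (hf : ContDiff ℝ 1 f)
    (hfs : HasCompactSupport f) (v : E) : ∫ x, fderiv ℝ f x v ∂μ = 0 := by
  simpa using integral_mul_fderiv_eq_neg_of_hasCompactSupport (μ := μ) (f := fun _ => 1)
    contDiff_const hf hfs v

lemma eq_sum_fderiv_of_integral_eq_zero {ι : Type*} [Fintype ι] {P : E → ℝ}
    (hP : Continuous P) {a : ι → E → ℝ} (ha : ∀ i, ContDiff ℝ 1 (a i)) (e : ι → E)
    (h : ∀ η : E → ℝ, ContDiff ℝ ∞ η → HasCompactSupport η →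
      ∫ x, (P x * η x + ∑ i, a i x * fderiv ℝ η x (e i)) ∂μ = 0) (x : E) :
    P x = ∑ i, fderiv ℝ (a i) x (e i) := by
  have ha' : ∀ i, Continuous fun x => fderiv ℝ (a i) x (e i) := fun i =>
    ((ha i).continuous_fderiv one_ne_zero).clm_apply continuous_const
  have hcont : Continuous fun x => P x - ∑ i, fderiv ℝ (a i) x (e i) :=
    hP.sub (continuous_finsetSum _ fun i _ => ha' i)
  have hae := ae_eq_zero_of_integral_contDiff_smul_eq_zero (μ := μ) hcont.locallyIntegrable
    fun η hη hηs => by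
      have hη' : ∀ i, Continuous fun x => fderiv ℝ η x (e i) := fun i =>
        (hη.continuous_fderiv (by simp)).clm_apply continuous_const
      have hint : ∀ {f : E → ℝ}, Continuous f → Integrable (fun x => f x * η x) μ := fun hf =>
        (hf.mul hη.continuous).integrable_of_hasCompactSupport hηs.mul_left
      have hint' : ∀ i, Integrable (fun x => a i x * fderiv ℝ η x (e i)) μ := fun i =>
        ((ha i).continuous.mul (hη' i)).integrable_of_hasCompactSupport
          (hηs.fderiv_apply ℝ (e i)).mul_left
      have hweak := h η hη hηs
      rw [integral_add (hint hP) (integrable_finsetSum _ fun i _ => hint' i),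
        integral_finsetSum _ fun i _ => hint' i] at hweak
      simp only [integral_mul_fderiv_eq_neg_of_hasCompactSupport (ha _) (hη.of_le (by simp)) hηs,
        Finset.sum_neg_distrib] at hweak
      simp only [smul_eq_mul, mul_comm (η _), sub_mul, Finset.sum_mul]
      rw [integral_sub (hint hP) (integrable_finsetSum _ fun i _ => hint (ha' i)),
        integral_finsetSum _ fun i _ => hint (ha' i)]
      linarith
  have hzero := hcont.ae_eq_iff_eq μ continuous_const |>.1 hae
  exact sub_eq_zero.1 (congrFun hzero x)

lemma IsNullLagrangian.euler_lagrange (H : IsNullLagrangian μ W (affineLagrangian B A e))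
    (hW : IsOpen W) (hB : ContDiffOn ℝ ∞ B (Set.univ ×ˢ W))
    (hA : ∀ i, ContDiffOn ℝ ∞ (A i) (Set.univ ×ˢ W))
    (hφ : ContDiff ℝ ∞ φ) (hφW : ∀ x, φ x ∈ W) (v : V) (x : E) :
    fderiv ℝ B (x, φ x) (0, v) + ∑ i, fderiv ℝ (A i) (x, φ x) (0, v) (fderiv ℝ φ x (e i)) =
      ∑ i, fderiv ℝ (fun y => A i (y, φ y) v) x (e i) :=
  eq_sum_fderiv_of_integral_eq_zero (μ := μ)
    ((continuous_fderiv_graph hW hB hφ.continuous hφW _).add <| continuous_finsetSum _ fun i _ =>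
      (continuous_fderiv_graph hW (hA i) hφ.continuous hφW _).clm_apply
        ((hφ.continuous_fderiv (by simp)).clm_apply continuous_const))
    (fun i => (((hA i).comp_contDiff (contDiff_id.prodMk hφ) fun x => ⟨trivial, hφW x⟩).clm_apply
      contDiff_const).of_le (by simp)) e
    (fun _ hη hηs => H.integral_firstVariation_eq_zero hW hB hA hφ hφW hη hηs v) x

lemma IsNullLagrangian.jet_euler_lagrange (H : IsNullLagrangian μ W (affineLagrangian B A e))
    (hW : IsOpen W) (hB : ContDiffOn ℝ ∞ B (Set.univ ×ˢ W))
    (hA : ∀ i, ContDiffOn ℝ ∞ (A i) (Set.univ ×ˢ W)) (x : E) {y : V} (hy : y ∈ W)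
    (l : E →L[ℝ] ℝ) (v w : V) :
    fderiv ℝ B (x, y) (0, v) + ∑ i, l (e i) * fderiv ℝ (A i) (x, y) (0, v) w =
      ∑ i, (fderiv ℝ (A i) (x, y) (e i, 0) v + l (e i) * fderiv ℝ (A i) (x, y) (0, w) v) := by
  obtain ⟨φ, hφ, hφW, rfl, hd⟩ := exists_contDiff_eq_hasFDerivAt hW hy x l w
  have hxA : ∀ i, HasFDerivAt (A i) (fderiv ℝ (A i) (x, φ x)) (x, φ x) := fun i =>
    (((hA i).contDiffAt ((isOpen_univ.prod hW).mem_nhds ⟨trivial, hφW x⟩)).differentiableAt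
      (by simp)).hasFDerivAt
  have hchain : ∀ i, fderiv ℝ (fun z => A i (z, φ z) v) x (e i) =
      fderiv ℝ (A i) (x, φ x) (e i, 0) v + l (e i) * fderiv ℝ (A i) (x, φ x) (0, w) v := by
    intro i
    have hcomp : HasFDerivAt (fun z => A i (z, φ z)) _ x :=
      (hxA i).comp x ((hasFDerivAt_id x).prodMk hd)
    rw [(hcomp.clm_apply (hasFDerivAt_const v x)).fderiv]
    have hsplit : (e i, l (e i) • w) = (e i, (0 : V)) + l (e i) • ((0 : E), w) := by simp
    rw [← smul_eq_mul, ← smul_apply, ← add_apply, ← map_smul, ← map_add, ← hsplit]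
    simp
  have hEL := H.euler_lagrange hW hB hA hφ hφW v x
  simpa [hd.fderiv, hchain] using hEL

lemma IsNullLagrangian.fderiv_eq_sum (H : IsNullLagrangian μ W (affineLagrangian B A e))
    (hW : IsOpen W) (hB : ContDiffOn ℝ ∞ B (Set.univ ×ˢ W))
    (hA : ∀ i, ContDiffOn ℝ ∞ (A i) (Set.univ ×ˢ W)) (x : E) {y : V} (hy : y ∈ W) (v : V) :
    fderiv ℝ B (x, y) (0, v) = ∑ i, fderiv ℝ (A i) (x, y) (e i, 0) v := by
  simpa using H.jet_euler_lagrange hW hB hA x hy 0 v 0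

lemma IsNullLagrangian.fderiv_apply_comm {b : Module.Basis ι ℝ E}
    (H : IsNullLagrangian μ W (affineLagrangian B A b)) (hW : IsOpen W)
    (hB : ContDiffOn ℝ ∞ B (Set.univ ×ˢ W)) (hA : ∀ i, ContDiffOn ℝ ∞ (A i) (Set.univ ×ˢ W))
    (x : E) {y : V} (hy : y ∈ W) (v w : V) (k : ι) :
    fderiv ℝ (A k) (x, y) (0, v) w = fderiv ℝ (A k) (x, y) (0, w) v := by
  classical
  have h := H.jet_euler_lagrange hW hB hA x hy (b.coord k).toContinuousLinearMap v w
  rw [H.fderiv_eq_sum hW hB hA x hy v, Finset.sum_add_distrib] at h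
  simpa [Finsupp.single_apply] using h

end AffineLagrangian

/-! ### Smooth functions of `(t, x, u, ρ, p)` -/

section States

variable {n : ℕ}

/-- The space of values `(u, ρ, p)` of the fluid variables. -/
abbrev FluidState (n : ℕ) := Space n × ℝ × ℝ

/-- The space of `(t, x, u, ρ, p)`. -/
abbrev State (n : ℕ) := ℝ × Space n × FluidState n

/-- The arguments `(t, x, u, ρ, p)` whose thermodynamic state `(p, ρ)` lies in `Ω`. -/
def stateDomain (n : ℕ) (Ω : Set (ℝ × ℝ)) : Set (State n) := {q | (q.2.2.2.2, q.2.2.2.1) ∈ Ω}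

/-- A function of kinematic form as a function on the space of states. -/
def KinematicFunction.onState (T : KinematicFunction n) : State n → ℝ :=
  fun q => T q.1 q.2.1 q.2.2.1 q.2.2.2.1 q.2.2.2.2

/-- The projection `(t, x, u, ρ, p) ↦ (p, ρ)`. -/
def thermoProj (n : ℕ) : State n →L[ℝ] ℝ × ℝ :=
  let tail := ContinuousLinearMap.snd ℝ (Space n) (ℝ × ℝ) ∘L
    ContinuousLinearMap.snd ℝ (Space n) (Space n × ℝ × ℝ) ∘L
    ContinuousLinearMap.snd ℝ ℝ (Space n × Space n × ℝ × ℝ)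
  (ContinuousLinearMap.snd ℝ ℝ ℝ ∘L tail).prod (ContinuousLinearMap.fst ℝ ℝ ℝ ∘L tail)

@[simp] lemma thermoProj_apply (q : State n) : thermoProj n q = (q.2.2.2.2, q.2.2.2.1) := rfl

lemma isOpen_stateDomain {Ω : Set (ℝ × ℝ)} (hΩ : IsOpen Ω) : IsOpen (stateDomain n Ω) :=
  hΩ.preimage (thermoProj n).continuous

lemma isPreconnected_stateDomain {Ω : Set (ℝ × ℝ)} (hΩ : IsPreconnected Ω) :
    IsPreconnected (stateDomain n Ω) := by
  have hprod : IsPreconnected ((Set.univ : Set (ℝ × Space n × Space n)) ×ˢ Ω) :=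
    isPreconnected_univ.prod hΩ
  convert hprod.image (fun z => ((z.1.1, z.1.2.1, z.1.2.2, z.2.2, z.2.1) : State n))
    (by fun_prop)
  ext ⟨t, x, u, ρ, p⟩
  simp [stateDomain]

/-- The unit vector in a coordinate direction. -/
def Direction.vec : Direction n → State n
  | .t => (1, 0, 0, 0, 0)
  | .x i => (0, EuclideanSpace.single i 1, 0, 0, 0)
  | .u i => (0, 0, EuclideanSpace.single i 1, 0, 0)
  | .r => (0, 0, 0, 1, 0)
  | .p => (0, 0, 0, 0, 1)

section Partial

variable {G : State n → ℝ} {t : ℝ} {x u : Space n} {ρ p : ℝ}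
  (hG : DifferentiableAt ℝ G (t, x, u, ρ, p))
include hG

lemma hasDerivAt_state_t :
    HasDerivAt (fun s => G (s, x, u, ρ, p)) (fderiv ℝ G (t, x, u, ρ, p) Direction.t.vec) t :=
  hG.hasFDerivAt.comp_hasDerivAt t
    ((hasDerivAt_id t).prodMk (hasDerivAt_const t ((x, u, ρ, p) : Space n × Space n × ℝ × ℝ)))

lemma fderiv_state_u (v : Space n) :
    fderiv ℝ (fun w => G (t, x, w, ρ, p)) u v = fderiv ℝ G (t, x, u, ρ, p) (0, 0, v, 0, 0) := by
  have h : HasFDerivAt (fun w => G (t, x, w, ρ, p)) _ u := hG.hasFDerivAt.comp u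
    ((hasFDerivAt_const t u).prodMk ((hasFDerivAt_const x u).prodMk
      ((hasFDerivAt_id u).prodMk (hasFDerivAt_const ((ρ, p) : ℝ × ℝ) u))))
  rw [h.fderiv]
  rfl

lemma hasDerivAt_state_r :
    HasDerivAt (fun s => G (t, x, u, s, p)) (fderiv ℝ G (t, x, u, ρ, p) Direction.r.vec) ρ :=
  hG.hasFDerivAt.comp_hasDerivAt ρ ((hasDerivAt_const ρ t).prodMk ((hasDerivAt_const ρ x).prodMk
    ((hasDerivAt_const ρ u).prodMk ((hasDerivAt_id ρ).prodMk (hasDerivAt_const ρ p)))))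

lemma hasDerivAt_state_p :
    HasDerivAt (fun s => G (t, x, u, ρ, s)) (fderiv ℝ G (t, x, u, ρ, p) Direction.p.vec) p :=
  hG.hasFDerivAt.comp_hasDerivAt p ((hasDerivAt_const p t).prodMk ((hasDerivAt_const p x).prodMk
    ((hasDerivAt_const p u).prodMk ((hasDerivAt_const p ρ).prodMk (hasDerivAt_id p)))))

end Partial

variable {Ω : Set (ℝ × ℝ)}

lemma smoothDeriv_clm (hD : IsOpen (stateDomain n Ω)) (l : State n →L[ℝ] ℝ) (v : State n) :
    smoothDeriv hD v (restrictSmooth l l.contDiff.contDiffOn) =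
      algebraMap ℝ (smoothAlgebra (stateDomain n Ω)) (l v) := by
  rw [smoothDeriv_restrictSmooth]
  ext q
  rw [restrictSmooth_apply, ContinuousLinearMap.fderiv]
  rfl

/-- A function of the thermodynamic state in the ring of smooth functions of all variables. -/
def thermoFun (F : ℝ × ℝ → ℝ) (hF : ContDiffOn ℝ ∞ F Ω) : smoothAlgebra (stateDomain n Ω) :=
  restrictSmooth (fun q => F (thermoProj n q))
    (hF.comp (thermoProj n).contDiff.contDiffOn fun _ hq => hq)

lemma smoothDeriv_thermoFun_apply (hΩ : IsOpen Ω) (F : ℝ × ℝ → ℝ) (hF : ContDiffOn ℝ ∞ F Ω)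
    (v : State n) (q : stateDomain n Ω) :
    (smoothDeriv (isOpen_stateDomain hΩ) v (thermoFun F hF)).1 q =
      fderiv ℝ F (thermoProj n q) (thermoProj n v) := by
  have h : HasFDerivAt (fun q => F (thermoProj n q)) _ q.1 :=
    ((hF.contDiffAt (hΩ.mem_nhds q.2)).differentiableAt (by simp)).hasFDerivAt.comp q.1
      (thermoProj n).hasFDerivAt
  rw [thermoFun, smoothDeriv_restrictSmooth, restrictSmooth_apply, h.fderiv]
  rfl

lemma smoothDeriv_thermoFun_eq_zero (hΩ : IsOpen Ω) (F : ℝ × ℝ → ℝ) (hF : ContDiffOn ℝ ∞ F Ω)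
    {v : State n} (hv : thermoProj n v = 0) :
    smoothDeriv (isOpen_stateDomain hΩ) v (thermoFun F hF) = 0 := by
  ext q
  rw [smoothDeriv_thermoFun_apply hΩ, hv, map_zero]
  rfl

lemma thermoFun_mem_nonZeroDivisors (hΩ : IsOpen Ω) {F : ℝ × ℝ → ℝ} (hF : ContDiffOn ℝ ∞ F Ω)
    (hF_ne : ∀ W : Set (ℝ × ℝ), W ⊆ Ω → IsOpen W → W.Nonempty → ∃ q ∈ W, F q ≠ 0) :
    thermoFun F hF ∈ nonZeroDivisors (smoothAlgebra (stateDomain n Ω)) := by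
  refine mem_nonZeroDivisors_iff_right.2 fun f hf => ?_
  ext ⟨⟨t, x, u, ρ, p⟩, hq⟩
  by_contra hne
  set g : ℝ × ℝ → ℝ := fun s => extendZero f.1 (t, x, u, s.2, s.1) with hg
  have hgc : ContinuousOn g Ω :=
    (contDiffOn_extendZero f).continuousOn.comp (by fun_prop) fun s hs => hs
  obtain ⟨s, ⟨hs, hgs⟩, hFs⟩ := hF_ne (Ω ∩ g ⁻¹' {0}ᶜ) Set.inter_subset_left
    (hgc.isOpen_inter_preimage hΩ isOpen_compl_singleton)
    ⟨(p, ρ), hq, by simpa [hg, extendZero_of_mem f.1 (q := (t, x, u, ρ, p)) hq] using hne⟩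
  have hsD : (t, x, u, s.2, s.1) ∈ stateDomain n Ω := hs
  have hfs : f.1 ⟨_, hsD⟩ * F s = 0 := congrFun (congrArg Subtype.val hf) ⟨_, hsD⟩
  exact hgs (by simpa [hg, extendZero_of_mem f.1 hsD, hFs] using hfs)

/-- The velocity component `uʲ` as a linear function on the space of states. -/
def velocityProj (j : Fin n) : State n →L[ℝ] ℝ :=
  EuclideanSpace.proj j ∘L ContinuousLinearMap.fst ℝ (Space n) (ℝ × ℝ) ∘L
    ContinuousLinearMap.snd ℝ (Space n) (Space n × ℝ × ℝ) ∘L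
    ContinuousLinearMap.snd ℝ ℝ (Space n × Space n × ℝ × ℝ)

@[simp] lemma velocityProj_apply (j : Fin n) (q : State n) : velocityProj j q = q.2.2.1 j := rfl

/-- The density as a linear function on the space of states. -/
def densityProj (n : ℕ) : State n →L[ℝ] ℝ := ContinuousLinearMap.snd ℝ ℝ ℝ ∘L thermoProj n

@[simp] lemma densityProj_apply (q : State n) : densityProj n q = q.2.2.2.1 := rfl

/-- The differential ring of smooth functions of `(t, x, u, ρ, p)` with state function `F`. -/
def stateRing (n : ℕ) (hΩ : IsOpen Ω) (hpos : ∀ p ρ : ℝ, (p, ρ) ∈ Ω → 0 < ρ)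
    (F : ℝ × ℝ → ℝ) (hF : ContDiffOn ℝ ∞ F Ω) :
    StateRing n (smoothAlgebra (stateDomain n Ω)) where
  D a := smoothDeriv (isOpen_stateDomain hΩ) a.vec
  comm a b f := smoothDeriv_comm _ _ _ f
  u j := restrictSmooth (velocityProj j) (velocityProj j).contDiff.contDiffOn
  r := restrictSmooth (densityProj n) (densityProj n).contDiff.contDiffOn
  rinv := restrictSmooth (fun q => (densityProj n q)⁻¹)
    ((densityProj n).contDiff.contDiffOn.inv fun q hq => (hpos _ _ hq).ne')
  F := thermoFun F hF
  r_mul_rinv := by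
    ext q
    exact mul_inv_cancel₀ (hpos _ _ q.2).ne'
  D_t_u j := by simp [smoothDeriv_clm, Direction.vec]
  D_x_u i j := by simp [smoothDeriv_clm, Direction.vec]
  D_u_u i j := by by_cases h : i = j <;> simp [smoothDeriv_clm, Direction.vec, h, Ne.symm]
  D_r_u j := by simp [smoothDeriv_clm, Direction.vec]
  D_p_u j := by simp [smoothDeriv_clm, Direction.vec]
  D_t_r := by simp [smoothDeriv_clm, Direction.vec]
  D_x_r i := by simp [smoothDeriv_clm, Direction.vec]
  D_u_r i := by simp [smoothDeriv_clm, Direction.vec]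
  D_r_r := by simp [smoothDeriv_clm, Direction.vec]
  D_p_r := by simp [smoothDeriv_clm, Direction.vec]
  D_t_F := smoothDeriv_thermoFun_eq_zero hΩ F hF rfl
  D_x_F i := smoothDeriv_thermoFun_eq_zero hΩ F hF rfl
  D_u_F i := smoothDeriv_thermoFun_eq_zero hΩ F hF rfl

end States

/-! ### Conserved densities are null Lagrangians -/

section Conserved

open MeasureTheory Filter Topology

variable {n : ℕ} {Ω : Set (ℝ × ℝ)} {F : ℝ × ℝ → ℝ}

lemma clm_apply_eq_sum_single {E : Type*} [NormedAddCommGroup E] [NormedSpace ℝ E]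
    (l : Space n →L[ℝ] E) (w : Space n) :
    l w = ∑ i, w i • l (EuclideanSpace.single i 1) := by
  conv_lhs => rw [← (EuclideanSpace.basisFun (Fin n) ℝ).sum_repr w]
  simp

lemma gradient_apply (f : Space n → ℝ) (x : Space n) (i : Fin n) :
    gradient f x i = fderiv ℝ f x (EuclideanSpace.single i 1) := by
  rw [← inner_gradient_left, EuclideanSpace.inner_single_right]
  simp

/-- The values `(u, ρ, p)` of fluid variables whose thermodynamic state lies in `Ω`. -/
def fluidDomain (n : ℕ) (Ω : Set (ℝ × ℝ)) : Set (FluidState n) := {w | (w.2.2, w.2.1) ∈ Ω}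

lemma isOpen_fluidDomain (hΩ : IsOpen Ω) : IsOpen (fluidDomain n Ω) :=
  hΩ.preimage (by fun_prop : Continuous fun w : FluidState n => (w.2.2, w.2.1))

namespace FluidField

/-- Fluid variables as a single map into `(u, ρ, p)`-space. -/
def toMap (φ : FluidField n Ω) (x : Space n) : FluidState n := (φ.u x, φ.ρ x, φ.p x)

/-- The fluid variables with prescribed values. -/
def ofMap (φ : Space n → FluidState n) (hφ : ContDiff ℝ ∞ φ) (hm : ∀ x, φ x ∈ fluidDomain n Ω) :
    FluidField n Ω where
  u x := (φ x).1
  ρ x := (φ x).2.1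
  p x := (φ x).2.2
  smooth_u := hφ.fst
  smooth_ρ := hφ.snd.fst
  smooth_p := hφ.snd.snd
  mem := hm

lemma contDiff_toMap (φ : FluidField n Ω) : ContDiff ℝ ∞ φ.toMap :=
  φ.smooth_u.prodMk (φ.smooth_ρ.prodMk φ.smooth_p)

lemma fderiv_toMap_apply (φ : FluidField n Ω) (x v : Space n) :
    fderiv ℝ φ.toMap x v = (fderiv ℝ φ.u x v, fderiv ℝ φ.ρ x v, fderiv ℝ φ.p x v) := by
  have hu := (φ.smooth_u.differentiable (by simp) x).hasFDerivAt
  have hρ := (φ.smooth_ρ.differentiable (by simp) x).hasFDerivAt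
  have hp := (φ.smooth_p.differentiable (by simp) x).hasFDerivAt
  have h : HasFDerivAt φ.toMap _ x := hu.prodMk (hρ.prodMk hp)
  rw [h.fderiv]
  rfl

lemma contDiff_jet (k : ℕ) (φ : FluidField n Ω) : ContDiff ℝ ∞ (φ.jet k) :=
  contDiff_pi.2 fun _ => φ.contDiff_toMap.iteratedFDeriv_right (by exact_mod_cast le_top)

lemma jet_base (k : ℕ) (φ : FluidField n Ω) (x : Space n) : (φ.jet k x).base = φ.toMap x :=
  iteratedFDeriv_zero_apply _

lemma jet_eq_of_notMem_tsupport (k : ℕ) {φ ψ : FluidField n Ω} {x : Space n}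
    (hx : x ∉ tsupport (φ.toMap - ψ.toMap)) : φ.jet k x = ψ.jet k x := by
  have h : φ.toMap =ᶠ[𝓝 x] ψ.toMap := by
    filter_upwards [notMem_tsupport_iff_eventuallyEq.1 hx] with y hy using sub_eq_zero.1 hy
  funext j
  exact (h.iteratedFDeriv ℝ j).self_of_nhds

end FluidField

/-- The matrix `Mᵢ(u, ρ, p)` in the form `φ_t + ∑ᵢ Mᵢ(φ) ∂ᵢφ = 0` of the gas dynamics equations,
where `φ = (u, ρ, p)`. -/
def gasMatrix (F : ℝ × ℝ → ℝ) (i : Fin n) (w : FluidState n) : FluidState n →L[ℝ] FluidState n :=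
  w.1 i • ContinuousLinearMap.id ℝ (FluidState n)
    + (EuclideanSpace.proj i ∘L ContinuousLinearMap.fst ℝ (Space n) (ℝ × ℝ)).smulRight
        ((0, w.2.1, F (w.2.2, w.2.1)) : FluidState n)
    + (w.2.1⁻¹ • ContinuousLinearMap.snd ℝ ℝ ℝ ∘L
        ContinuousLinearMap.snd ℝ (Space n) (ℝ × ℝ)).smulRight
        ((EuclideanSpace.single i 1, 0, 0) : FluidState n)

lemma gasMatrix_apply (i : Fin n) (w v : FluidState n) : gasMatrix F i w v =
    w.1 i • v + v.1 i • ((0, w.2.1, F (w.2.2, w.2.1)) : FluidState n)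
      + (w.2.1⁻¹ * v.2.2) • ((EuclideanSpace.single i 1, 0, 0) : FluidState n) := rfl

lemma contDiffOn_gasMatrix (hpos : ∀ p ρ : ℝ, (p, ρ) ∈ Ω → 0 < ρ) (hF : ContDiffOn ℝ ∞ F Ω)
    (i : Fin n) : ContDiffOn ℝ ∞ (gasMatrix F i) (fluidDomain n Ω) := by
  refine contDiffOn_clm_apply.2 fun v => ?_
  simp only [gasMatrix_apply]
  have hu : ContDiffOn ℝ ∞ (fun w : FluidState n => w.1 i) (fluidDomain n Ω) :=
    ((EuclideanSpace.proj i : Space n →L[ℝ] ℝ).contDiff.comp contDiff_fst).contDiffOn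
  have hρ : ContDiffOn ℝ ∞ (fun w : FluidState n => w.2.1) (fluidDomain n Ω) := by fun_prop
  have hF' : ContDiffOn ℝ ∞ (fun w : FluidState n => F (w.2.2, w.2.1)) (fluidDomain n Ω) :=
    hF.comp (by fun_prop) fun _ hw => hw
  have hv : ContDiffOn ℝ ∞ (fun w : FluidState n => w.1 i • v) (fluidDomain n Ω) :=
    hu.smul contDiffOn_const
  have hdiv : ContDiffOn ℝ ∞ (fun w : FluidState n => v.1 i • ((0, w.2.1, F (w.2.2, w.2.1)) :
      FluidState n)) (fluidDomain n Ω) :=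
    (contDiffOn_const.prodMk (hρ.prodMk hF')).const_smul (v.1 i)
  have hgrad : ContDiffOn ℝ ∞ (fun w : FluidState n => (w.2.1⁻¹ * v.2.2) •
      ((EuclideanSpace.single i 1, 0, 0) : FluidState n)) (fluidDomain n Ω) :=
    ((hρ.inv fun w hw => (hpos _ _ hw).ne').mul contDiffOn_const).smul contDiffOn_const
  exact (hv.add hdiv).add hgrad

namespace FluidField

lemma uDot_eq_neg_sum (φ : FluidField n Ω) (x : Space n) : φ.uDot x =
    -∑ i, (φ.u x i • fderiv ℝ φ.u x (EuclideanSpace.single i 1)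
      + ((φ.ρ x)⁻¹ * fderiv ℝ φ.p x (EuclideanSpace.single i 1)) • EuclideanSpace.single i 1) := by
  rw [uDot, Finset.sum_add_distrib, neg_add, ← clm_apply_eq_sum_single, sub_eq_add_neg]
  congr 2
  have h := clm_apply_eq_sum_single (.id ℝ (Space n)) (gradient φ.p x)
  simp only [ContinuousLinearMap.id_apply, gradient_apply] at h
  rw [h, Finset.smul_sum]
  simp only [smul_smul, one_div]

lemma ρDot_eq_neg_sum (φ : FluidField n Ω) (x : Space n) : φ.ρDot x =
    -∑ i, (φ.u x i * fderiv ℝ φ.ρ x (EuclideanSpace.single i 1)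
      + fderiv ℝ φ.u x (EuclideanSpace.single i 1) i * φ.ρ x) := by
  rw [ρDot, divergence, fderiv_fun_smul (φ.smooth_ρ.differentiable (by simp) x)
    (φ.smooth_u.differentiable (by simp) x)]
  congr 1
  refine Finset.sum_congr rfl fun i _ => ?_
  simp
  ring

lemma pDot_eq_neg_sum (φ : FluidField n Ω) (x : Space n) : φ.pDot F x =
    -∑ i, (φ.u x i * fderiv ℝ φ.p x (EuclideanSpace.single i 1)
      + fderiv ℝ φ.u x (EuclideanSpace.single i 1) i * F (φ.p x, φ.ρ x)) := by
  rw [pDot, inner_gradient_right, clm_apply_eq_sum_single (fderiv ℝ φ.p x) (φ.u x), divergence,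
    Finset.mul_sum, Finset.sum_add_distrib]
  simp only [smul_eq_mul, mul_comm (F _), conj_trivial]
  ring

lemma timeDeriv_eq_neg_sum_gasMatrix (φ : FluidField n Ω) (x : Space n) :
    (φ.uDot x, φ.ρDot x, φ.pDot F x) =
      -∑ i, gasMatrix F i (φ.toMap x) (fderiv ℝ φ.toMap x (EuclideanSpace.single i 1)) := by
  rw [uDot_eq_neg_sum, ρDot_eq_neg_sum, pDot_eq_neg_sum]
  simp [gasMatrix_apply, fderiv_toMap_apply, toMap, Prod.ext_iff, Prod.fst_sum, Prod.snd_sum]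

end FluidField

/-- The inclusion of the space of `(u, ρ, p)` into the space of `(t, x, u, ρ, p)`. -/
def fluidIncl (n : ℕ) : FluidState n →L[ℝ] State n :=
  ContinuousLinearMap.inr ℝ ℝ (Space n × FluidState n) ∘L
    ContinuousLinearMap.inr ℝ (Space n) (FluidState n)

lemma fluidIncl_apply (w : FluidState n) : fluidIncl n w = (0, 0, w) := rfl

/-- The coefficient of `∂ᵢ(u, ρ, p)` in the total time derivative of `G`. -/
def gradCoeff (F : ℝ × ℝ → ℝ) (G : State n → ℝ) (i : Fin n) (q : State n) :
    FluidState n →L[ℝ] ℝ :=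
  -(fderiv ℝ G q ∘L fluidIncl n ∘L gasMatrix F i q.2.2)

lemma gradCoeff_apply (G : State n → ℝ) (i : Fin n) (q : State n) (w : FluidState n) :
    gradCoeff F G i q w = -(q.2.2.1 i * fderiv ℝ G q (0, 0, w))
      - (q.2.2.2.1 * fderiv ℝ G q Direction.r.vec
        + F (thermoProj n q) * fderiv ℝ G q Direction.p.vec) * w.1 i
      - q.2.2.2.1⁻¹ * fderiv ℝ G q (Direction.u i).vec * w.2.2 := by
  have h : ((0, q.2.2.2.1, F (q.2.2.2.2, q.2.2.2.1)) : FluidState n) =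
      q.2.2.2.1 • ((0, 1, 0) : FluidState n)
        + F (q.2.2.2.2, q.2.2.2.1) • ((0, 0, 1) : FluidState n) := by
    simp
  simp only [gradCoeff, neg_apply, ContinuousLinearMap.comp_apply,
    gasMatrix_apply, h, map_add, map_smul, smul_eq_mul, fluidIncl_apply, Direction.vec,
    thermoProj_apply]
  ring

lemma contDiffOn_gradCoeff (hΩ : IsOpen Ω) (hpos : ∀ p ρ : ℝ, (p, ρ) ∈ Ω → 0 < ρ)
    (hF : ContDiffOn ℝ ∞ F Ω) {G : State n → ℝ} (hG : ContDiffOn ℝ ∞ G (stateDomain n Ω))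
    (i : Fin n) : ContDiffOn ℝ ∞ (gradCoeff F G i) (stateDomain n Ω) :=
  ((hG.fderiv_of_isOpen (isOpen_stateDomain hΩ) (by simp)).clm_comp (contDiffOn_const.clm_comp
    ((contDiffOn_gasMatrix hpos hF i).comp (by fun_prop) fun _ hq => hq))).neg

lemma totalTimeDeriv_eq_fderiv {T : KinematicFunction n} {φ : FluidField n Ω} {t : ℝ} {x : Space n}
    (hT : DifferentiableAt ℝ T.onState (t, x, φ.toMap x)) :
    totalTimeDeriv F T φ t x = fderiv ℝ T.onState (t, x, φ.toMap x) Direction.t.vec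
      + fderiv ℝ T.onState (t, x, φ.toMap x)
          (fluidIncl n (φ.uDot x, φ.ρDot x, φ.pDot F x)) := by
  have ht : deriv (fun s => T s x (φ.u x) (φ.ρ x) (φ.p x)) t = _ := (hasDerivAt_state_t hT).deriv
  have hr : deriv (fun r => T t x (φ.u x) r (φ.p x)) (φ.ρ x) = _ := (hasDerivAt_state_r hT).deriv
  have hp : deriv (fun r => T t x (φ.u x) (φ.ρ x) r) (φ.p x) = _ := (hasDerivAt_state_p hT).deriv
  have hu : fderiv ℝ (fun v => T t x v (φ.ρ x) (φ.p x)) (φ.u x) (φ.uDot x) = _ :=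
    fderiv_state_u hT (φ.uDot x)
  have hsplit : fluidIncl n (φ.uDot x, φ.ρDot x, φ.pDot F x) = (0, 0, φ.uDot x, 0, 0)
      + φ.ρDot x • (Direction.r.vec : State n) + φ.pDot F x • (Direction.p.vec : State n) := by
    simp [fluidIncl_apply, Direction.vec]
  rw [totalTimeDeriv, ht, hu, hr, hp, hsplit, map_add, map_add, map_smul, map_smul, smul_eq_mul,
    smul_eq_mul, FluidField.toMap]
  ring

lemma totalTimeDeriv_eq_affineLagrangian (hΩ : IsOpen Ω) {T : KinematicFunction n}
    (hT : T.IsSmooth Ω) (φ : FluidField n Ω) (t : ℝ) (x : Space n) :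
    totalTimeDeriv F T φ t x =
      affineLagrangian (fun z => fderiv ℝ T.onState (t, z) Direction.t.vec)
        (fun i z => gradCoeff F T.onState i (t, z)) (EuclideanSpace.single · 1) φ.toMap x := by
  have hd : DifferentiableAt ℝ T.onState (t, x, φ.toMap x) :=
    (ContDiffOn.contDiffAt hT ((isOpen_stateDomain hΩ).mem_nhds (φ.mem x))).differentiableAt
      (by simp)
  rw [totalTimeDeriv_eq_fderiv hd, φ.timeDeriv_eq_neg_sum_gasMatrix]
  simp [affineLagrangian, gradCoeff]

lemma contDiff_flux_jet {k : ℕ} {X : ℝ × Space n × Jet n k → Space n}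
    (hX : ContDiffOn ℝ ∞ X (jetDomain n k Ω)) (φ : FluidField n Ω) (t : ℝ) :
    ContDiff ℝ ∞ fun y => X (t, y, φ.jet k y) := by
  refine hX.comp_contDiff (contDiff_const.prodMk (contDiff_id.prodMk (φ.contDiff_jet k)))
    fun y => ?_
  simp only [jetDomain, Set.mem_ofPred_eq, FluidField.jet_base]
  exact φ.mem y

lemma fderiv_coord {E : Type*} [NormedAddCommGroup E] [NormedSpace ℝ E] {v : E → Space n} {x : E}
    (hv : DifferentiableAt ℝ v x) (w : E) (i : Fin n) :
    fderiv ℝ v x w i = fderiv ℝ (fun y => v y i) x w := by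
  have h : HasFDerivAt (fun y => v y i) _ x :=
    (EuclideanSpace.proj i : Space n →L[ℝ] ℝ).hasFDerivAt.comp x hv.hasFDerivAt
  rw [h.fderiv]
  rfl

lemma divergence_add {v w : Space n → Space n} {x : Space n} (hv : DifferentiableAt ℝ v x)
    (hw : DifferentiableAt ℝ w x) :
    divergence (v + w) x = divergence v x + divergence w x := by
  simp [divergence, fderiv_add hv hw, Finset.sum_add_distrib]

lemma divergence_sub {v w : Space n → Space n} {x : Space n} (hv : DifferentiableAt ℝ v x)
    (hw : DifferentiableAt ℝ w x) :
    divergence (v - w) x = divergence v x - divergence w x := by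
  simp [divergence, fderiv_sub hv hw]

lemma integral_divergence_eq_zero {v : Space n → Space n} (hv : ContDiff ℝ 1 v)
    (hvs : HasCompactSupport v) : ∫ x, divergence v x = 0 := by
  have hvi (i : Fin n) : ContDiff ℝ 1 fun y => v y i :=
    (EuclideanSpace.proj i : Space n →L[ℝ] ℝ).contDiff.comp hv
  have hvsi (i : Fin n) : HasCompactSupport fun y => v y i :=
    hvs.comp_left (g := fun w : Space n => w i) rfl
  simp only [divergence, fderiv_coord (hv.differentiable one_ne_zero _)]
  rw [integral_finsetSum]
  · exact Finset.sum_eq_zero fun i _ =>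
      integral_fderiv_apply_eq_zero_of_hasCompactSupport (hvi i) (hvsi i) _
  · exact fun i _ => (((hvi i).continuous_fderiv one_ne_zero).clm_apply
      continuous_const).integrable_of_hasCompactSupport ((hvsi i).fderiv_apply ℝ _)

namespace IsConservedDensity

variable {T : KinematicFunction n} (hT : IsConservedDensity F Ω T)
include hT

lemma contDiffOn : ContDiffOn ℝ ∞ T.onState (stateDomain n Ω) := hT.1

lemma integral_totalTimeDeriv_sub_eq_zero {φ ψ : FluidField n Ω}
    (h : HasCompactSupport (φ.toMap - ψ.toMap)) (t : ℝ) :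
    ∫ y, (totalTimeDeriv F T φ t y - totalTimeDeriv F T ψ t y) = 0 := by
  obtain ⟨-, k, X, hX, hdiv⟩ := hT
  have hφ := contDiff_flux_jet hX φ t
  have hψ := contDiff_flux_jet hX ψ t
  have hs : HasCompactSupport ((fun y => X (t, y, φ.jet k y)) - fun y => X (t, y, ψ.jet k y)) :=
    HasCompactSupport.intro h fun y hy => by
      simp [FluidField.jet_eq_of_notMem_tsupport k hy]
  have hL (y : Space n) : totalTimeDeriv F T φ t y - totalTimeDeriv F T ψ t y =
      -divergence ((fun y => X (t, y, φ.jet k y)) - fun y => X (t, y, ψ.jet k y)) y := by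
    rw [divergence_sub (hφ.differentiable (by simp) y) (hψ.differentiable (by simp) y)]
    linear_combination hdiv φ t y - hdiv ψ t y
  have hX0 := integral_divergence_eq_zero ((hφ.of_le (by simp)).sub (hψ.of_le (by simp))) hs
  simp only [hL, integral_neg]
  exact neg_eq_zero.2 hX0

lemma isNullLagrangian (hΩ : IsOpen Ω) (t : ℝ) :
    IsNullLagrangian volume (fluidDomain n Ω)
      (affineLagrangian (fun z => fderiv ℝ T.onState (t, z) Direction.t.vec)
        (fun i z => gradCoeff F T.onState i (t, z)) (EuclideanSpace.single · 1)) := by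
  intro φ ψ hφ hψ hφm hψm hs
  have h := hT.integral_totalTimeDeriv_sub_eq_zero (φ := .ofMap φ hφ hφm) (ψ := .ofMap ψ hψ hψm)
    hs t
  simp only [totalTimeDeriv_eq_affineLagrangian hΩ hT.1] at h
  exact h

end IsConservedDensity

lemma fderiv_comp_prodMk_apply {E Y : Type*} [NormedAddCommGroup E] [NormedSpace ℝ E]
    [NormedAddCommGroup Y] [NormedSpace ℝ Y] {f : ℝ × E → Y} {t : ℝ} {z : E}
    (hf : DifferentiableAt ℝ f (t, z)) (v : E) :
    fderiv ℝ (fun z => f (t, z)) z v = fderiv ℝ f (t, z) (0, v) := by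
  have h : HasFDerivAt (fun z => f (t, z)) _ z :=
    hf.hasFDerivAt.comp z (hasFDerivAt_prodMk_right t z)
  rw [h.fderiv]
  rfl

lemma fderiv_clm_apply_const {E V Y : Type*} [NormedAddCommGroup E] [NormedSpace ℝ E]
    [NormedAddCommGroup V] [NormedSpace ℝ V] [NormedAddCommGroup Y] [NormedSpace ℝ Y]
    {f : E → V →L[ℝ] Y} {z : E} (hf : DifferentiableAt ℝ f z) (v : E) (w : V) :
    fderiv ℝ (fun z => f z w) z v = fderiv ℝ f z v w := by
  rw [fderiv_clm_apply hf (differentiableAt_const w)]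
  simp

namespace IsConservedDensity

variable {T : KinematicFunction n} (hT : IsConservedDensity F Ω T) (hΩ : IsOpen Ω)
  (hpos : ∀ p ρ : ℝ, (p, ρ) ∈ Ω → 0 < ρ) (hF : ContDiffOn ℝ ∞ F Ω)
include hT hΩ hpos hF

lemma contDiffOn_gradCoeff_prodMk (t : ℝ) (i : Fin n) :
    ContDiffOn ℝ ∞ (fun z => gradCoeff F T.onState i (t, z)) (Set.univ ×ˢ fluidDomain n Ω) :=
  (contDiffOn_gradCoeff hΩ hpos hF hT.1 i).comp (by fun_prop) fun _ hz => hz.2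

omit hpos hF in
lemma contDiffOn_fderiv_t_prodMk (t : ℝ) :
    ContDiffOn ℝ ∞ (fun z => fderiv ℝ T.onState (t, z) Direction.t.vec)
      (Set.univ ×ˢ fluidDomain n Ω) :=
  (contDiffOn_fderiv_apply (isOpen_stateDomain hΩ) hT.1 _).comp (by fun_prop) fun _ hz => hz.2

lemma fderiv_gradCoeff_comm {q : State n} (hq : q ∈ stateDomain n Ω) (v w : FluidState n)
    (i : Fin n) : fderiv ℝ (fun z => gradCoeff F T.onState i z w) q (0, 0, v) =
      fderiv ℝ (fun z => gradCoeff F T.onState i z v) q (0, 0, w) := by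
  obtain ⟨t, x, y⟩ := q
  have hd : DifferentiableAt ℝ (gradCoeff F T.onState i) (t, x, y) :=
    ((contDiffOn_gradCoeff hΩ hpos hF hT.1 i).contDiffAt
      ((isOpen_stateDomain hΩ).mem_nhds hq)).differentiableAt (by simp)
  have hb : (fun i : Fin n => EuclideanSpace.single i (1 : ℝ)) =
      (EuclideanSpace.basisFun (Fin n) ℝ).toBasis := by
    ext1 i
    simp
  have h := hb ▸ hT.isNullLagrangian hΩ t
  have hc := h.fderiv_apply_comm (isOpen_fluidDomain hΩ)
    (hT.contDiffOn_fderiv_t_prodMk hΩ t) (hT.contDiffOn_gradCoeff_prodMk hΩ hpos hF t) x hq v w i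
  rwa [fderiv_comp_prodMk_apply hd, fderiv_comp_prodMk_apply hd, ← fderiv_clm_apply_const hd,
    ← fderiv_clm_apply_const hd] at hc

lemma fderiv_fderiv_t_eq_sum {q : State n} (hq : q ∈ stateDomain n Ω) (v : FluidState n) :
    fderiv ℝ (fun z => fderiv ℝ T.onState z Direction.t.vec) q (0, 0, v) =
      ∑ i, fderiv ℝ (fun z => gradCoeff F T.onState i z v) q (Direction.x i).vec := by
  obtain ⟨t, x, y⟩ := q
  have hd (i) : DifferentiableAt ℝ (gradCoeff F T.onState i) (t, x, y) :=
    ((contDiffOn_gradCoeff hΩ hpos hF hT.1 i).contDiffAt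
      ((isOpen_stateDomain hΩ).mem_nhds hq)).differentiableAt (by simp)
  have hd' : DifferentiableAt ℝ (fun z => fderiv ℝ T.onState z Direction.t.vec) (t, x, y) :=
    ((contDiffOn_fderiv_apply (isOpen_stateDomain hΩ) hT.1 _).contDiffAt
      ((isOpen_stateDomain hΩ).mem_nhds hq)).differentiableAt (by simp)
  have h := (hT.isNullLagrangian hΩ t).fderiv_eq_sum (isOpen_fluidDomain hΩ)
    (hT.contDiffOn_fderiv_t_prodMk hΩ t) (hT.contDiffOn_gradCoeff_prodMk hΩ hpos hF t) x hq v
  simp only [fderiv_comp_prodMk_apply (hd _), fderiv_comp_prodMk_apply hd',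
    ← fderiv_clm_apply_const (hd _)] at h
  exact h

end IsConservedDensity

section Ring

variable (hΩ : IsOpen Ω) (hpos : ∀ p ρ : ℝ, (p, ρ) ∈ Ω → 0 < ρ) (hF : ContDiffOn ℝ ∞ F Ω)

/-- The component along `w` of the coefficient of `∂ᵢ(u, ρ, p)` in the total time derivative of
`G`, in the ring of smooth functions. -/
def gradCoeffElt {G : State n → ℝ} (hG : ContDiffOn ℝ ∞ G (stateDomain n Ω)) (w : FluidState n)
    (i : Fin n) : smoothAlgebra (stateDomain n Ω) :=
  restrictSmooth (fun q => gradCoeff F G i q w)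
    ((contDiffOn_gradCoeff hΩ hpos hF hG i).clm_apply contDiffOn_const)

variable {G : State n → ℝ} (hG : ContDiffOn ℝ ∞ G (stateDomain n Ω))

lemma stateRing_D_restrictSmooth (a : Direction n) :
    (stateRing n hΩ hpos F hF).D a (restrictSmooth G hG) =
      restrictSmooth (fun q => fderiv ℝ G q a.vec)
        (contDiffOn_fderiv_apply (isOpen_stateDomain hΩ) hG a.vec) :=
  smoothDeriv_restrictSmooth (isOpen_stateDomain hΩ) _ _

lemma coeffU_restrictSmooth (i j : Fin n) :
    (stateRing n hΩ hpos F hF).coeffU (restrictSmooth G hG) i j =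
      gradCoeffElt hΩ hpos hF hG (EuclideanSpace.single j 1, 0, 0) i := by
  rw [StateRing.coeffU, StateRing.thermal]
  simp only [stateRing_D_restrictSmooth]
  ext q
  by_cases hij : i = j
  · subst hij
    simp [stateRing, gradCoeffElt, gradCoeff_apply, Direction.vec, thermoFun]
  · simp [stateRing, gradCoeffElt, gradCoeff_apply, Direction.vec, hij, thermoFun]

lemma coeffR_restrictSmooth (i : Fin n) :
    (stateRing n hΩ hpos F hF).coeffR (restrictSmooth G hG) i =
      gradCoeffElt hΩ hpos hF hG (0, 1, 0) i := by
  rw [StateRing.coeffR, stateRing_D_restrictSmooth]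
  ext q
  simp [stateRing, gradCoeffElt, gradCoeff_apply, Direction.vec]

lemma coeffP_restrictSmooth (i : Fin n) :
    (stateRing n hΩ hpos F hF).coeffP (restrictSmooth G hG) i =
      gradCoeffElt hΩ hpos hF hG (0, 0, 1) i := by
  rw [StateRing.coeffP, stateRing_D_restrictSmooth, stateRing_D_restrictSmooth]
  ext q
  simp [stateRing, gradCoeffElt, gradCoeff_apply, Direction.vec]

variable {T : KinematicFunction n} (hT : IsConservedDensity F Ω T)

lemma IsConservedDensity.smoothDeriv_gradCoeffElt_comm (v w : FluidState n) (i : Fin n) :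
    smoothDeriv (isOpen_stateDomain hΩ) (0, 0, v) (gradCoeffElt hΩ hpos hF hT.contDiffOn w i) =
      smoothDeriv (isOpen_stateDomain hΩ) (0, 0, w)
        (gradCoeffElt hΩ hpos hF hT.contDiffOn v i) := by
  simp only [gradCoeffElt, smoothDeriv_restrictSmooth]
  ext q
  exact hT.fderiv_gradCoeff_comm hΩ hpos hF q.2 v w i

lemma IsConservedDensity.smoothDeriv_smoothDeriv_t_eq_sum (v : FluidState n) :
    smoothDeriv (isOpen_stateDomain hΩ) (0, 0, v)
        ((stateRing n hΩ hpos F hF).D .t (restrictSmooth T.onState hT.contDiffOn)) =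
      ∑ i, (stateRing n hΩ hpos F hF).D (.x i) (gradCoeffElt hΩ hpos hF hT.contDiffOn v i) := by
  simp only [gradCoeffElt, stateRing_D_restrictSmooth, smoothDeriv_restrictSmooth]
  ext q
  simpa using hT.fderiv_fderiv_t_eq_sum hΩ hpos hF q.2 v

lemma IsConservedDensity.isNull :
    (stateRing n hΩ hpos F hF).IsNull (restrictSmooth T.onState hT.contDiffOn) where
  rp i := by
    simp only [coeffR_restrictSmooth, coeffP_restrictSmooth]
    exact hT.smoothDeriv_gradCoeffElt_comm hΩ hpos hF (0, 0, 1) (0, 1, 0) i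
  ur i j := by
    simp only [coeffR_restrictSmooth, coeffU_restrictSmooth]
    exact hT.smoothDeriv_gradCoeffElt_comm hΩ hpos hF (0, 1, 0) (EuclideanSpace.single j 1, 0, 0) i
  up i j := by
    simp only [coeffP_restrictSmooth, coeffU_restrictSmooth]
    exact hT.smoothDeriv_gradCoeffElt_comm hΩ hpos hF (0, 0, 1) (EuclideanSpace.single j 1, 0, 0) i
  uu i j k := by
    simp only [coeffU_restrictSmooth]
    exact hT.smoothDeriv_gradCoeffElt_comm hΩ hpos hF
      (EuclideanSpace.single k 1, 0, 0) (EuclideanSpace.single j 1, 0, 0) i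
  tr := by
    simp only [coeffR_restrictSmooth]
    exact hT.smoothDeriv_smoothDeriv_t_eq_sum hΩ hpos hF (0, 1, 0)
  tu j := by
    simp only [coeffU_restrictSmooth]
    exact hT.smoothDeriv_smoothDeriv_t_eq_sum hΩ hpos hF (EuclideanSpace.single j 1, 0, 0)
  tp := by
    simp only [coeffP_restrictSmooth]
    exact hT.smoothDeriv_smoothDeriv_t_eq_sum hΩ hpos hF (0, 0, 1)

end Ring

end Conserved

/-! ### Differential equations in the ring of smooth functions -/

section Slices

variable {Z W : Type*} [NormedAddCommGroup Z] [NormedSpace ℝ Z] [NormedAddCommGroup W]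
  [NormedSpace ℝ W] {D : Set Z} {U : Set W} {ι : W →L[ℝ] Z} {σ σ' : W → Z}

lemma sub_eq_sub_of_smoothDeriv_eq (hD : IsOpen D) (hU : IsOpen U) (hc : IsPreconnected U)
    (hσ : ∀ w, HasFDerivAt σ ι w) (hσ' : ∀ w, HasFDerivAt σ' ι w) (f g : smoothAlgebra D)
    (h : ∀ w ∈ U, σ w ∈ D) (h' : ∀ w ∈ U, σ' w ∈ D)
    (hd : ∀ w (hw : w ∈ U) v, (smoothDeriv hD (ι v) f).1 ⟨σ w, h w hw⟩ =
      (smoothDeriv hD (ι v) g).1 ⟨σ' w, h' w hw⟩) {w₁ w₂ : W} (h₁ : w₁ ∈ U) (h₂ : w₂ ∈ U) :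
    f.1 ⟨σ w₁, h w₁ h₁⟩ - g.1 ⟨σ' w₁, h' w₁ h₁⟩ =
      f.1 ⟨σ w₂, h w₂ h₂⟩ - g.1 ⟨σ' w₂, h' w₂ h₂⟩ := by
  have hf (w) (hw : w ∈ U) : HasFDerivAt (extendZero f.1 ∘ σ) _ w :=
    (differentiableAt_extendZero hD f ⟨σ w, h w hw⟩).hasFDerivAt.comp w (hσ w)
  have hg (w) (hw : w ∈ U) : HasFDerivAt (extendZero g.1 ∘ σ') _ w :=
    (differentiableAt_extendZero hD g ⟨σ' w, h' w hw⟩).hasFDerivAt.comp w (hσ' w)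
  obtain ⟨a, ha⟩ := hU.exists_is_const_of_fderiv_eq_zero hc
    (f := extendZero f.1 ∘ σ - extendZero g.1 ∘ σ')
    (fun w hw => ((hf w hw).sub (hg w hw)).differentiableAt.differentiableWithinAt)
    (fun w hw => by
      rw [((hf w hw).sub (hg w hw)).fderiv]
      ext v
      exact sub_eq_zero.2 (hd w hw v))
  have hval (w) (hw : w ∈ U) : f.1 ⟨σ w, h w hw⟩ - g.1 ⟨σ' w, h' w hw⟩ = a := by
    simpa [extendZero_of_mem _ (h w hw), extendZero_of_mem _ (h' w hw)] using ha w hw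
  rw [hval _ h₁, hval _ h₂]

lemma apply_eq_of_smoothDeriv_eq_zero (hD : IsOpen D) (hU : IsOpen U) (hc : IsPreconnected U)
    (hσ : ∀ w, HasFDerivAt σ ι w) (f : smoothAlgebra D) (h : ∀ w ∈ U, σ w ∈ D)
    (hd : ∀ w (hw : w ∈ U) v, (smoothDeriv hD (ι v) f).1 ⟨σ w, h w hw⟩ = 0)
    {w₁ w₂ : W} (h₁ : w₁ ∈ U) (h₂ : w₂ ∈ U) :
    f.1 ⟨σ w₁, h w₁ h₁⟩ = f.1 ⟨σ w₂, h w₂ h₂⟩ := by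
  simpa using sub_eq_sub_of_smoothDeriv_eq hD hU hc hσ hσ f 0 h h
    (fun w hw v => by simp [hd w hw v]) h₁ h₂

end Slices

section Coordinates

variable {n : ℕ} {Ω : Set (ℝ × ℝ)}

/-- The inclusion of space-time in the space of states. -/
def spacetimeIncl (n : ℕ) : ℝ × Space n →L[ℝ] State n :=
  (ContinuousLinearMap.fst ℝ ℝ (Space n)).prod
    (ContinuousLinearMap.inl ℝ (Space n) (FluidState n) ∘L ContinuousLinearMap.snd ℝ ℝ (Space n))

@[simp] lemma spacetimeIncl_apply (y : ℝ × Space n) : spacetimeIncl n y = (y.1, y.2, 0) := rfl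

lemma hasFDerivAt_fluid_slice (t : ℝ) (x : Space n) (w : FluidState n) :
    HasFDerivAt (fun w => ((t, x, w) : State n)) (fluidIncl n) w :=
  (hasFDerivAt_prodMk_right t (x, w)).comp w (hasFDerivAt_prodMk_right x w)

lemma hasFDerivAt_spacetime_slice (w : FluidState n) (y : ℝ × Space n) :
    HasFDerivAt (fun y => ((y.1, y.2, w) : State n)) (spacetimeIncl n) y :=
  hasFDerivAt_fst.prodMk (HasFDerivAt.comp (g := fun x => (x, w)) y
    (hasFDerivAt_prodMk_left y.2 w) hasFDerivAt_snd)

lemma clm_state_apply (L : State n →L[ℝ] ℝ) (t : ℝ) (x u : Space n) (ρ p : ℝ) :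
    L (t, x, u, ρ, p) = t * L Direction.t.vec + ∑ i, x i * L (Direction.x i).vec
      + ∑ i, u i * L (Direction.u i).vec + ρ * L Direction.r.vec + p * L Direction.p.vec := by
  have hx := clm_apply_eq_sum_single (L ∘L spacetimeIncl n ∘L ContinuousLinearMap.inr ℝ ℝ _) x
  have hu := clm_apply_eq_sum_single (L ∘L fluidIncl n ∘L ContinuousLinearMap.inl ℝ _ (ℝ × ℝ)) u
  have hsum : ((t, x, u, ρ, p) : State n) = t • (Direction.t.vec : State n)
      + spacetimeIncl n (0, x) + fluidIncl n (u, 0) + ρ • (Direction.r.vec : State n)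
      + p • (Direction.p.vec : State n) := by
    simp [Direction.vec, fluidIncl_apply]
  rw [hsum, map_add, map_add, map_add, map_add, map_smul, map_smul, map_smul]
  exact congrArg₂ _ (congrArg₂ _ (congrArg₂ _ (congrArg₂ _ rfl hx) hu) rfl) rfl

variable (hΩ : IsOpen Ω)

/-- The position component `xʲ` as a linear function on the space of states. -/
def positionProj (j : Fin n) : State n →L[ℝ] ℝ :=
  EuclideanSpace.proj j ∘L ContinuousLinearMap.fst ℝ (Space n) (FluidState n) ∘L
    ContinuousLinearMap.snd ℝ ℝ (Space n × FluidState n)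

@[simp] lemma positionProj_apply (j : Fin n) (q : State n) : positionProj j q = q.2.1 j := rfl

/-- A linear function of `(t, x, u, ρ, p)` as an element of the differential ring. -/
def linearElt (Ω : Set (ℝ × ℝ)) (l : State n →L[ℝ] ℝ) : smoothAlgebra (stateDomain n Ω) :=
  restrictSmooth l l.contDiff.contDiffOn

@[simp] lemma linearElt_apply (l : State n →L[ℝ] ℝ) (q : stateDomain n Ω) :
    (linearElt Ω l).1 q = l q := rfl

variable (hpos : ∀ p ρ : ℝ, (p, ρ) ∈ Ω → 0 < ρ) {F : ℝ × ℝ → ℝ} (hF : ContDiffOn ℝ ∞ F Ω)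

lemma D_linearElt (a : Direction n) (l : State n →L[ℝ] ℝ) :
    (stateRing n hΩ hpos F hF).D a (linearElt Ω l) = algebraMap ℝ _ (l a.vec) :=
  smoothDeriv_clm (isOpen_stateDomain hΩ) l _

lemma smoothDeriv_apply_eq_sum_D (f : smoothAlgebra (stateDomain n Ω)) (q : stateDomain n Ω)
    (t : ℝ) (x u : Space n) (ρ p : ℝ) :
    (smoothDeriv (isOpen_stateDomain hΩ) (t, x, u, ρ, p) f).1 q =
      t * ((stateRing n hΩ hpos F hF).D .t f).1 q
      + ∑ i, x i * ((stateRing n hΩ hpos F hF).D (.x i) f).1 q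
      + ∑ i, u i * ((stateRing n hΩ hpos F hF).D (.u i) f).1 q
      + ρ * ((stateRing n hΩ hpos F hF).D .r f).1 q
      + p * ((stateRing n hΩ hpos F hF).D .p f).1 q := by
  rw [smoothDeriv_apply, clm_state_apply]
  rfl

lemma isPreconnected_fluidDomain (hc : IsPreconnected Ω) : IsPreconnected (fluidDomain n Ω) := by
  have himage := (isPreconnected_univ.prod hc).image
    (fun q : Space n × ℝ × ℝ => ((q.1, q.2.2, q.2.1) : FluidState n)) (by fun_prop)
  convert himage
  ext ⟨u, ρ, p⟩
  simp [fluidDomain]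

end Coordinates

section Separation

variable {n : ℕ} {Ω : Set (ℝ × ℝ)} {hΩ : IsOpen Ω} {hpos : ∀ p ρ : ℝ, (p, ρ) ∈ Ω → 0 < ρ}
  {F : ℝ × ℝ → ℝ} {hF : ContDiffOn ℝ ∞ F Ω} {K : smoothAlgebra (stateDomain n Ω)}

local notation "𝒮" => stateRing n hΩ hpos F hF

lemma exists_eq_algebraMap_of_D_eq_zero (hc : IsConnected Ω) (hK : ∀ a, (𝒮).D a K = 0) :
    ∃ c : ℝ, K = algebraMap ℝ _ c := by
  obtain ⟨⟨p, ρ⟩, h⟩ := hc.nonempty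
  refine ⟨K.1 ⟨(0, 0, 0, ρ, p), h⟩, ?_⟩
  ext q
  refine smoothAlgebra_apply_eq_of_smoothDeriv_eq_zero (isOpen_stateDomain hΩ)
    (isPreconnected_stateDomain hc.isPreconnected) K (fun ⟨t, x, u, ρ, p⟩ => ?_) q _
  ext z
  rw [smoothDeriv_apply_eq_sum_D hΩ hpos hF]
  simp [hK]

lemma apply_fluid_eq_of_D_eq_zero (hc : IsPreconnected Ω) (hu : ∀ i, (𝒮).D (.u i) K = 0)
    (hr : (𝒮).D .r K = 0) (hp : (𝒮).D .p K = 0) (t : ℝ) (x : Space n) {w w' : FluidState n}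
    (hw : (w.2.2, w.2.1) ∈ Ω) (hw' : (w'.2.2, w'.2.1) ∈ Ω) :
    K.1 ⟨(t, x, w), hw⟩ = K.1 ⟨(t, x, w'), hw'⟩ :=
  apply_eq_of_smoothDeriv_eq_zero (isOpen_stateDomain hΩ) (isOpen_fluidDomain hΩ)
    (isPreconnected_fluidDomain hc) (hasFDerivAt_fluid_slice t x) K (fun _ hw => hw)
    (fun w hw ⟨u, ρ, p⟩ => (smoothDeriv_apply_eq_sum_D hΩ hpos hF K _ 0 0 u ρ p).trans
      (by simp [hu, hr, hp])) hw hw'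

lemma apply_spacetime_eq_of_D_eq_zero (ht : (𝒮).D .t K = 0) (hx : ∀ i, (𝒮).D (.x i) K = 0)
    (t t' : ℝ) (x x' : Space n) {w : FluidState n} (hw : (w.2.2, w.2.1) ∈ Ω) :
    K.1 ⟨(t, x, w), hw⟩ = K.1 ⟨(t', x', w), hw⟩ :=
  apply_eq_of_smoothDeriv_eq_zero (isOpen_stateDomain hΩ) isOpen_univ isPreconnected_univ
    (hasFDerivAt_spacetime_slice w) K (fun _ _ => hw)
    (fun y _ ⟨s, z⟩ => (smoothDeriv_apply_eq_sum_D hΩ hpos hF K _ s z 0 0 0).trans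
      (by simp [ht, hx])) (w₁ := (t, x)) (w₂ := (t', x')) trivial trivial

lemma apply_velocity_eq_of_D_eq_zero (hu : ∀ i, (𝒮).D (.u i) K = 0) (t : ℝ)
    (x u u' : Space n) {ρ p : ℝ} (h : (p, ρ) ∈ Ω) :
    K.1 ⟨(t, x, u, ρ, p), h⟩ = K.1 ⟨(t, x, u', ρ, p), h⟩ :=
  apply_eq_of_smoothDeriv_eq_zero (isOpen_stateDomain hΩ) isOpen_univ isPreconnected_univ
    (fun u => HasFDerivAt.comp (g := fun w => (t, x, w)) u
      (hasFDerivAt_fluid_slice t x (u, ρ, p)) (hasFDerivAt_prodMk_left u (ρ, p)))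
    K (fun _ _ => h)
    (fun _ _ v => (smoothDeriv_apply_eq_sum_D hΩ hpos hF K _ 0 0 v 0 0).trans (by simp [hu]))
    (Set.mem_univ u) (Set.mem_univ u')

lemma sub_eq_sub_of_mixed_D_eq_zero (hc : IsPreconnected Ω) (hu : ∀ i, (𝒮).D (.u i) K = 0)
    (hrt : (𝒮).D .r ((𝒮).D .t K) = 0) (hpt : (𝒮).D .p ((𝒮).D .t K) = 0)
    (hrx : ∀ i, (𝒮).D .r ((𝒮).D (.x i) K) = 0) (hpx : ∀ i, (𝒮).D .p ((𝒮).D (.x i) K) = 0)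
    (t t' : ℝ) (x x' : Space n) {w w' : FluidState n} (hw : (w.2.2, w.2.1) ∈ Ω)
    (hw' : (w'.2.2, w'.2.1) ∈ Ω) :
    K.1 ⟨(t, x, w), hw⟩ - K.1 ⟨(t', x', w), hw⟩ =
      K.1 ⟨(t, x, w'), hw'⟩ - K.1 ⟨(t', x', w'), hw'⟩ := by
  have hr {w : FluidState n} (hw : (w.2.2, w.2.1) ∈ Ω) :
      ((𝒮).D .r K).1 ⟨(t, x, w), hw⟩ = ((𝒮).D .r K).1 ⟨(t', x', w), hw⟩ :=
    apply_spacetime_eq_of_D_eq_zero (by rw [StateRing.comm, hrt])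
      (fun i => by rw [StateRing.comm, hrx]) _ _ _ _ hw
  have hp {w : FluidState n} (hw : (w.2.2, w.2.1) ∈ Ω) :
      ((𝒮).D .p K).1 ⟨(t, x, w), hw⟩ = ((𝒮).D .p K).1 ⟨(t', x', w), hw⟩ :=
    apply_spacetime_eq_of_D_eq_zero (by rw [StateRing.comm, hpt])
      (fun i => by rw [StateRing.comm, hpx]) _ _ _ _ hw
  refine sub_eq_sub_of_smoothDeriv_eq (isOpen_stateDomain hΩ) (isOpen_fluidDomain hΩ)
    (isPreconnected_fluidDomain hc) (hasFDerivAt_fluid_slice t x)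
    (hasFDerivAt_fluid_slice t' x') K K (fun _ hw => hw) (fun _ hw => hw)
    (fun w hw ⟨v, s, z⟩ => ?_) hw hw'
  refine (smoothDeriv_apply_eq_sum_D hΩ hpos hF K _ 0 0 v s z).trans
    (Eq.trans ?_ (smoothDeriv_apply_eq_sum_D hΩ hpos hF K _ 0 0 v s z).symm)
  simp [hu, hr hw, hp hw]

lemma apply_eq_add_sub_of_mixed_D_eq_zero (hc : IsPreconnected Ω)
    (hu : ∀ i, (𝒮).D (.u i) K = 0)
    (hrt : (𝒮).D .r ((𝒮).D .t K) = 0) (hpt : (𝒮).D .p ((𝒮).D .t K) = 0)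
    (hrx : ∀ i, (𝒮).D .r ((𝒮).D (.x i) K) = 0) (hpx : ∀ i, (𝒮).D .p ((𝒮).D (.x i) K) = 0)
    {ρ p ρ₀ p₀ : ℝ} (h : (p, ρ) ∈ Ω) (h₀ : (p₀, ρ₀) ∈ Ω) (t : ℝ) (x u : Space n) :
    K.1 ⟨(t, x, u, ρ, p), h⟩ = K.1 ⟨(0, 0, 0, ρ, p), h⟩ + K.1 ⟨(t, x, 0, ρ₀, p₀), h₀⟩
      - K.1 ⟨(0, 0, 0, ρ₀, p₀), h₀⟩ := by
  have hsep := sub_eq_sub_of_mixed_D_eq_zero hc hu hrt hpt hrx hpx t 0 x 0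
    (w := (u, ρ, p)) (w' := (0, ρ₀, p₀)) h h₀
  linear_combination hsep + apply_velocity_eq_of_D_eq_zero hu 0 0 u 0 h

end Separation

/-! ### Densities with stationary energy coefficient -/

section Elements

variable {n : ℕ} {Ω : Set (ℝ × ℝ)} {hΩ : IsOpen Ω} {hpos : ∀ p ρ : ℝ, (p, ρ) ∈ Ω → 0 < ρ}
  {F : ℝ × ℝ → ℝ} {hF : ContDiffOn ℝ ∞ F Ω}

local notation "𝒮" => stateRing n hΩ hpos F hF

local notation "C" => algebraMap ℝ (smoothAlgebra (stateDomain n Ω))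

/-- The position component `xʲ` in the differential ring. -/
abbrev posElt (Ω : Set (ℝ × ℝ)) (j : Fin n) := linearElt Ω (positionProj j)

/-- The time `t` in the differential ring. -/
abbrev timeElt (n : ℕ) (Ω : Set (ℝ × ℝ)) :=
  linearElt Ω (ContinuousLinearMap.fst ℝ ℝ (Space n × FluidState n))

/-- The pressure `p` in the differential ring. -/
abbrev pressureElt (n : ℕ) (Ω : Set (ℝ × ℝ)) :=
  linearElt Ω (ContinuousLinearMap.fst ℝ ℝ ℝ ∘L thermoProj n)

@[simp] lemma D_posElt (a : Direction n) (k : Fin n) : (𝒮).D a (posElt Ω k) =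
    match a with
    | .x i => if i = k then 1 else 0
    | _ => 0 := by
  rw [D_linearElt]
  cases a with
  | x i => by_cases h : i = k <;> simp [Direction.vec, h, Ne.symm]
  | _ => simp [Direction.vec]

@[simp] lemma D_timeElt (a : Direction n) : (𝒮).D a (timeElt n Ω) =
    match a with
    | .t => 1
    | _ => 0 := by
  rw [D_linearElt]
  cases a <;> simp [Direction.vec]

@[simp] lemma D_pressureElt (a : Direction n) : (𝒮).D a (pressureElt n Ω) =
    match a with
    | .p => 1
    | _ => 0 := by
  rw [D_linearElt]
  cases a <;> simp [Direction.vec]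

lemma two_mul_algebraMap_div_two {A : Type*} [CommRing A] [Algebra ℝ A] (c : ℝ) :
    2 * algebraMap ℝ A (c / 2) = algebraMap ℝ A c := by
  rw [← map_ofNat (algebraMap ℝ A) 2, ← map_mul, mul_div_cancel₀ _ two_ne_zero]

lemma coe_sum_apply {ι : Type*} (D : Set (State n)) (I : Finset ι) (f : ι → smoothAlgebra D)
    (q : D) : (∑ i ∈ I, f i).1 q = ∑ i ∈ I, (f i).1 q := by
  simp [AddSubmonoidClass.coe_finsetSum]

/-- The specific momentum `Gᵤ / ρ = b u + a + M x + t g` of a density `G`, integrated with respect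
to `u`; the summand `-g · x` makes the Galilean momenta appear. -/
def momentumPart (S : StateRing n (smoothAlgebra (stateDomain n Ω))) (b : ℝ) (a : Fin n → ℝ)
    (M : Fin n → Fin n → ℝ) (g : Fin n → ℝ) : smoothAlgebra (stateDomain n Ω) :=
  C (b / 2) * ∑ j, S.u j ^ 2 + ∑ j, C (a j) * S.u j
    + ∑ j, ∑ k, C (M j k) * (S.u j * posElt Ω k)
    + timeElt n Ω * ∑ j, C (g j) * S.u j - ∑ j, C (g j) * posElt Ω j

variable (b : ℝ) (a : Fin n → ℝ) (M : Fin n → Fin n → ℝ) (g : Fin n → ℝ)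

lemma D_r_momentumPart : (𝒮).D .r (momentumPart 𝒮 b a M g) = 0 := by
  simp [momentumPart, Derivation.leibniz_pow]

lemma D_p_momentumPart : (𝒮).D .p (momentumPart 𝒮 b a M g) = 0 := by
  simp [momentumPart, Derivation.leibniz_pow]

lemma D_t_momentumPart :
    (𝒮).D .t (momentumPart 𝒮 b a M g) = ∑ j, C (g j) * (𝒮).u j := by
  simp [momentumPart, Derivation.leibniz_pow]

lemma D_x_momentumPart (i : Fin n) :
    (𝒮).D (.x i) (momentumPart 𝒮 b a M g) = ∑ j, C (M j i) * (𝒮).u j - C (g i) := by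
  simp [momentumPart, Derivation.leibniz_pow]

lemma D_u_momentumPart (i : Fin n) : (𝒮).D (.u i) (momentumPart 𝒮 b a M g) =
    C b * (𝒮).u i + C (a i) + ∑ k, C (M i k) * posElt Ω k + C (g i) * timeElt n Ω := by
  have hhalf : 2 * C (b / 2) = C b := two_mul_algebraMap_div_two b
  simp [momentumPart, Derivation.leibniz_pow, ← hhalf]
  ring

lemma momentumPart_apply (t : ℝ) (x u : Space n) {ρ p : ℝ} (h : (p, ρ) ∈ Ω) :
    (momentumPart 𝒮 b a M g).1 ⟨(t, x, u, ρ, p), h⟩ =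
      b * (1 / 2 * ‖u‖ ^ 2) + ∑ j, a j * u j + ∑ j, ∑ k, M j k * (u j * x k)
        + t * ∑ j, g j * u j - ∑ j, g j * x j := by
  have hC (c : ℝ) (q) : (C c).1 q = c := rfl
  have hu (j q) : ((𝒮).u j).1 q = q.1.2.2.1 j := rfl
  simp only [momentumPart, Subalgebra.coe_add, Pi.add_apply, coe_sum_apply, Subalgebra.coe_mul,
    Pi.mul_apply, hC, hu, Subalgebra.coe_sub, Pi.sub_apply, linearElt_apply, positionProj_apply,
    EuclideanSpace.norm_sq_eq, Real.norm_eq_abs, sq_abs, Subalgebra.coe_pow, Pi.pow_apply,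
    ContinuousLinearMap.coe_fst']
  ring

lemma mul_momentumPart_apply (A : Fin n → Fin n → ℝ) (t : ℝ) (x u : Space n) {ρ p : ℝ}
    (h : (p, ρ) ∈ Ω) :
    ρ * (momentumPart 𝒮 b a (fun i j => A i j - A j i) g).1 ⟨(t, x, u, ρ, p), h⟩ =
      ∑ i, a i * momentum i t x u ρ p + ∑ i, ∑ j, A i j * angularMomentum i j t x u ρ p
        + ∑ i, g i * galileanMomentum i t x u ρ p + ρ * (b * (1 / 2 * ‖u‖ ^ 2)) := by
  have ha : ∑ i, a i * momentum i t x u ρ p = ρ * ∑ j, a j * u j := by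
    simp only [momentum, Finset.mul_sum, mul_left_comm]
  have hA : ∑ i, ∑ j, A i j * angularMomentum i j t x u ρ p =
      ρ * ∑ j, ∑ k, (A j k - A k j) * (u j * x k) := by
    simp only [sub_mul, Finset.sum_sub_distrib]
    rw [Finset.sum_comm (f := fun j k => A k j * (u j * x k))]
    simp only [mul_sub, Finset.mul_sum, ← Finset.sum_sub_distrib, angularMomentum]
    exact Finset.sum_congr rfl fun i _ => Finset.sum_congr rfl fun j _ => by ring
  have hg : ∑ i, g i * galileanMomentum i t x u ρ p =
      ρ * (t * ∑ j, g j * u j - ∑ j, g j * x j) := by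
    simp only [galileanMomentum, Finset.mul_sum, ← Finset.sum_sub_distrib]
    exact Finset.sum_congr rfl fun i _ => by ring
  rw [momentumPart_apply, ha, hA, hg]
  ring

end Elements

section Stationary

variable {n : ℕ} {Ω : Set (ℝ × ℝ)} {hΩ : IsOpen Ω} {hpos : ∀ p ρ : ℝ, (p, ρ) ∈ Ω → 0 < ρ}
  {F : ℝ × ℝ → ℝ} {hF : ContDiffOn ℝ ∞ F Ω}

local notation "𝒮" => stateRing n hΩ hpos F hF

local notation "C" => algebraMap ℝ (smoothAlgebra (stateDomain n Ω))

variable {G : smoothAlgebra (stateDomain n Ω)} (h : (stateRing n hΩ hpos F hF).IsNull G)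
  (hn : 1 < n) (hF' : thermoFun F hF ∈ nonZeroDivisors (smoothAlgebra (stateDomain n Ω)))
  (hβ : (stateRing n hΩ hpos F hF).D .t ((stateRing n hΩ hpos F hF).energyCoeff G) = 0)
include h hn hF' hβ

lemma exists_specificMomentum_eq_D_u_momentumPart (hc : IsConnected Ω) :
    ∃ (b : ℝ) (a : Fin n → ℝ) (M : Fin n → Fin n → ℝ) (g : Fin n → ℝ),
      (𝒮).energyCoeff G = C b ∧ (∀ j k, M j k = -M k j) ∧
      ∀ j, (𝒮).specificMomentum G j = (𝒮).D (.u j) (momentumPart 𝒮 b a M g) := by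
  have hconst {f} (hf : ∀ a, (𝒮).D a f = 0) : ∃ c : ℝ, f = C c :=
    exists_eq_algebraMap_of_D_eq_zero hc hf
  have hDD := h.D_D_specificMomentum_eq_zero hβ hn hF'
  obtain ⟨b, hb⟩ := hconst (h.D_energyCoeff_eq_zero hβ hn hF')
  have hM (j k) : ∃ c : ℝ, (𝒮).D (.x k) ((𝒮).specificMomentum G j) = C c :=
    hconst fun a => hDD a (.x k) j
  have hg (j) : ∃ c : ℝ, (𝒮).D .t ((𝒮).specificMomentum G j) = C c :=
    hconst fun a => hDD a .t j
  choose M hM using hM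
  choose g hg using hg
  have ha (j) : ∃ c : ℝ, (𝒮).specificMomentum G j
      - (𝒮).D (.u j) (momentumPart 𝒮 b 0 M g) = C c := by
    refine hconst fun a => ?_
    rw [D_u_momentumPart]
    cases a with
    | t => simp [hg]
    | x i => simp [hM]
    | u i => simp [h.D_u_specificMomentum, hb, eq_comm]
    | r => simp [h.D_r_specificMomentum]
    | p => simp [h.D_p_specificMomentum hn hF']
  choose a ha using ha
  refine ⟨b, a, M, g, hb, fun j k => ?_, fun j => ?_⟩
  · obtain ⟨⟨p, ρ⟩, hq⟩ := hc.nonempty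
    have hanti : C (M j k) = -C (M k j) := by
      rw [← hM, ← hM, h.D_x_specificMomentum_antisymm hβ hn]
    exact congrArg (fun f => f.1 ⟨(0, 0, 0, ρ, p), hq⟩) hanti
  · have := ha j
    rw [D_u_momentumPart, Pi.zero_apply, map_zero] at this
    rw [D_u_momentumPart]
    linear_combination this

variable {b : ℝ} {a : Fin n → ℝ} {M : Fin n → Fin n → ℝ} {g : Fin n → ℝ}
  (hM : ∀ j k, M j k = -M k j)
  (hν : ∀ j, (stateRing n hΩ hpos F hF).specificMomentum G j =
    (stateRing n hΩ hpos F hF).D (.u j) (momentumPart (stateRing n hΩ hpos F hF) b a M g))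
include hM hν

lemma apply_sub_momentumPart_eq (hc : IsPreconnected Ω) {K : smoothAlgebra (stateDomain n Ω)}
    (hK : K = G - (𝒮).r * momentumPart 𝒮 b a M g) {ρ p ρ₀ p₀ : ℝ} (hq : (p, ρ) ∈ Ω)
    (h₀ : (p₀, ρ₀) ∈ Ω) (t : ℝ) (x u : Space n) :
    K.1 ⟨(t, x, u, ρ, p), hq⟩ = K.1 ⟨(0, 0, 0, ρ, p), hq⟩ + K.1 ⟨(t, x, 0, ρ₀, p₀), h₀⟩
      - K.1 ⟨(0, 0, 0, ρ₀, p₀), h₀⟩ := by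
  have hr := D_r_momentumPart (hΩ := hΩ) (hpos := hpos) (hF := hF) b a M g
  have hp := D_p_momentumPart (hΩ := hΩ) (hpos := hpos) (hF := hF) b a M g
  have hνt (j) : (𝒮).D .t ((𝒮).specificMomentum G j) = C (g j) := by
    simp [hν, D_u_momentumPart]
  have hνx (i j) : (𝒮).D (.x i) ((𝒮).specificMomentum G j) = C (M j i) := by
    simp [hν, D_u_momentumPart]
  subst hK
  refine apply_eq_add_sub_of_mixed_D_eq_zero (hΩ := hΩ) (hpos := hpos) (hF := hF) hc
    (fun i => (𝒮).D_u_sub_r_mul G (hν i).symm) ?_ ?_ (fun i => ?_) (fun i => ?_) hq h₀ t x u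
  · rw [(𝒮).D_r_D_sub_r_mul G (𝒮).D_t_r hr, h.D_r_D_t_of_stationary hβ hn,
      D_t_momentumPart]
    simp [hνt, mul_comm]
  · rw [(𝒮).D_p_D_sub_r_mul G (𝒮).D_t_r hp, h.D_p_D_t_of_stationary hβ hn hF']
  · rw [(𝒮).D_r_D_sub_r_mul G ((𝒮).D_x_r i) hr, h.D_r_D_x, D_x_momentumPart]
    have hsum : ∑ j, (𝒮).u j * C (M i j) + ∑ j, C (M j i) * (𝒮).u j = 0 := by
      rw [← Finset.sum_add_distrib]
      refine Finset.sum_eq_zero fun j _ => ?_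
      rw [hM j i, map_neg]
      ring
    simp only [hνt, hνx]
    linear_combination -hsum
  · rw [(𝒮).D_p_D_sub_r_mul G ((𝒮).D_x_r i) hp, h.D_p_D_x hn hF']

end Stationary

section NormalForm

variable {n : ℕ} {Ω : Set (ℝ × ℝ)} {hΩ : IsOpen Ω} {hpos : ∀ p ρ : ℝ, (p, ρ) ∈ Ω → 0 < ρ}
  {F : ℝ × ℝ → ℝ} {hF : ContDiffOn ℝ ∞ F Ω}

local notation "𝒮" => stateRing n hΩ hpos F hF

local notation "C" => algebraMap ℝ (smoothAlgebra (stateDomain n Ω))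

lemma StateRing.IsNull.exists_legendre_apply_eq {G : smoothAlgebra (stateDomain n Ω)}
    (h : (𝒮).IsNull G) (hn : 1 < n) (hc : IsConnected Ω) {b : ℝ} (hb : (𝒮).energyCoeff G = C b) :
    ∃ k, ∀ (ρ p : ℝ) (hq : (p, ρ) ∈ Ω),
      ((𝒮).legendre G).1 ⟨(0, 0, 0, ρ, p), hq⟩ = b * p + k := by
  obtain ⟨⟨p₀, ρ₀⟩, h₀⟩ := hc.nonempty
  refine ⟨((𝒮).legendre G).1 ⟨(0, 0, 0, ρ₀, p₀), h₀⟩ - b * p₀, fun ρ p hq => ?_⟩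
  have hconst : ((𝒮).legendre G - C b * pressureElt n Ω).1 ⟨(0, 0, 0, ρ, p), hq⟩ =
      ((𝒮).legendre G - C b * pressureElt n Ω).1 ⟨(0, 0, 0, ρ₀, p₀), h₀⟩ :=
    apply_fluid_eq_of_D_eq_zero (hΩ := hΩ) (hpos := hpos) (hF := hF) hc.isPreconnected
      (fun i => by simp [h.D_u_legendre hn]) (by simp [h.D_r_legendre hn])
      (by rw [map_sub, ← StateRing.energyCoeff, hb]; simp) 0 0
      (w := (0, ρ, p)) (w' := (0, ρ₀, p₀)) hq h₀
  change _ - b * p = _ - b * p₀ at hconst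
  linarith

/-- `s` solves `ρ s_ρ + F s_p = b p / ρ` on `Ω`: the solutions are the entropies for `b = 0` and
the internal energies for `b = 1`. -/
def IsThermalSolution (F : ℝ × ℝ → ℝ) (Ω : Set (ℝ × ℝ)) (b : ℝ) (s : ℝ × ℝ → ℝ) : Prop :=
  ContDiffOn ℝ ∞ s Ω ∧ ∀ p ρ : ℝ, (p, ρ) ∈ Ω →
    ρ * deriv (fun r => s (p, r)) ρ + F (p, ρ) * deriv (fun q => s (q, ρ)) p = b * (p / ρ)

/-- The function `(K + k) / ρ` of the thermodynamic state at `t = 0`, `x = u = 0`. -/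
def thermoQuotient (K : smoothAlgebra (stateDomain n Ω)) (k : ℝ) (s : ℝ × ℝ) : ℝ :=
  (extendZero K.1 (0, 0, 0, s.2, s.1) + k) / s.2

variable (K : smoothAlgebra (stateDomain n Ω)) (k : ℝ)

lemma isThermalSolution_thermoQuotient {b : ℝ}
    (hleg : ∀ (ρ p : ℝ) (hq : (p, ρ) ∈ Ω),
      ((𝒮).legendre K).1 ⟨(0, 0, 0, ρ, p), hq⟩ = b * p + k) :
    IsThermalSolution F Ω b (thermoQuotient K k) := by
  refine ⟨((contDiffOn_extendZero K).comp (f := fun s : ℝ × ℝ => ((0, 0, 0, s.2, s.1) : State n))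
    (by fun_prop) fun s hs => hs).add contDiffOn_const |>.div contDiffOn_snd
      fun s hs => (hpos _ _ hs).ne', fun p ρ hq => ?_⟩
  have hρ := (hpos p ρ hq).ne'
  have hdiff := differentiableAt_extendZero (isOpen_stateDomain hΩ) K ⟨(0, 0, 0, ρ, p), hq⟩
  have hderiv_r : deriv (fun r => thermoQuotient K k (p, r)) ρ = _ :=
    (((hasDerivAt_state_r hdiff).add_const k).div (hasDerivAt_id ρ) hρ).deriv
  have hderiv_p : deriv (fun q => thermoQuotient K k (q, ρ)) p = _ :=
    (((hasDerivAt_state_p hdiff).add_const k).div_const ρ).deriv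
  have hlegq : ρ * fderiv ℝ (extendZero K.1) (0, 0, 0, ρ, p) Direction.r.vec
    + F (p, ρ) * fderiv ℝ (extendZero K.1) (0, 0, 0, ρ, p) Direction.p.vec
    - K.1 ⟨(0, 0, 0, ρ, p), hq⟩ = b * p + k := hleg ρ p hq
  rw [hderiv_r, hderiv_p, extendZero_of_mem K.1 (q := (0, 0, 0, ρ, p)) hq]
  simp only [id]
  field_simp
  linear_combination hlegq

/-- The normal form of a density whose energy coefficient is constant; `s` combines mass, entropy
and internal energy. -/
def HasNormalForm (F : ℝ × ℝ → ℝ) (Ω : Set (ℝ × ℝ)) (T : KinematicFunction n) (b : ℝ) : Prop :=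
  ∃ (a : Fin n → ℝ) (A : Fin n → Fin n → ℝ) (g : Fin n → ℝ) (s : ℝ × ℝ → ℝ) (c : ℝ × Space n → ℝ),
    IsThermalSolution F Ω b s ∧ ContDiff ℝ ∞ c ∧
    ∀ (t : ℝ) (x u : Space n) (ρ p : ℝ), (p, ρ) ∈ Ω →
      T t x u ρ p = ∑ i, a i * momentum i t x u ρ p
        + ∑ i, ∑ j, A i j * angularMomentum i j t x u ρ p
        + ∑ i, g i * galileanMomentum i t x u ρ p
        + ρ * (b * (1 / 2 * ‖u‖ ^ 2) + s (p, ρ)) + c (t, x)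

lemma IsConservedDensity.hasNormalForm
    (hF_ne : ∀ W : Set (ℝ × ℝ), W ⊆ Ω → IsOpen W → W.Nonempty → ∃ q ∈ W, F q ≠ 0)
    (hn : 1 < n) (hc : IsConnected Ω) {T : KinematicFunction n} (hT : IsConservedDensity F Ω T)
    (hβ : (𝒮).D .t ((𝒮).energyCoeff (restrictSmooth T.onState hT.contDiffOn)) = 0) :
    ∃ b, HasNormalForm F Ω T b := by
  have h := hT.isNull hΩ hpos hF
  have hF' := thermoFun_mem_nonZeroDivisors (n := n) hΩ hF hF_ne
  obtain ⟨⟨p₀, ρ₀⟩, h₀⟩ := hc.nonempty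
  obtain ⟨b, a, M, g, hb, hM, hν⟩ :=
    exists_specificMomentum_eq_D_u_momentumPart h hn hF' hβ hc
  obtain ⟨k, hk⟩ := h.exists_legendre_apply_eq hn hc hb
  set P := momentumPart 𝒮 b a M g with hP
  set K := restrictSmooth T.onState hT.contDiffOn - (𝒮).r * P with hK
  have hKs := contDiffOn_extendZero K
  have hleg : (𝒮).legendre K = (𝒮).legendre (restrictSmooth T.onState hT.contDiffOn) :=
    (𝒮).legendre_sub_r_mul _ (D_r_momentumPart b a M g) (D_p_momentumPart b a M g)
  refine ⟨b, a, fun i j => M i j / 2, g, thermoQuotient K k,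
    fun y => extendZero K.1 (y.1, y.2, 0, ρ₀, p₀) - extendZero K.1 (0, 0, 0, ρ₀, p₀) - k,
    isThermalSolution_thermoQuotient (hΩ := hΩ) (hpos := hpos) (hF := hF) K k (by rwa [hleg]),
    ?_, fun t x u ρ p hq => ?_⟩
  · exact ((hKs.comp_contDiff (f := fun y : ℝ × Space n => ((y.1, y.2, 0, ρ₀, p₀) : State n))
      (by fun_prop) fun _ => h₀).sub contDiff_const).sub contDiff_const
  · have hsep := apply_sub_momentumPart_eq h hn hF' hβ hM hν hc.isPreconnected hK hq h₀ t x u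
    have hKT : K.1 ⟨(t, x, u, ρ, p), hq⟩ = T t x u ρ p - ρ * P.1 ⟨(t, x, u, ρ, p), hq⟩ := rfl
    have hM' : M = fun i j => M i j / 2 - M j i / 2 := by
      ext i j
      rw [hM j i]
      ring
    have hmom := mul_momentumPart_apply (hΩ := hΩ) (hpos := hpos) (hF := hF) b a g
      (fun i j => M i j / 2) t x u hq
    rw [← hM', ← hP] at hmom
    rw [hKT] at hsep
    simp only [thermoQuotient]
    rw [extendZero_of_mem K.1 (q := (0, 0, 0, ρ, p)) hq,
      extendZero_of_mem K.1 (q := (0, 0, 0, ρ₀, p₀)) h₀,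
      extendZero_of_mem K.1 (q := (t, x, 0, ρ₀, p₀)) h₀, mul_add ρ,
      mul_div_cancel₀ _ (hpos p ρ hq).ne']
    linear_combination hsep + hmom

end NormalForm

/-! ### Fluxes -/

namespace StateRing

variable {n : ℕ} {A : Type*} [CommRing A] [Algebra ℝ A] (S : StateRing n A)

/-- `Y` is a flux of the density `G` which, like `G`, does not involve derivatives of the fluid
variables. -/
structure IsFlux (G : A) (Y : Fin n → A) : Prop where
  u : ∀ i j, S.D (.u j) (Y i) = -S.coeffU G i j
  r : ∀ i, S.D .r (Y i) = -S.coeffR G i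
  p : ∀ i, S.D .p (Y i) = -S.coeffP G i
  t : S.D .t G = -∑ i, S.D (.x i) (Y i)

/-- The quantity `π` is the pressure up to a constant. -/
lemma isFlux_of_momentum {G β π : A} {μ : Fin n → A}
    (hβu : ∀ i, S.D (.u i) β = 0) (hβr : S.D .r β = 0) (hβp : S.D .p β = 0)
    (hβx : ∀ i, S.D (.x i) β = 0)
    (hμu : ∀ i j, S.D (.u i) (μ j) = 0) (hμr : ∀ j, S.D .r (μ j) = 0)
    (hμp : ∀ j, S.D .p (μ j) = 0)
    (hπu : ∀ i, S.D (.u i) π = 0) (hπr : S.D .r π = 0) (hπp : S.D .p π = 1)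
    (hπx : ∀ i, S.D (.x i) π = 0)
    (hu : ∀ i, S.D (.u i) G = S.r * (β * S.u i + μ i))
    (hth : S.thermal G = G + β * π)
    (ht : S.D .t G + ∑ i, S.u i * S.D (.x i) G + π * ∑ i, S.D (.x i) (μ i) = 0) :
    S.IsFlux G fun i => (G + β * π) * S.u i + π * μ i where
  u i j := by
    simp only [map_add, Derivation.leibniz, smul_eq_mul, hβu, hμu, hπu, hu, D_u_u, coeffU, hth,
      eq_comm (a := i)]
    split_ifs <;> ring
  r i := by
    simp only [map_add, Derivation.leibniz, smul_eq_mul, hβr, hμr, hπr, D_r_u, coeffR]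
    ring
  p i := by
    simp only [map_add, Derivation.leibniz, smul_eq_mul, hβp, hμp, hπp, D_p_u, coeffP, hu]
    linear_combination -(β * S.u i + μ i) * S.r_mul_rinv
  t := by
    simp only [map_add, Derivation.leibniz, smul_eq_mul, hβx, hπx, D_x_u, Finset.sum_add_distrib,
      mul_zero, add_zero, zero_add, ← Finset.mul_sum]
    linear_combination ht

end StateRing

section Flux

variable {n : ℕ} {Ω : Set (ℝ × ℝ)} {F : ℝ × ℝ → ℝ}

/-- The restriction of a jet to lower order. -/
def jetTruncation (n : ℕ) {k l : ℕ} (h : k ≤ l) : Jet n l →L[ℝ] Jet n k :=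
  ContinuousLinearMap.pi fun j : Fin (k + 1) => ContinuousLinearMap.proj (R := ℝ)
    (φ := fun j : Fin (l + 1) => (Space n) [×(j : ℕ)]→L[ℝ] FluidState n)
    (Fin.castLE (Nat.succ_le_succ h) j)

lemma contDiffOn_comp_jetTruncation {k l : ℕ} (h : k ≤ l) {X : ℝ × Space n × Jet n k → Space n}
    (hX : ContDiffOn ℝ ∞ X (jetDomain n k Ω)) :
    ContDiffOn ℝ ∞ (fun z => X (z.1, z.2.1, jetTruncation n h z.2.2)) (jetDomain n l Ω) :=
  hX.comp (by fun_prop) fun _ hz => hz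

lemma IsConservedDensity.add (hΩ : IsOpen Ω) {T T' : KinematicFunction n}
    (hT : IsConservedDensity F Ω T) (hT' : IsConservedDensity F Ω T') :
    IsConservedDensity F Ω (T + T') := by
  have hs : (T + T').IsSmooth Ω := hT.1.add hT'.1
  have hd {T : KinematicFunction n} (hT : T.IsSmooth Ω) (φ : FluidField n Ω) (t : ℝ) (x : Space n) :
      DifferentiableAt ℝ T.onState (t, x, φ.toMap x) :=
    (ContDiffOn.contDiffAt hT ((isOpen_stateDomain hΩ).mem_nhds (φ.mem x))).differentiableAt
      (by simp)
  have hadd : (T + T').onState = T.onState + T'.onState := rfl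
  obtain ⟨hTs, k, X, hX, hdiv⟩ := hT
  obtain ⟨hTs', k', X', hX', hdiv'⟩ := hT'
  have hY := contDiffOn_comp_jetTruncation (le_max_left k k') hX
  have hY' := contDiffOn_comp_jetTruncation (le_max_right k k') hX'
  refine ⟨hs, max k k', _, hY.add hY', fun φ t x => ?_⟩
  have hsum := divergence_add ((contDiff_flux_jet hX φ t).differentiable (by simp) x)
    ((contDiff_flux_jet hX' φ t).differentiable (by simp) x)
  refine (congrArg _ hsum).trans ?_
  rw [totalTimeDeriv_eq_fderiv (hd hs φ t x), hadd, fderiv_add (hd hTs φ t x) (hd hTs' φ t x)]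
  have h := hdiv φ t x
  have h' := hdiv' φ t x
  rw [totalTimeDeriv_eq_fderiv (hd hTs φ t x)] at h
  rw [totalTimeDeriv_eq_fderiv (hd hTs' φ t x)] at h'
  simp only [add_apply]
  linear_combination h + h'

lemma fderiv_comp_fluid_apply {φ : FluidField n Ω} {t : ℝ} {x : Space n} {Y : State n → Space n}
    (hY : DifferentiableAt ℝ Y (t, x, φ.toMap x)) (v : Space n) :
    fderiv ℝ (fun y => Y (t, y, φ.toMap y)) x v =
      fderiv ℝ Y (t, x, φ.toMap x) (0, v, 0)
        + fderiv ℝ Y (t, x, φ.toMap x) (0, 0, fderiv ℝ φ.toMap x v) := by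
  have hφ := (φ.contDiff_toMap.differentiable (by simp) x).hasFDerivAt
  have h : HasFDerivAt (fun y => Y (t, y, φ.toMap y)) _ x :=
    hY.hasFDerivAt.comp x ((hasFDerivAt_const t x).prodMk ((hasFDerivAt_id x).prodMk hφ))
  rw [h.fderiv, ← map_add]
  simp

/-- With a flux that does not involve derivatives of the fluid variables, `D_t T + D_x · Y` is
affine in their first derivatives, so it vanishes as soon as all of its coefficients do. -/
lemma isConservedDensity_of_forall_fderiv (hΩ : IsOpen Ω) {T : KinematicFunction n}
    (hT : T.IsSmooth Ω) {Y : State n → Space n} (hY : ContDiffOn ℝ ∞ Y (stateDomain n Ω))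
    (ht : ∀ q ∈ stateDomain n Ω, fderiv ℝ T.onState q Direction.t.vec =
      -∑ i, fderiv ℝ Y q (Direction.x i).vec i)
    (hw : ∀ q ∈ stateDomain n Ω, ∀ i w,
      fderiv ℝ Y q (0, 0, w) i = -gradCoeff F T.onState i q w) :
    IsConservedDensity F Ω T := by
  refine ⟨hT, 0, fun z => Y (z.1, z.2.1, z.2.2.base), ?_, fun φ t x => ?_⟩
  · refine hY.comp ?_ fun _ hz => hz
    have hbase : ContDiff ℝ ∞ (Jet.base : Jet n 0 → FluidState n) :=
      (ContinuousMultilinearMap.apply ℝ (fun _ : Fin ((0 : Fin 1) : ℕ) => Space n)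
        (FluidState n) (fun _ => 0) ∘L ContinuousLinearMap.proj (R := ℝ)
          (φ := fun j : Fin 1 => (Space n) [×(j : ℕ)]→L[ℝ] FluidState n) 0).contDiff
    exact (contDiff_fst.prodMk (contDiff_snd.fst.prodMk (hbase.comp contDiff_snd.snd))).contDiffOn
  · have hd : DifferentiableAt ℝ Y (t, x, φ.toMap x) :=
      (hY.contDiffAt ((isOpen_stateDomain hΩ).mem_nhds (φ.mem x))).differentiableAt (by simp)
    rw [totalTimeDeriv_eq_affineLagrangian hΩ hT, affineLagrangian, ht _ (φ.mem x)]
    simp only [FluidField.jet_base, divergence, fderiv_comp_fluid_apply hd, PiLp.add_apply,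
      hw (t, x, φ.toMap x) (φ.mem x), Direction.vec, Finset.sum_add_distrib,
      Finset.sum_neg_distrib, Prod.mk_zero_zero]
    abel

lemma clm_fluid_apply (L : FluidState n →L[ℝ] ℝ) (w : FluidState n) :
    L w = ∑ i, w.1 i * L (EuclideanSpace.single i 1, 0, 0) + w.2.1 * L (0, 1, 0)
      + w.2.2 * L (0, 0, 1) := by
  obtain ⟨u, ρ, p⟩ := w
  have h := clm_state_apply (L ∘L ContinuousLinearMap.snd ℝ (Space n) (FluidState n) ∘L
    ContinuousLinearMap.snd ℝ ℝ (Space n × FluidState n)) 0 0 u ρ p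
  simpa [Direction.vec] using h

variable {hΩ : IsOpen Ω} {hpos : ∀ p ρ : ℝ, (p, ρ) ∈ Ω → 0 < ρ} {hF : ContDiffOn ℝ ∞ F Ω}

lemma isConservedDensity_of_isFlux {G : smoothAlgebra (stateDomain n Ω)}
    {Y : Fin n → smoothAlgebra (stateDomain n Ω)} (h : (stateRing n hΩ hpos F hF).IsFlux G Y)
    {T : KinematicFunction n} (hTG : ∀ q : stateDomain n Ω, T.onState q = G.1 q) :
    IsConservedDensity F Ω T := by
  have hD := isOpen_stateDomain (n := n) hΩ
  have hT : ContDiffOn ℝ ∞ T.onState (stateDomain n Ω) :=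
    (contDiffOn_extendZero G).congr fun q hq =>
      (hTG ⟨q, hq⟩).trans (extendZero_of_mem G.1 hq).symm
  obtain rfl : G = restrictSmooth T.onState hT := Subtype.ext (funext fun q => (hTG q).symm)
  let Z : State n → Space n := fun q => WithLp.toLp 2 fun i => extendZero (Y i).1 q
  have hZ : ContDiffOn ℝ ∞ Z (stateDomain n Ω) :=
    contDiffOn_euclidean.2 fun i => contDiffOn_extendZero (Y i)
  have hZd {q : State n} (hq : q ∈ stateDomain n Ω) (v : State n) (i : Fin n) :
      fderiv ℝ Z q v i = (smoothDeriv hD v (Y i)).1 ⟨q, hq⟩ :=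
    fderiv_coord ((hZ.contDiffAt (hD.mem_nhds hq)).differentiableAt (by simp)) v i
  refine isConservedDensity_of_forall_fderiv hΩ hT hZ (fun q hq => ?_) fun q hq i w => ?_
  · have ht := congrArg (fun f => f.1 ⟨q, hq⟩) h.t
    rw [stateRing_D_restrictSmooth] at ht
    simp only [hZd hq]
    exact ht.trans (congrArg Neg.neg (coe_sum_apply _ _ _ _))
  · let L : FluidState n →L[ℝ] ℝ :=
      (EuclideanSpace.proj i : Space n →L[ℝ] ℝ) ∘L fderiv ℝ Z q ∘L fluidIncl n
    have hu (j : Fin n) := congrArg (fun f => f.1 ⟨q, hq⟩) (h.u i j)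
    have hr := congrArg (fun f => f.1 ⟨q, hq⟩) (h.r i)
    have hp := congrArg (fun f => f.1 ⟨q, hq⟩) (h.p i)
    simp only [coeffU_restrictSmooth, coeffR_restrictSmooth, coeffP_restrictSmooth] at hu hr hp
    have hL : fderiv ℝ Z q (0, 0, w) i = L w := rfl
    rw [hL, clm_fluid_apply L, clm_fluid_apply (gradCoeff F T.onState i q)]
    have hu' (j : Fin n) : L (EuclideanSpace.single j 1, 0, 0) =
      -gradCoeff F T.onState i q (EuclideanSpace.single j 1, 0, 0) := (hZd hq _ i).trans (hu j)
    have hr' : L (0, 1, 0) = -gradCoeff F T.onState i q (0, 1, 0) := (hZd hq _ i).trans hr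
    have hp' : L (0, 0, 1) = -gradCoeff F T.onState i q (0, 0, 1) := (hZd hq _ i).trans hp
    simp only [hu', hr', hp', mul_neg, Finset.sum_neg_distrib]
    abel

end Flux

section Trivial

open MeasureTheory

lemma contDiff_intervalIntegral_param {P : Type*} [NormedAddCommGroup P] [NormedSpace ℝ P]
    {k : P × ℝ → ℝ} (hk : ContDiff ℝ ∞ k) : ContDiff ℝ ∞ fun y => ∫ s in (0 : ℝ)..1, k (y, s) := by
  -- Cut off in `s`, the integral is the convolution at `0` of the indicator function of `(0, 1]`.
  let χ : ContDiffBump (0 : ℝ) := ⟨1, 2, one_pos, one_lt_two⟩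
  have hloc : LocallyIntegrable (Set.indicator (Set.Ioc (0 : ℝ) 1) fun _ => (1 : ℝ)) volume :=
    (locallyIntegrable_const 1).indicator measurableSet_Ioc
  have hcut : ContDiff ℝ ∞ fun q : P × ℝ => χ q.2 * k (q.1, -q.2) :=
    (χ.contDiff.comp contDiff_snd).mul (hk.comp (by fun_prop))
  have hconv := contDiffOn_convolution_right_with_param (μ := (volume : Measure ℝ)) (n := ⊤)
    (ContinuousLinearMap.mul ℝ ℝ) (g := fun (y : P) (s : ℝ) => χ s * k (y, -s)) (s := Set.univ)
    isOpen_univ χ.hasCompactSupport.isCompact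
    (fun y s _ hs => by rw [image_eq_zero_of_notMem_tsupport hs, zero_mul]) hloc hcut.contDiffOn
  rw [Set.univ_prod_univ, contDiffOn_univ] at hconv
  convert hconv.comp (contDiff_id.prodMk (contDiff_const (c := (0 : ℝ)))) using 1
  ext y
  simp only [Function.comp_apply, convolution, ContinuousLinearMap.mul_apply', id]
  rw [intervalIntegral.integral_of_le zero_le_one, ← integral_indicator measurableSet_Ioc]
  congr 1
  ext s
  by_cases hs : s ∈ Set.Ioc (0 : ℝ) 1
  · have hχ : χ (-s) = 1 := χ.one_of_mem_closedBall <| by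
      simpa [abs_of_pos hs.1] using hs.2
    simp [hs, hχ]
  · simp [hs]

variable {n : ℕ} {h : ℝ × Space n → ℝ}

/-- The primitive of `h` in the `i`-th spatial coordinate that vanishes for `xᵢ = 0`; the
integration is rescaled to the fixed interval `[0, 1]`. -/
def coordPrimitive (i : Fin n) (h : ℝ × Space n → ℝ) (y : ℝ × Space n) : ℝ :=
  y.2 i * ∫ s in (0 : ℝ)..1, h (y.1, y.2 + ((s - 1) * y.2 i) • EuclideanSpace.single i 1)

lemma contDiff_coordPrimitive (i : Fin n) (hh : ContDiff ℝ ∞ h) :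
    ContDiff ℝ ∞ (coordPrimitive i h) :=
  ContDiff.mul (by fun_prop) <| contDiff_intervalIntegral_param (P := ℝ × Space n)
    (k := fun z => h (z.1.1, z.1.2 + ((z.2 - 1) * z.1.2 i) • EuclideanSpace.single i 1))
    (by fun_prop)

lemma differentiable_coordPrimitive (i : Fin n) (hh : ContDiff ℝ ∞ h) (t : ℝ) :
    Differentiable ℝ fun y => coordPrimitive i h (t, y) :=
  ((contDiff_coordPrimitive i hh).comp (contDiff_const.prodMk contDiff_id)).differentiable (by simp)

lemma coordPrimitive_add_smul_single (i : Fin n) (h : ℝ × Space n → ℝ) (t : ℝ) (x : Space n)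
    (δ : ℝ) : coordPrimitive i h (t, x + δ • EuclideanSpace.single i 1) =
      ∫ σ in (0 : ℝ)..(x i + δ), h (t, x + (σ - x i) • EuclideanSpace.single i 1) := by
  have hs := intervalIntegral.smul_integral_comp_mul_right (a := 0) (b := 1)
    (fun σ => h (t, x + (σ - x i) • EuclideanSpace.single i 1)) (x i + δ)
  rw [zero_mul, one_mul] at hs
  have hcoord : (x + δ • EuclideanSpace.single i (1 : ℝ)) i = x i + δ := by simp
  rw [← hs]
  simp only [coordPrimitive, hcoord, smul_eq_mul, add_assoc, ← add_smul]
  congr! 7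
  ring

lemma fderiv_coordPrimitive (i : Fin n) (hh : ContDiff ℝ ∞ h) (t : ℝ) (x : Space n) :
    fderiv ℝ (fun y => coordPrimitive i h (t, y)) x (EuclideanSpace.single i 1) = h (t, x) := by
  set e : Space n := EuclideanSpace.single i 1
  have hline : HasDerivAt (fun δ : ℝ => x + δ • e) e 0 := by
    simpa using ((hasDerivAt_id (0 : ℝ)).smul_const e).const_add x
  have hchain : HasDerivAt (fun δ : ℝ => coordPrimitive i h (t, x + δ • e))
      (fderiv ℝ (fun y => coordPrimitive i h (t, y)) x e) 0 := by
    refine HasFDerivAt.comp_hasDerivAt (l := fun y => coordPrimitive i h (t, y)) (0 : ℝ) ?_ hline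
    simpa using (differentiable_coordPrimitive i hh t x).hasFDerivAt
  have hc : Continuous fun σ : ℝ => h (t, x + (σ - x i) • e) := hh.continuous.comp (by fun_prop)
  have hftc : HasDerivAt (fun b : ℝ => ∫ σ in (0 : ℝ)..b, h (t, x + (σ - x i) • e))
      (h (t, x)) (x i + 0) := by
    simpa using intervalIntegral.integral_hasDerivAt_right (hc.intervalIntegrable 0 (x i + 0))
      (hc.stronglyMeasurableAtFilter _ _) hc.continuousAt
  refine hchain.unique ?_
  simp only [e, coordPrimitive_add_smul_single]
  exact (mul_one (h (t, x))) ▸ hftc.comp (0 : ℝ) ((hasDerivAt_id (0 : ℝ)).const_add (x i))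

lemma isConservedDensity_of_spacetime (hn : 0 < n) {Ω : Set (ℝ × ℝ)} (F : ℝ × ℝ → ℝ)
    {c : ℝ × Space n → ℝ} (hc : ContDiff ℝ ∞ c) :
    IsConservedDensity F Ω (fun t x _ _ _ => c (t, x)) := by
  let i : Fin n := ⟨0, hn⟩
  let k : ℝ × Space n → ℝ := fun y => fderiv ℝ c y (1, 0)
  have hk : ContDiff ℝ ∞ k := (hc.fderiv_right (by simp)).clm_apply contDiff_const
  have hH := contDiff_coordPrimitive i hk
  refine ⟨(hc.comp (by fun_prop : ContDiff ℝ ∞ fun q : State n => (q.1, q.2.1))).contDiffOn, 0,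
    fun z => -coordPrimitive i k (z.1, z.2.1) • EuclideanSpace.single i (1 : ℝ),
    ((hH.comp (by fun_prop)).neg.smul contDiff_const).contDiffOn, fun φ t x => ?_⟩
  have hct : deriv (fun s => c (s, x)) t = k (t, x) :=
    HasDerivAt.deriv (HasFDerivAt.comp_hasDerivAt (f := fun s => (s, x)) t
      (hc.differentiable (by simp) (t, x)).hasFDerivAt
      ((hasDerivAt_id t).prodMk (hasDerivAt_const t x)))
  have hd : DifferentiableAt ℝ (fun y => -coordPrimitive i k (t, y)) x :=
    (differentiable_coordPrimitive i hk t).neg x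
  simp only [totalTimeDeriv, divergence, fderiv_smul_const hd, hct, fderiv_fun_neg]
  simp [fderiv_coordPrimitive i hk]

end Trivial

section Sufficiency

variable {n : ℕ} {Ω : Set (ℝ × ℝ)}

section ThermoPartial

variable {s : ℝ × ℝ → ℝ} {p ρ : ℝ} (hs : DifferentiableAt ℝ s (p, ρ))
include hs

lemma hasDerivAt_thermo_r : HasDerivAt (fun r => s (p, r)) (fderiv ℝ s (p, ρ) (0, 1)) ρ :=
  HasFDerivAt.comp_hasDerivAt (f := fun r => (p, r)) ρ hs.hasFDerivAt
    ((hasDerivAt_const ρ p).prodMk (hasDerivAt_id ρ))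

lemma hasDerivAt_thermo_p : HasDerivAt (fun q => s (q, ρ)) (fderiv ℝ s (p, ρ) (1, 0)) p :=
  HasFDerivAt.comp_hasDerivAt (f := fun q => (q, ρ)) p hs.hasFDerivAt
    ((hasDerivAt_id p).prodMk (hasDerivAt_const p ρ))

end ThermoPartial

variable {hΩ : IsOpen Ω} {hpos : ∀ p ρ : ℝ, (p, ρ) ∈ Ω → 0 < ρ} {F : ℝ × ℝ → ℝ}
  {hF : ContDiffOn ℝ ∞ F Ω}

local notation "𝒮" => stateRing n hΩ hpos F hF

local notation "C" => algebraMap ℝ (smoothAlgebra (stateDomain n Ω))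

lemma IsThermalSolution.r_mul_D_thermoFun {b : ℝ} {s : ℝ × ℝ → ℝ}
    (hs : IsThermalSolution F Ω b s) :
    (𝒮).r * ((𝒮).r * (𝒮).D .r (thermoFun s hs.1) + (𝒮).F * (𝒮).D .p (thermoFun s hs.1)) =
      C b * pressureElt n Ω := by
  ext ⟨⟨t, x, u, ρ, p⟩, hq⟩
  have hd := (hs.1.contDiffAt (hΩ.mem_nhds hq)).differentiableAt (by simp)
  have hsol := hs.2 p ρ hq
  rw [(hasDerivAt_thermo_r hd).deriv, (hasDerivAt_thermo_p hd).deriv] at hsol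
  have hD (a : Direction n) : ((𝒮).D a (thermoFun s hs.1)).1 ⟨(t, x, u, ρ, p), hq⟩ =
      fderiv ℝ s (p, ρ) (thermoProj n a.vec) :=
    smoothDeriv_thermoFun_apply hΩ s hs.1 _ _
  change ρ * (ρ * _ + F (p, ρ) * _) = b * p
  rw [hD, hD]
  refine (congrArg (ρ * ·) hsol).trans ?_
  have := (hpos p ρ hq).ne'
  field_simp

lemma sum_mul_sum_skew_eq_zero {M : Fin n → Fin n → ℝ} (hM : ∀ i j, M i j = -M j i)
    (v : Fin n → smoothAlgebra (stateDomain n Ω)) :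
    ∑ i, v i * ∑ j, C (M j i) * v j = 0 := by
  refine eq_zero_of_natCast_mul_eq_zero two_ne_zero ?_
  have hneg : ∑ i, v i * ∑ j, C (M j i) * v j = -∑ i, v i * ∑ j, C (M j i) * v j := by
    simp only [Finset.mul_sum]
    conv_lhs => rw [Finset.sum_comm]
    rw [← Finset.sum_neg_distrib]
    simp only [← Finset.sum_neg_distrib]
    refine Finset.sum_congr rfl fun i _ => Finset.sum_congr rfl fun j _ => ?_
    rw [hM i j, map_neg]
    ring
  push_cast
  linear_combination hneg

lemma IsThermalSolution.exists_isFlux {b : ℝ} {s : ℝ × ℝ → ℝ} (hs : IsThermalSolution F Ω b s)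
    (a : Fin n → ℝ) {M : Fin n → Fin n → ℝ} (hM : ∀ i j, M i j = -M j i) (g : Fin n → ℝ) :
    ∃ Y, (𝒮).IsFlux ((𝒮).r * (momentumPart 𝒮 b a M g + thermoFun s hs.1)) Y := by
  have hDs {d : Direction n} (hd : thermoProj n d.vec = 0) : (𝒮).D d (thermoFun s hs.1) = 0 :=
    smoothDeriv_thermoFun_eq_zero hΩ s hs.1 hd
  have hM₀ (i) : M i i = 0 := self_eq_neg.1 (hM i i)
  refine ⟨_, (𝒮).isFlux_of_momentum (β := C b) (π := pressureElt n Ω)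
    (μ := fun i => C (a i) + ∑ k, C (M i k) * posElt Ω k + C (g i) * timeElt n Ω)
    (fun i => by simp) (by simp) (by simp) (fun i => by simp)
    (fun i j => by simp) (fun j => by simp) (fun j => by simp)
    (fun i => by simp) (by simp) (by simp) (fun i => by simp) (fun i => ?_) ?_ ?_⟩
  · simp only [Derivation.leibniz, smul_eq_mul, map_add, StateRing.D_u_r, D_u_momentumPart,
      hDs (d := .u i) rfl]
    ring
  · simp only [StateRing.thermal, Derivation.leibniz, smul_eq_mul, map_add, StateRing.D_r_r,
      StateRing.D_p_r, D_r_momentumPart, D_p_momentumPart]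
    linear_combination hs.r_mul_D_thermoFun (hΩ := hΩ) (hpos := hpos) (hF := hF)
  · have hdiv (i) : (𝒮).D (.x i) (C (a i) + ∑ k, C (M i k) * posElt Ω k + C (g i) * timeElt n Ω)
        = 0 := by
      simp [hM₀]
    simp only [hdiv, Finset.sum_const_zero, mul_zero, add_zero, Derivation.leibniz, smul_eq_mul,
      map_add, StateRing.D_t_r, StateRing.D_x_r, D_t_momentumPart, D_x_momentumPart,
      hDs (d := .t) rfl, hDs (d := .x _) rfl, mul_left_comm _ (𝒮).r, ← Finset.mul_sum, mul_sub,
      Finset.sum_sub_distrib, sum_mul_sum_skew_eq_zero hM]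
    simp only [mul_comm]
    ring

include hΩ hpos hF in
lemma HasNormalForm.isConservedDensity (hn : 0 < n) {T : KinematicFunction n} {b : ℝ}
    (h : HasNormalForm F Ω T b) : IsConservedDensity F Ω T := by
  obtain ⟨a, A, g, s, c, hs, hc, hT⟩ := h
  obtain ⟨Y, hY⟩ := hs.exists_isFlux (hΩ := hΩ) (hpos := hpos) (hF := hF) a
    (M := fun i j => A i j - A j i) (fun i j => by ring) g
  let T₀ : KinematicFunction n := fun t x _ _ _ => c (t, x)
  have hflux : IsConservedDensity F Ω (T - T₀) := isConservedDensity_of_isFlux hY <| by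
    rintro ⟨⟨t, x, u, ρ, p⟩, hq⟩
    have hmom := mul_momentumPart_apply (hΩ := hΩ) (hpos := hpos) (hF := hF) b a g A t x u hq
    change T t x u ρ p - c (t, x) = ρ * (_ + s (p, ρ))
    rw [mul_add, hmom, hT t x u ρ p hq]
    ring
  exact sub_add_cancel T T₀ ▸ hflux.add hΩ (isConservedDensity_of_spacetime hn F hc)

end Sufficiency

section Combinations

variable {n : ℕ} {Ω : Set (ℝ × ℝ)} {F : ℝ × ℝ → ℝ} {s s' e : ℝ × ℝ → ℝ} {b b' : ℝ}

lemma IsThermalSolution.add (hΩ : IsOpen Ω) (hs : IsThermalSolution F Ω b s)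
    (hs' : IsThermalSolution F Ω b' s') : IsThermalSolution F Ω (b + b') (fun q => s q + s' q) := by
  refine ⟨hs.1.add hs'.1, fun p ρ hp => ?_⟩
  have hd := (hs.1.contDiffAt (hΩ.mem_nhds hp)).differentiableAt (by simp)
  have hd' := (hs'.1.contDiffAt (hΩ.mem_nhds hp)).differentiableAt (by simp)
  rw [deriv_fun_add (hasDerivAt_thermo_r hd).differentiableAt
      (hasDerivAt_thermo_r hd').differentiableAt,
    deriv_fun_add (hasDerivAt_thermo_p hd).differentiableAt
      (hasDerivAt_thermo_p hd').differentiableAt]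
  linear_combination hs.2 p ρ hp + hs'.2 p ρ hp

lemma IsThermalSolution.const_mul (c : ℝ) (hs : IsThermalSolution F Ω b s) :
    IsThermalSolution F Ω (c * b) (fun q => c * s q) := by
  refine ⟨contDiffOn_const.mul hs.1, fun p ρ hp => ?_⟩
  simp only [deriv_const_mul_field']
  linear_combination c * hs.2 p ρ hp

lemma isThermalSolution_const (c : ℝ) : IsThermalSolution F Ω 0 (fun _ => c) :=
  ⟨contDiffOn_const, fun p ρ _ => by simp⟩

lemma isThermalSolution_zero_iff : IsThermalSolution F Ω 0 s ↔ IsEntropy F Ω s := by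
  simp only [IsThermalSolution, IsEntropy, zero_mul]

lemma isThermalSolution_one_iff : IsThermalSolution F Ω 1 e ↔ IsInternalEnergy F Ω e := by
  simp only [IsThermalSolution, IsInternalEnergy, one_mul]

lemma isThermalSolution_const_mul_of_imp (he : b ≠ 0 → IsInternalEnergy F Ω e) :
    IsThermalSolution F Ω b (fun q => b * e q) := by
  rcases eq_or_ne b 0 with rfl | hb
  · simpa using isThermalSolution_const (F := F) (Ω := Ω) 0
  · simpa using (isThermalSolution_one_iff.2 (he hb)).const_mul b

variable {T : KinematicFunction n}

lemma IsBasicCombination.hasNormalForm (hΩ : IsOpen Ω) (h : IsBasicCombination F Ω e T) :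
    ∃ b, HasNormalForm F Ω T b := by
  obtain ⟨m, a, A, g, b, S, c, he, hS, hc, hT⟩ := h
  have hs := ((isThermalSolution_const m).add hΩ (isThermalSolution_zero_iff.2 hS)).add hΩ
    (isThermalSolution_const_mul_of_imp he)
  rw [zero_add, zero_add] at hs
  refine ⟨b, a, A, g, _, c, hs, hc, fun t x u ρ p hp => ?_⟩
  rw [hT t x u ρ p hp]
  simp only [mass, volumetricEntropy, energy]
  ring

lemma HasNormalForm.isBasicCombination (hΩ : IsOpen Ω) (h : HasNormalForm F Ω T b)
    (he : b ≠ 0 → IsInternalEnergy F Ω e) : IsBasicCombination F Ω e T := by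
  obtain ⟨a, A, g, s, c, hs, hc, hT⟩ := h
  have hS := hs.add hΩ ((isThermalSolution_const_mul_of_imp he).const_mul (-1))
  rw [neg_one_mul, add_neg_cancel] at hS
  refine ⟨0, a, A, g, b, _, c, he, isThermalSolution_zero_iff.1 hS, hc, fun t x u ρ p hp => ?_⟩
  rw [hT t x u ρ p hp]
  simp only [energy, volumetricEntropy]
  ring

lemma HasNormalForm.exists_isBasicCombination (hΩ : IsOpen Ω) (h : HasNormalForm F Ω T b) :
    ∃ e, IsBasicCombination F Ω e T := by
  have ⟨_, _, _, s, _, hs, _, _⟩ := h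
  refine ⟨fun q => b⁻¹ * s q, h.isBasicCombination hΩ fun hb => ?_⟩
  simpa [hb, isThermalSolution_one_iff] using hs.const_mul b⁻¹

end Combinations

section Polytropic

variable {n : ℕ} {Ω : Set (ℝ × ℝ)}

section Elements

variable (n Ω)

local notation "C" => algebraMap ℝ (smoothAlgebra (stateDomain n Ω))

/-- The energy coefficient `b₁ t + b₂ t²`. -/
def polytropicCoeff (b₁ b₂ : ℝ) : smoothAlgebra (stateDomain n Ω) :=
  C b₁ * timeElt n Ω + C b₂ * timeElt n Ω ^ 2

/-- Half of the time derivative of `polytropicCoeff`; the specific momentum at zero velocity is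
`-dilationRate * x`. -/
def dilationRate (b₁ b₂ : ℝ) : smoothAlgebra (stateDomain n Ω) :=
  C (b₁ / 2) + C b₂ * timeElt n Ω

/-- The pressure counted from `p₀`. -/
def shiftedPressure (p₀ : ℝ) : smoothAlgebra (stateDomain n Ω) :=
  pressureElt n Ω - C p₀

variable {n Ω}

/-- The combination `b₁` similarity energy `+ b₂` dilational energy. -/
def polytropicElt (S : StateRing n (smoothAlgebra (stateDomain n Ω))) (p₀ b₁ b₂ : ℝ) :
    smoothAlgebra (stateDomain n Ω) :=
  polytropicCoeff n Ω b₁ b₂ *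
      (C (1 / 2) * (S.r * ∑ i, S.u i ^ 2) + C (n / 2) * shiftedPressure n Ω p₀)
    - S.r * (dilationRate n Ω b₁ b₂ * ∑ i, S.u i * posElt Ω i)
    + C (b₂ / 2) * (S.r * ∑ i, posElt Ω i ^ 2)

variable {hΩ : IsOpen Ω} {hpos : ∀ p ρ : ℝ, (p, ρ) ∈ Ω → 0 < ρ} {F : ℝ × ℝ → ℝ}
  {hF : ContDiffOn ℝ ∞ F Ω}

local notation "𝒮" => stateRing n hΩ hpos F hF

variable (p₀ b₁ b₂ : ℝ)

@[simp] lemma D_polytropicCoeff (a : Direction n) : (𝒮).D a (polytropicCoeff n Ω b₁ b₂) =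
    match a with
    | .t => 2 * dilationRate n Ω b₁ b₂
    | _ => 0 := by
  cases a with
  | t => simp [polytropicCoeff, dilationRate, mul_add, two_mul_algebraMap_div_two, mul_left_comm]
  | _ => simp [polytropicCoeff, Derivation.leibniz_pow]

@[simp] lemma D_dilationRate (a : Direction n) : (𝒮).D a (dilationRate n Ω b₁ b₂) =
    match a with
    | .t => C b₂
    | _ => 0 := by
  cases a <;> simp [dilationRate]

@[simp] lemma D_shiftedPressure (a : Direction n) : (𝒮).D a (shiftedPressure n Ω p₀) =
    match a with
    | .p => 1
    | _ => 0 := by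
  cases a <;> simp [shiftedPressure]

lemma D_t_polytropicElt : (𝒮).D .t (polytropicElt 𝒮 p₀ b₁ b₂) =
    dilationRate n Ω b₁ b₂ * ((𝒮).r * ∑ i, (𝒮).u i ^ 2 + n * shiftedPressure n Ω p₀)
      - C b₂ * ((𝒮).r * ∑ i, (𝒮).u i * posElt Ω i) := by
  have hhalf : 2 * C (1 / 2) = 1 := by rw [two_mul_algebraMap_div_two, map_one]
  have hn : 2 * C (n / 2) = n := by rw [two_mul_algebraMap_div_two, map_natCast]
  simp only [polytropicElt, map_add, map_sub, Derivation.leibniz, map_sum, Derivation.leibniz_pow,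
    StateRing.D_t_u, smul_eq_mul, mul_zero, nsmul_zero, Finset.sum_const_zero,
    StateRing.D_t_r, add_zero, Derivation.map_algebraMap, D_shiftedPressure, D_polytropicCoeff,
    zero_add, D_posElt, D_dilationRate]
  linear_combination dilationRate n Ω b₁ b₂ * ((𝒮).r * ∑ i, (𝒮).u i ^ 2) * hhalf
    + dilationRate n Ω b₁ b₂ * shiftedPressure n Ω p₀ * hn

lemma D_x_polytropicElt (i : Fin n) : (𝒮).D (.x i) (polytropicElt 𝒮 p₀ b₁ b₂) =
    (𝒮).r * (C b₂ * posElt Ω i - dilationRate n Ω b₁ b₂ * (𝒮).u i) := by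
  have hb₂ : 2 * C (b₂ / 2) = C b₂ := two_mul_algebraMap_div_two b₂
  simp only [polytropicElt, map_add, map_sub, Derivation.leibniz, map_sum, Derivation.leibniz_pow,
    Nat.add_one_sub_one, pow_one, StateRing.D_x_u, smul_eq_mul, mul_zero,
    Finset.sum_const_zero, StateRing.D_x_r, add_zero, Derivation.map_algebraMap, D_shiftedPressure,
    D_polytropicCoeff, D_posElt, mul_ite, mul_one, Finset.sum_ite_eq, Finset.mem_univ, if_true,
    D_dilationRate, zero_sub, smul_ite, nsmul_eq_mul, Nat.cast_ofNat]
  linear_combination (𝒮).r * posElt Ω i * hb₂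

lemma D_u_polytropicElt (i : Fin n) : (𝒮).D (.u i) (polytropicElt 𝒮 p₀ b₁ b₂) =
    (𝒮).r * (polytropicCoeff n Ω b₁ b₂ * (𝒮).u i - dilationRate n Ω b₁ b₂ * posElt Ω i) := by
  have hhalf : 2 * C (1 / 2) = 1 := by rw [two_mul_algebraMap_div_two, map_one]
  simp only [polytropicElt, map_add, map_sub, Derivation.leibniz, map_sum, Derivation.leibniz_pow,
    Nat.add_one_sub_one, pow_one, StateRing.D_u_u, smul_eq_mul, mul_ite, mul_one, mul_zero,
    smul_ite, nsmul_eq_mul, Nat.cast_ofNat, Finset.sum_ite_eq, Finset.mem_univ, if_true,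
    StateRing.D_u_r, add_zero, Derivation.map_algebraMap, D_shiftedPressure, D_polytropicCoeff,
    D_posElt, zero_add, D_dilationRate, Finset.sum_const_zero]
  linear_combination (𝒮).r * polytropicCoeff n Ω b₁ b₂ * (𝒮).u i * hhalf

lemma r_mul_D_r_polytropicElt : (𝒮).r * (𝒮).D .r (polytropicElt 𝒮 p₀ b₁ b₂) =
    polytropicElt 𝒮 p₀ b₁ b₂
      - polytropicCoeff n Ω b₁ b₂ * (C (n / 2) * shiftedPressure n Ω p₀) := by
  simp only [polytropicElt, map_add, map_sub, Derivation.leibniz, map_sum, Derivation.leibniz_pow,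
    StateRing.D_r_u, smul_eq_mul, mul_zero, nsmul_zero, Finset.sum_const_zero,
    StateRing.D_r_r, mul_one, zero_add, Derivation.map_algebraMap, add_zero, D_shiftedPressure,
    D_polytropicCoeff, D_posElt, D_dilationRate]
  ring

lemma D_p_polytropicElt : (𝒮).D .p (polytropicElt 𝒮 p₀ b₁ b₂) =
    polytropicCoeff n Ω b₁ b₂ * C (n / 2) := by
  simp [polytropicElt, Derivation.leibniz_pow]

lemma polytropicElt_apply (t : ℝ) (x u : Space n) {p ρ : ℝ} (h : (p, ρ) ∈ Ω) :
    (polytropicElt 𝒮 p₀ b₁ b₂).1 ⟨(t, x, u, ρ, p), h⟩ =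
      b₁ * similarityEnergy p₀ t x u ρ p + b₂ * dilationalEnergy p₀ t x u ρ p := by
  have hr : (𝒮).r.1 ⟨(t, x, u, ρ, p), h⟩ = ρ := rfl
  have hu (j : Fin n) : ((𝒮).u j).1 ⟨(t, x, u, ρ, p), h⟩ = u j := rfl
  have hinner : ∑ i, u i * x i = inner ℝ u x := by simp [PiLp.inner_apply, mul_comm]
  simp only [polytropicElt, polytropicCoeff, shiftedPressure, dilationRate, Subalgebra.coe_add,
    Subalgebra.coe_sub, Subalgebra.coe_mul, Subalgebra.coe_pow, SubalgebraClass.coe_algebraMap,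
    coe_sum_apply, Pi.add_apply, Pi.sub_apply, Pi.mul_apply, Pi.pow_apply, Pi.algebraMap_apply,
    Algebra.algebraMap_self, RingHom.id_apply, linearElt_apply, ContinuousLinearMap.coe_fst',
    ContinuousLinearMap.comp_apply, thermoProj_apply, positionProj_apply, hr, hu, hinner,
    ← EuclideanSpace.real_norm_sq_eq, similarityEnergy, polytropicEnergy, dilationalEnergy]
  ring

lemma D_t_polytropicElt_add : (𝒮).D .t (polytropicElt 𝒮 p₀ b₁ b₂)
      + ∑ i, (𝒮).u i * (𝒮).D (.x i) (polytropicElt 𝒮 p₀ b₁ b₂)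
      + shiftedPressure n Ω p₀ *
        ∑ i, (𝒮).D (.x i) (-(dilationRate n Ω b₁ b₂ * posElt Ω i)) = 0 := by
  have hdiv : ∑ i, (𝒮).D (.x i) (-(dilationRate n Ω b₁ b₂ * posElt Ω i)) =
      -(n * dilationRate n Ω b₁ b₂) := by simp
  have htransport : ∑ i, (𝒮).u i * (𝒮).D (.x i) (polytropicElt 𝒮 p₀ b₁ b₂) =
      C b₂ * ((𝒮).r * ∑ i, (𝒮).u i * posElt Ω i)
        - dilationRate n Ω b₁ b₂ * ((𝒮).r * ∑ i, (𝒮).u i ^ 2) := by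
    simp only [D_x_polytropicElt, Finset.mul_sum, ← Finset.sum_sub_distrib]
    exact Finset.sum_congr rfl fun i _ => by ring
  rw [D_t_polytropicElt, hdiv, htransport]
  ring

variable {p₀}

lemma IsSpecialPolytropic.stateRing_F (h : IsSpecialPolytropic n F Ω p₀) :
    (𝒮).F = C (1 + 2 / n) * shiftedPressure n Ω p₀ :=
  Subtype.ext <| funext fun q => h _ _ q.2

lemma thermal_polytropicElt (h : IsSpecialPolytropic n F Ω p₀) (hn : 0 < n) :
    (𝒮).thermal (polytropicElt 𝒮 p₀ b₁ b₂) =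
      polytropicElt 𝒮 p₀ b₁ b₂ + polytropicCoeff n Ω b₁ b₂ * shiftedPressure n Ω p₀ := by
  have hcoeff : C (1 + 2 / n) * C (n / 2) = C (n / 2) + 1 := by
    have : (n : ℝ) ≠ 0 := by exact_mod_cast hn.ne'
    rw [← map_mul, ← map_one C, ← map_add]
    congr 1
    field_simp
  rw [StateRing.thermal, r_mul_D_r_polytropicElt, D_p_polytropicElt, h.stateRing_F]
  linear_combination polytropicCoeff n Ω b₁ b₂ * shiftedPressure n Ω p₀ * hcoeff

lemma exists_isFlux_polytropicElt (h : IsSpecialPolytropic n F Ω p₀) (hn : 0 < n) :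
    ∃ Y, (𝒮).IsFlux (polytropicElt 𝒮 p₀ b₁ b₂) Y :=
  ⟨_, (𝒮).isFlux_of_momentum (β := polytropicCoeff n Ω b₁ b₂) (π := shiftedPressure n Ω p₀)
    (μ := fun i => -(dilationRate n Ω b₁ b₂ * posElt Ω i)) (by simp) (by simp) (by simp) (by simp)
    (by simp) (by simp) (by simp) (by simp) (by simp) (by simp) (by simp)
    (fun i => by rw [D_u_polytropicElt, sub_eq_add_neg])
    (thermal_polytropicElt b₁ b₂ h hn) (D_t_polytropicElt_add p₀ b₁ b₂)⟩

lemma energyCoeff_polytropicElt (h : IsSpecialPolytropic n F Ω p₀) (hn : 0 < n) :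
    (𝒮).energyCoeff (polytropicElt 𝒮 p₀ b₁ b₂) = polytropicCoeff n Ω b₁ b₂ := by
  rw [StateRing.energyCoeff, StateRing.legendre, thermal_polytropicElt b₁ b₂ h hn,
    add_sub_cancel_left]
  simp

variable (hΩ hpos hF)
include hΩ hpos hF

lemma IsSpecialPolytropic.isConservedDensity_similarityEnergy_add_dilationalEnergy
    (h : IsSpecialPolytropic n F Ω p₀) (hn : 0 < n) : IsConservedDensity F Ω fun t x u ρ p =>
      b₁ * similarityEnergy (n := n) p₀ t x u ρ p + b₂ * dilationalEnergy p₀ t x u ρ p :=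
  have ⟨_, hY⟩ := exists_isFlux_polytropicElt (hΩ := hΩ) (hpos := hpos) (hF := hF) b₁ b₂ h hn
  isConservedDensity_of_isFlux hY fun q => (polytropicElt_apply p₀ b₁ b₂ _ _ _ q.2).symm

end Elements

end Polytropic

section Classification

variable {n : ℕ} {Ω : Set (ℝ × ℝ)} {hΩ : IsOpen Ω} {hpos : ∀ p ρ : ℝ, (p, ρ) ∈ Ω → 0 < ρ}
  {F : ℝ × ℝ → ℝ} {hF : ContDiffOn ℝ ∞ F Ω}

local notation "𝒮" => stateRing n hΩ hpos F hF

local notation "C" => algebraMap ℝ (smoothAlgebra (stateDomain n Ω))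

section EnergyCoeff

variable {G : smoothAlgebra (stateDomain n Ω)} (h : (stateRing n hΩ hpos F hF).IsNull G)
  (hn : 1 < n) (hF' : thermoFun F hF ∈ nonZeroDivisors (smoothAlgebra (stateDomain n Ω)))
include h hn hF'

lemma D_D_t_energyCoeff_eq_zero {a : Direction n} (ha : a ≠ .t) :
    (𝒮).D a ((𝒮).D .t ((𝒮).energyCoeff G)) = 0 := by
  rw [(𝒮).comm]
  cases a with
  | t => exact absurd rfl ha
  | x i => rw [h.D_x_energyCoeff hn, map_zero]
  | u i => rw [h.D_u_energyCoeff hn, map_zero]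
  | r => rw [h.D_r_energyCoeff hn, map_zero]
  | p => rw [h.D_p_energyCoeff hn hF', map_zero]

lemma exists_D_t_energyCoeff_eq (hc : IsConnected Ω) :
    ∃ b₁ b₂, (𝒮).D .t ((𝒮).energyCoeff G) = (𝒮).D .t (polytropicCoeff n Ω b₁ b₂) := by
  have hconst {f} (hf : ∀ a, (𝒮).D a f = 0) : ∃ c : ℝ, f = C c :=
    exists_eq_algebraMap_of_D_eq_zero hc hf
  set β' := (𝒮).D .t ((𝒮).energyCoeff G)
  have hD {a : Direction n} (ha : a ≠ .t) : (𝒮).D a β' = 0 := D_D_t_energyCoeff_eq_zero h hn hF' ha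
  obtain ⟨d, hd⟩ : ∃ d : ℝ, (𝒮).D .t β' = C d := hconst fun a => by
    rcases eq_or_ne a .t with rfl | ha
    · exact h.D_t_D_t_D_t_energyCoeff hn
    · rw [(𝒮).comm, hD ha, map_zero]
  obtain ⟨b₁, hb₁⟩ : ∃ b₁ : ℝ, β' - C d * timeElt n Ω = C b₁ := hconst fun a => by
    rcases eq_or_ne a .t with rfl | ha
    · simp [hd]
    · rw [map_sub, hD ha]
      cases a <;> simp at ha ⊢
  refine ⟨b₁, d / 2, ?_⟩
  have hb : 2 * C (b₁ / 2) = C b₁ := two_mul_algebraMap_div_two b₁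
  have hd : 2 * C (d / 2) = C d := two_mul_algebraMap_div_two d
  simp only [D_polytropicCoeff, dilationRate]
  linear_combination hb₁ - hb - timeElt n Ω * hd

lemma fderiv_stateFunction_of_D_t_energyCoeff_ne_zero (hc : IsConnected Ω)
    (hβ : (𝒮).D .t ((𝒮).energyCoeff G) ≠ 0) {q : ℝ × ℝ} (hq : q ∈ Ω) :
    fderiv ℝ F q (0, 1) = 0 ∧ n * fderiv ℝ F q (1, 0) = n + 2 := by
  obtain ⟨⟨⟨t, x, w⟩, hw⟩, hne⟩ : ∃ z, ((𝒮).D .t ((𝒮).energyCoeff G)).1 z ≠ 0 :=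
    Function.ne_iff.1 fun h0 => hβ (Subtype.ext h0)
  let z : stateDomain n Ω := ⟨(t, x, 0, q.2, q.1), hq⟩
  have hz : ((𝒮).D .t ((𝒮).energyCoeff G)).1 z ≠ 0 := by
    rwa [apply_fluid_eq_of_D_eq_zero hc.isPreconnected
      (fun i => D_D_t_energyCoeff_eq_zero h hn hF' (by simp))
      (D_D_t_energyCoeff_eq_zero h hn hF' (by simp))
      (D_D_t_energyCoeff_eq_zero h hn hF' (by simp)) t x (w' := w) hq hw]
  have hr : ((𝒮).D .t ((𝒮).energyCoeff G)).1 z * fderiv ℝ F q (0, 1) = 0 :=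
    (congrArg _ (smoothDeriv_thermoFun_apply hΩ F hF Direction.r.vec z)).symm.trans
      (congrArg (·.1 z) (h.D_t_energyCoeff_mul_D_r_F hn hF'))
  have hp : n * ((𝒮).D .t ((𝒮).energyCoeff G)).1 z * fderiv ℝ F q (1, 0) =
      (n + 2) * ((𝒮).D .t ((𝒮).energyCoeff G)).1 z :=
    (congrArg _ (smoothDeriv_thermoFun_apply hΩ F hF Direction.p.vec z)).symm.trans
      (congrArg (·.1 z) (h.D_t_energyCoeff_mul_D_p_F hn hF'))
  exact ⟨(mul_eq_zero.1 hr).resolve_left hz, mul_left_cancel₀ hz (by linear_combination hp)⟩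

end EnergyCoeff

lemma exists_isSpecialPolytropic_of_fderiv (hΩ : IsOpen Ω) (hF : ContDiffOn ℝ ∞ F Ω)
    (hc : IsConnected Ω) (hn : 0 < n)
    (h : ∀ q ∈ Ω, fderiv ℝ F q (0, 1) = 0 ∧ n * fderiv ℝ F q (1, 0) = n + 2) :
    ∃ p₀, IsSpecialPolytropic n F Ω p₀ := by
  have hn' : (n : ℝ) ≠ 0 := by exact_mod_cast hn.ne'
  have hconst {q : ℝ × ℝ} (hq : q ∈ Ω) : fderiv ℝ (fun q => F q - (1 + 2 / n) * q.1) q = 0 := by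
    obtain ⟨hr, hp⟩ := h q hq
    have hp : fderiv ℝ F q (1, 0) = 1 + 2 / n := by
      field_simp
      linear_combination hp
    have hFq := (hF.contDiffAt (hΩ.mem_nhds hq)).differentiableAt (by simp)
    have hd : HasFDerivAt (fun q : ℝ × ℝ => F q - (1 + 2 / n) * q.1) _ q :=
      hFq.hasFDerivAt.sub ((hasFDerivAt_fst (𝕜 := ℝ)).const_mul _)
    rw [hd.fderiv]
    ext <;> simp [hp, hr]
  obtain ⟨κ, hκ⟩ := hΩ.exists_is_const_of_fderiv_eq_zero hc.isPreconnected
    ((hF.differentiableOn (by simp)).sub (by fun_prop)) fun q hq => hconst hq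
  refine ⟨-κ / (1 + 2 / n), fun p ρ hq => ?_⟩
  have hγ : (1 + 2 / n : ℝ) ≠ 0 := by positivity
  rw [mul_sub, mul_div_cancel₀ _ hγ, ← hκ (p, ρ) hq, Pi.sub_apply]
  ring

lemma IsBasicCombination.congr {e : ℝ × ℝ → ℝ} {T T₀ : KinematicFunction n}
    (h : IsBasicCombination F Ω e T₀)
    (hT : ∀ (t : ℝ) (x u : Space n) (ρ p : ℝ), (p, ρ) ∈ Ω → T t x u ρ p = T₀ t x u ρ p) :
    IsBasicCombination F Ω e T :=
  have ⟨m, a, A, g, b, S, c, he, hS, hc, hT₀⟩ := h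
  ⟨m, a, A, g, b, S, c, he, hS, hc, fun t x u ρ p hq =>
    (hT t x u ρ p hq).trans (hT₀ t x u ρ p hq)⟩

section

variable (hΩ hpos hF)
  (hF_ne : ∀ W : Set (ℝ × ℝ), W ⊆ Ω → IsOpen W → W.Nonempty → ∃ q ∈ W, F q ≠ 0)
include hΩ hpos hF

lemma IsBasicCombination.isConservedDensity (hn : 0 < n) {e : ℝ × ℝ → ℝ} {T : KinematicFunction n}
    (h : IsBasicCombination F Ω e T) : IsConservedDensity F Ω T :=
  have ⟨_, hb⟩ := h.hasNormalForm hΩ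
  hb.isConservedDensity (hΩ := hΩ) (hpos := hpos) (hF := hF) hn

lemma IsSpecialPolytropic.isConservedDensity_add {p₀ : ℝ} {T T₀ : KinematicFunction n}
    (hsp : IsSpecialPolytropic n F Ω p₀) (hn : 0 < n) {e : ℝ × ℝ → ℝ}
    (hT₀ : IsBasicCombination F Ω e T₀) (b₁ b₂ : ℝ)
    (hT : ∀ (t : ℝ) (x u : Space n) (ρ p : ℝ), (p, ρ) ∈ Ω → T t x u ρ p =
      T₀ t x u ρ p + b₁ * similarityEnergy p₀ t x u ρ p + b₂ * dilationalEnergy p₀ t x u ρ p) :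
    IsConservedDensity F Ω T := by
  have hP := hsp.isConservedDensity_similarityEnergy_add_dilationalEnergy hΩ hpos hF b₁ b₂ hn
  set P : KinematicFunction n := fun t x u ρ p =>
    b₁ * similarityEnergy p₀ t x u ρ p + b₂ * dilationalEnergy p₀ t x u ρ p
  have hbasic : IsBasicCombination F Ω e (T - P) := hT₀.congr fun t x u ρ p hq => by
    simp only [Pi.sub_apply, hT t x u ρ p hq, P]
    ring
  rw [← sub_add_cancel T P]
  exact (hbasic.isConservedDensity hΩ hpos hF hn).add hΩ hP

variable (hn : 1 < n) (hc : IsConnected Ω) {p₀ : ℝ} {T : KinematicFunction n}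
include hF_ne hn hc

lemma IsConservedDensity.hasNormalForm_of_not_isSpecialPolytropic
    (hsp : ¬ ∃ p₀, IsSpecialPolytropic n F Ω p₀) (hT : IsConservedDensity F Ω T) :
    ∃ b, HasNormalForm F Ω T b :=
  hT.hasNormalForm (hΩ := hΩ) (hpos := hpos) (hF := hF) hF_ne hn hc <| by
    by_contra hβ
    exact hsp <| exists_isSpecialPolytropic_of_fderiv hΩ hF hc (by omega) fun q hq =>
      fderiv_stateFunction_of_D_t_energyCoeff_ne_zero (hT.isNull hΩ hpos hF) hn
        (thermoFun_mem_nonZeroDivisors hΩ hF hF_ne) hc hβ hq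

lemma IsConservedDensity.exists_hasNormalForm_sub (hsp : IsSpecialPolytropic n F Ω p₀)
    (hT : IsConservedDensity F Ω T) :
    ∃ b₁ b₂ b : ℝ, HasNormalForm F Ω (fun t x u ρ p => T t x u ρ p
      - (b₁ * similarityEnergy p₀ t x u ρ p + b₂ * dilationalEnergy p₀ t x u ρ p)) b := by
  obtain ⟨b₁, b₂, hβ⟩ := exists_D_t_energyCoeff_eq (hT.isNull hΩ hpos hF) hn
    (thermoFun_mem_nonZeroDivisors hΩ hF hF_ne) hc
  set T' : KinematicFunction n := fun t x u ρ p =>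
    T t x u ρ p - (b₁ * similarityEnergy p₀ t x u ρ p + b₂ * dilationalEnergy p₀ t x u ρ p) with hT'
  have hc' : IsConservedDensity F Ω T' := by
    convert hT.add hΩ (hsp.isConservedDensity_similarityEnergy_add_dilationalEnergy hΩ hpos hF
      (-b₁) (-b₂) (by omega)) using 1
    ext t x u ρ p
    simp only [hT', Pi.add_apply]
    ring
  have hG : restrictSmooth T'.onState hc'.contDiffOn =
      restrictSmooth T.onState hT.contDiffOn
        - polytropicElt (stateRing n hΩ hpos F hF) p₀ b₁ b₂ := by
    ext ⟨⟨t, x, u, ρ, p⟩, hq⟩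
    exact congrArg (T t x u ρ p - ·) (polytropicElt_apply p₀ b₁ b₂ t x u hq).symm
  refine ⟨b₁, b₂, hc'.hasNormalForm (hΩ := hΩ) (hpos := hpos) (hF := hF) hF_ne hn hc ?_⟩
  rw [hG, StateRing.energyCoeff_sub, energyCoeff_polytropicElt b₁ b₂ hsp (by omega), map_sub, hβ,
    sub_self]

end

lemma not_isBasicCombination_similarityEnergy (hn : 0 < n) (hne : Ω.Nonempty)
    (hpos : ∀ p ρ : ℝ, (p, ρ) ∈ Ω → 0 < ρ) (p₀ : ℝ) (e : ℝ × ℝ → ℝ) :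
    ¬ IsBasicCombination F Ω e (similarityEnergy (n := n) p₀) := by
  rintro ⟨m, a, A, g, b, S, c, -, -, -, hT⟩
  obtain ⟨⟨p, ρ⟩, hq⟩ := hne
  let v : Space n := EuclideanSpace.single ⟨0, hn⟩ 1
  have hv : ‖v‖ = 1 := by simp [v]
  -- The second difference in `u` at `x = 0` isolates the coefficient of `½ρ|u|²`.
  have hsecond (t : ℝ) : t = b := by
    have h0 := hT t 0 0 ρ p hq
    have h1 := hT t 0 v ρ p hq
    have h2 := hT t 0 (-v) ρ p hq
    simp only [similarityEnergy, polytropicEnergy, mass, momentum, angularMomentum,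
      galileanMomentum, energy, volumetricEntropy, norm_neg, hv, inner_zero_right, PiLp.neg_apply,
      PiLp.zero_apply, norm_zero, mul_neg, mul_zero, sub_zero, Finset.sum_neg_distrib,
      Finset.sum_const_zero] at h0 h1 h2
    exact mul_left_cancel₀ (hpos p ρ hq).ne' (by linear_combination h1 + h2 - 2 * h0)
  linarith [hsecond 0, hsecond 1]

end Classification

end GasDynamics

end

theorem theorem3 (n : ℕ) (hn : 1 < n)
    (Ω : Set (ℝ × ℝ)) (hΩ_open : IsOpen Ω) (hΩ_conn : IsConnected Ω)
    (hΩ_pos : ∀ p ρ : ℝ, (p, ρ) ∈ Ω → 0 < ρ)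
    (F : ℝ × ℝ → ℝ) (hF_smooth : ContDiffOn ℝ ∞ F Ω)
    (hF_ne : ∀ W : Set (ℝ × ℝ), W ⊆ Ω → IsOpen W → W.Nonempty → ∃ q ∈ W, F q ≠ 0) :
    -- the basic densities are conserved for every state function, with every choice of `e`, `S`
    (∀ (e : ℝ × ℝ → ℝ) (T : GasDynamics.KinematicFunction n),
      GasDynamics.IsBasicCombination F Ω e T → GasDynamics.IsConservedDensity F Ω T) ∧
    -- for a general state function there are no others, and any solution `e` may be used
    ((¬ ∃ p₀ : ℝ, GasDynamics.IsSpecialPolytropic n F Ω p₀) →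
      ∀ T : GasDynamics.KinematicFunction n, GasDynamics.IsConservedDensity F Ω T →
        (∃ e : ℝ × ℝ → ℝ, GasDynamics.IsBasicCombination F Ω e T) ∧
        (∀ e : ℝ × ℝ → ℝ, GasDynamics.IsInternalEnergy F Ω e →
          GasDynamics.IsBasicCombination F Ω e T)) ∧
    -- additional conserved densities exist exactly for the special polytropic state function
    ((∃ T : GasDynamics.KinematicFunction n, GasDynamics.IsConservedDensity F Ω T ∧
        ¬ ∃ e : ℝ × ℝ → ℝ, GasDynamics.IsBasicCombination F Ω e T) ↔
      ∃ p₀ : ℝ, GasDynamics.IsSpecialPolytropic n F Ω p₀) ∧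
    -- in that case they are the similarity energy and the dilational energy
    (∀ p₀ : ℝ, GasDynamics.IsSpecialPolytropic n F Ω p₀ →
      ∀ e : ℝ × ℝ → ℝ, GasDynamics.IsInternalEnergy F Ω e →
      ∀ T : GasDynamics.KinematicFunction n,
        GasDynamics.IsConservedDensity F Ω T ↔
          ∃ (b₁ b₂ : ℝ) (T₀ : GasDynamics.KinematicFunction n),
            GasDynamics.IsBasicCombination F Ω e T₀ ∧
            ∀ (t : ℝ) (x u : GasDynamics.Space n) (ρ p : ℝ), (p, ρ) ∈ Ω →
              T t x u ρ p = T₀ t x u ρ p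
                + b₁ * GasDynamics.similarityEnergy p₀ t x u ρ p
                + b₂ * GasDynamics.dilationalEnergy p₀ t x u ρ p) := by
  have hn0 : 0 < n := by omega
  have general (hsp : ¬ ∃ p₀ : ℝ, GasDynamics.IsSpecialPolytropic n F Ω p₀)
      (T : GasDynamics.KinematicFunction n) (hT : GasDynamics.IsConservedDensity F Ω T) :
      (∃ e, GasDynamics.IsBasicCombination F Ω e T) ∧
        ∀ e, GasDynamics.IsInternalEnergy F Ω e → GasDynamics.IsBasicCombination F Ω e T :=
    have ⟨_, hb⟩ := hT.hasNormalForm_of_not_isSpecialPolytropic hΩ_open hΩ_pos hF_smooth hF_ne hn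
      hΩ_conn hsp
    ⟨hb.exists_isBasicCombination hΩ_open, fun _ he => hb.isBasicCombination hΩ_open fun _ => he⟩
  refine ⟨fun e T h => h.isConservedDensity hΩ_open hΩ_pos hF_smooth hn0, general, ⟨?_, ?_⟩,
    fun p₀ hsp e he T => ⟨fun hT => ?_, ?_⟩⟩
  · rintro ⟨T, hT, hne⟩
    by_contra hsp
    exact hne (general hsp T hT).1
  · rintro ⟨p₀, hsp⟩
    have hsim := hsp.isConservedDensity_similarityEnergy_add_dilationalEnergy hΩ_open hΩ_pos
      hF_smooth 1 0 hn0
    simp only [one_mul, zero_mul, add_zero] at hsim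
    exact ⟨_, hsim, fun ⟨e, he⟩ => GasDynamics.not_isBasicCombination_similarityEnergy hn0
      hΩ_conn.nonempty hΩ_pos p₀ e he⟩
  · obtain ⟨b₁, b₂, b, hb⟩ :=
      hT.exists_hasNormalForm_sub hΩ_open hΩ_pos hF_smooth hF_ne hn hΩ_conn hsp
    exact ⟨b₁, b₂, _, hb.isBasicCombination hΩ_open fun _ => he, fun t x u ρ p _ => by ring⟩
  · rintro ⟨b₁, b₂, T₀, hT₀, hT⟩
    exact hsp.isConservedDensity_add hΩ_open hΩ_pos hF_smooth hn0 hT₀ b₁ b₂ hT
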